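/- Let $\Gamma$ be a connected oriented multigraph (multiple edges and loops are allowed) with vertex set $V$ and edge set $E$. For $v\in V$ let $E_v^-$ (resp. $E_v^+$) be the set of edges starting (resp. ending) at $v$. Assume that the degrees $|E_v^-\cup E_v^+|$ are finite and bounded independently of $v$. To each vertex $v$ associate a Riemann sphere $S_v=\mathbb C\cup\{\infty\}$ with standard coordinate $z$. For each edge $e$ from $v$ to $v'$ choose points $p_e^-\in S_v\setminus\{\infty\}$ and $p_e^+\in S_{v'}\setminus\{\infty\}$, and biholomorphic maps $z_e^-:D_e^-\to D(0,\rho)$ and $z_e^+:D_e^+\to D(0,\rho)$ defined on open neighbourhoods $D_e^-\subset S_v$ of $p_e^-$ and $D_e^+\subset S_{v'}$ of $p_e^+$, with $z_e^\pm(p_e^\pm)=0$. Assume that these coordinates are admissible: $\rho>0$ does not depend on $e$; for each $v$ the disks $D_e^-$ ($e\in E_v^-$) and $D_e^+$ ($e\in E_v^+$) are pairwise disjoint in $S_v$; and there are constants $c_1,c_2>0$ such that $$c_1|z_e^\pm(z)|\le |z-p_e^\pm|\le c_2|z_e^\pm(z)|\qquad\text{for all } e\in E,\ z\in D_e^\pm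 .$$ For $\mathbf t=(t_e)_{e\in E}$ with $|t_e|<\rho^2$, let $\Sigma_{\mathbf t}$ be the (possibly noded) Riemann surface obtained from the disjoint union of the spheres $S_v$ as follows. For each edge $e$ with $t_e\ne0$, remove the disks $|z_e^\pm|\le |t_e|/\rho$ and identify $z\in D_e^-$ with $z'\in D_e^+$ whenever $z_e^-(z)\,z_e^+(z')=t_e$. For each edge with $t_e=0$, identify $p_e^-$ and $p_e^+$ to a node. A regular differential on $\Sigma_{\mathbf t}$ is a differential which is holomorphic away from the nodes and has, at the two points $p_e^-,p_e^+$ of each node, at most simple poles, with opposite residues. Let $\gamma_e$ be the homology class in $\Sigma_{\mathbf t}$ of the positively oriented boundary of $D_e^+$, represented by any circle $|z_e^+|=s$ with $|t_e|/\rho<s<\rho$. Fix $0<\epsilon\le\rho c_1$, and let $\Omega_{v,\epsilon}$ be $S_v$ minus the disks $D(p_e^-,\epsilon)$, $e\in E_v^-$, and $D(p_e^+,\epsilon)$, $e\in E_v^+$. Let $\mathcal H^1_\infty(\Sigma_{\mathbf t})$ be the space of regular differentials $\omega$ on $\Sigma_{\mathbf t}$ for which $$\|\omega\|_\infty=\sup_{v\in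 V}\ \sup_{\Omega_{v,\epsilon}}\left|\frac{\omega}{dz}\right|<\infty .$$ Then there is $\delta\in(0,\rho^2]$ such that for every $\mathbf t\in\ell^\infty(E)$ with $\|\mathbf t\|_\infty<\delta$, $\mathcal H^1_\infty(\Sigma_{\mathbf t})$ with $\|\cdot\|_\infty$ is a Banach space, and the period map $$\omega\longmapsto\Big(\int_{\gamma_e}\omega\Big)_{e\in E}$$ is an isomorphism of Banach spaces (a bounded linear bijection with bounded inverse) from $\mathcal H^1_\infty(\Sigma_{\mathbf t})$ onto the subspace of those $\alpha\in\ell^\infty(E)$ (complex sequences, sup norm) which satisfy $$\sum_{e\in E_v^-}\alpha_e=\sum_{e\in E_v^+}\alpha_e\qquad\text{for all } v\in V .$$ -/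

import Mathlib

open scoped ENNReal Topology

noncomputable section

namespace OpeningNodes

/-- An oriented multigraph with vertex set `V` and edge set `E`; multiple edges and loops are
allowed.  The edge `e` goes from `src e` to `tgt e`. -/
structure OrientedMultigraph (V E : Type*) where
  src : E → V
  tgt : E → V

namespace OrientedMultigraph

variable {V E : Type*} (G : OrientedMultigraph V E)

/-- The graph is connected: there is a vertex, and any two vertices are joined by a chain of
edges, whatever the orientations. -/
def Connected : Prop :=
  Nonempty V ∧
    ∀ v w : V, Relation.EqvGen (fun a b => ∃ e : E, G.src e = a ∧ G.tgt e = b) v w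

/-- The set `E_v` of edges adjacent to `v`. -/
def edgesAt (v : V) : Set E := {e | G.src e = v ∨ G.tgt e = v}

/-- The degrees of the vertices are finite and bounded. -/
def BoundedDegree : Prop := ∃ k : ℕ, ∀ v : V, (G.edgesAt v).encard ≤ k

/-- The vertex at the end `b` of the edge `e`: the starting point of `e` for `b = false`
(the side `-`) and its endpoint for `b = true` (the side `+`). -/
def vert (e : E) (b : Bool) : V := if b then G.tgt e else G.src e

end OrientedMultigraph

/-- The points `p_e^±` and the local coordinates `z_e^±` used to open the nodes; the index
`false` stands for `-` and `true` for `+`.  The source of `z e b` is the topological disk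
`D_e^±`. All of this lives in the affine parts `ℂ` of the spheres. -/
structure NodeCoordinates (E : Type*) where
  p : E → Bool → ℂ
  z : E → Bool → OpenPartialHomeomorph ℂ ℂ

namespace NodeCoordinates

variable {V E : Type*} (X : NodeCoordinates E)

/-- Admissible coordinates, with radius `ρ` and constants `c₁`, `c₂`. -/
structure Admissible (G : OrientedMultigraph V E) (ρ c₁ c₂ : ℝ) : Prop where
  rho_pos : 0 < ρ
  c₁_pos : 0 < c₁
  c₂_pos : 0 < c₂
  /-- `z_e^±` is a biholomorphism from `D_e^±` onto the disk `D(0, ρ)` -/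
  target_eq : ∀ e b, (X.z e b).target = Metric.ball 0 ρ
  holo : ∀ e b, DifferentiableOn ℂ (X.z e b) (X.z e b).source
  holo_symm : ∀ e b, DifferentiableOn ℂ (X.z e b).symm (X.z e b).target
  /-- centered at `p_e^±` -/
  p_mem : ∀ e b, X.p e b ∈ (X.z e b).source
  z_p : ∀ e b, X.z e b (X.p e b) = 0
  /-- the disks which lie in the same sphere are pairwise disjoint -/
  disjoint : ∀ e b e' b', (e, b) ≠ (e', b') → G.vert e b = G.vert e' b' →
    Disjoint (X.z e b).source (X.z e' b').source
  /-- uniform comparison with the standard coordinate -/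
  lower : ∀ e b, ∀ z ∈ (X.z e b).source, c₁ * ‖X.z e b z‖ ≤ ‖z - X.p e b‖
  upper : ∀ e b, ∀ z ∈ (X.z e b).source, ‖z - X.p e b‖ ≤ c₂ * ‖X.z e b z‖

end NodeCoordinates

section Surface

variable {V E : Type*} (G : OrientedMultigraph V E) (X : NodeCoordinates E) (ρ : ℝ)
  (t : E → ℂ) (ε : ℝ)

/-- The part of the sphere `S_v` that remains in `Σ_t` away from the nodes, in the standard
coordinate (so without the point `∞`): for each end of an edge at `v`, the closed disk
`|z_e^±| ≤ |t_e| / ρ` is removed.  If `t_e = 0`, this disk is the point `p_e^±` itself. -/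
def part (v : V) : Set ℂ :=
  {z | ∀ e b, G.vert e b = v → ¬ (z ∈ (X.z e b).source ∧ ‖X.z e b z‖ ≤ ‖t e‖ / ρ)}

/-- The annulus `|t_e| / ρ < |z_e^-| < ρ` in the sphere of the starting point of `e`. -/
def neck (e : E) : Set ℂ :=
  {z | z ∈ (X.z e false).source ∧ ‖t e‖ / ρ < ‖X.z e false z‖}

/-- The gluing map `φ_e^+ = (z_e^+)⁻¹ ∘ (t_e / z_e^-)`: a point `z` of `neck e` is identified with
the point `z'` of `D_e^+` such that `z_e^-(z) z_e^+(z') = t_e`. -/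
def glue (e : E) (z : ℂ) : ℂ := (X.z e true).symm (t e / X.z e false z)

/-- `f dz` is holomorphic at the point `∞` of the Riemann sphere: in the coordinate `w = 1 / z`
it is `f (1 / w) (-1 / w²) dw`, and this extends holomorphically to `w = 0`. -/
def HolomorphicAtInfinity (f : ℂ → ℂ) : Prop :=
  ∃ g : ℂ → ℂ, AnalyticAt ℂ g 0 ∧ ∀ᶠ w in 𝓝[≠] (0 : ℂ), f w⁻¹ * (-(w ^ 2)⁻¹) = g w

/-- `f dz` has at `p` at most a simple pole, with residue `a`. -/
def HasSimplePoleAt (f : ℂ → ℂ) (p a : ℂ) : Prop :=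
  ∃ g : ℂ → ℂ, AnalyticAt ℂ g p ∧ ∀ᶠ z in 𝓝[≠] p, f z = a / (z - p) + g z

/-- Regular differentials on the (possibly noded) Riemann surface `Σ_t`.  A differential is given
by its local expressions `f v dz` in the standard coordinate of each sphere `S_v`. They have
to agree under the identifications which define `Σ_t`. -/
structure IsRegularDifferential (f : V → ℂ → ℂ) : Prop where
  /-- normalisation: `f v` is meaningful on `part v` only, and is extended by `0` -/
  off_part : ∀ v, ∀ z ∉ part G X ρ t v, f v z = 0
  holo : ∀ v, DifferentiableOn ℂ (f v) (part G X ρ t v)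
  holo_infty : ∀ v, HolomorphicAtInfinity (f v)
  /-- along an open neck, `(φ_e^+)^* ω = ω` -/
  glue_eq : ∀ e, t e ≠ 0 → ∀ z ∈ neck X ρ t e,
    f (G.src e) z = f (G.tgt e) (glue X t e z) * deriv (glue X t e) z
  /-- at a node, simple poles with opposite residues -/
  node : ∀ e, t e = 0 → ∃ a : ℂ,
    HasSimplePoleAt (f (G.src e)) (X.p e false) (-a) ∧
    HasSimplePoleAt (f (G.tgt e)) (X.p e true) a

/-- The domain `Ω_{v,ε}`: the sphere `S_v` minus the round disks `D(p_e^±, ε)`.  The point `∞` is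
left out, as `ω / dz` vanishes there. -/
def core (v : V) : Set ℂ := {z | ∀ e b, G.vert e b = v → ε ≤ ‖z - X.p e b‖}

theorem HolomorphicAtInfinity.add {f g : ℂ → ℂ} (hf : HolomorphicAtInfinity f)
    (hg : HolomorphicAtInfinity g) : HolomorphicAtInfinity (f + g) := by
  obtain ⟨F, hF, hF'⟩ := hf
  obtain ⟨K, hK, hK'⟩ := hg
  refine ⟨F + K, hF.add hK, ?_⟩
  filter_upwards [hF', hK'] with w h1 h2
  simp only [Pi.add_apply, ← h1, ← h2]
  ring

theorem HolomorphicAtInfinity.smul {f : ℂ → ℂ} (c : ℂ) (hf : HolomorphicAtInfinity f) :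
    HolomorphicAtInfinity (c • f) := by
  obtain ⟨F, hF, hF'⟩ := hf
  refine ⟨fun w => c * F w, analyticAt_const.mul hF, ?_⟩
  filter_upwards [hF'] with w h1
  simp only [Pi.smul_apply, smul_eq_mul, ← h1]
  ring

theorem HasSimplePoleAt.add {f g : ℂ → ℂ} {p a b : ℂ} (hf : HasSimplePoleAt f p a)
    (hg : HasSimplePoleAt g p b) : HasSimplePoleAt (f + g) p (a + b) := by
  obtain ⟨F, hF, hF'⟩ := hf
  obtain ⟨K, hK, hK'⟩ := hg
  refine ⟨F + K, hF.add hK, ?_⟩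
  filter_upwards [hF', hK'] with w h1 h2
  simp only [Pi.add_apply, h1, h2]
  ring

theorem HasSimplePoleAt.smul {f : ℂ → ℂ} {p a : ℂ} (c : ℂ) (hf : HasSimplePoleAt f p a) :
    HasSimplePoleAt (c • f) p (c * a) := by
  obtain ⟨F, hF, hF'⟩ := hf
  refine ⟨fun w => c * F w, analyticAt_const.mul hF, ?_⟩
  filter_upwards [hF'] with w h1
  simp only [Pi.smul_apply, smul_eq_mul, h1]
  ring

/-- The vector space of regular differentials on `Σ_t` whose coefficient `ω / dz` is bounded on
the union of the domains `Ω_{v,ε}`. -/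
def H1Submodule : Submodule ℂ (V → ℂ → ℂ) where
  carrier := {f | IsRegularDifferential G X ρ t f ∧
    ∃ C : ℝ, ∀ v, ∀ z ∈ core G X ε v, ‖f v z‖ ≤ C}
  zero_mem' := by
    refine ⟨⟨fun _ _ _ => rfl, fun _ => differentiableOn_const 0, fun _ => ?_, ?_, ?_⟩,
      0, by simp⟩
    · exact ⟨0, analyticAt_const, by simp⟩
    · intro e _ z _
      simp
    · intro e _
      refine ⟨0, ⟨0, analyticAt_const, by simp⟩, ⟨0, analyticAt_const, by simp⟩⟩
  add_mem' := by
    rintro f g ⟨hf, C, hC⟩ ⟨hg, D, hD⟩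
    refine ⟨⟨?_, fun v => (hf.holo v).add (hg.holo v),
      fun v => (hf.holo_infty v).add (hg.holo_infty v), ?_, ?_⟩, C + D, ?_⟩
    · intro v z hz
      simp [hf.off_part v z hz, hg.off_part v z hz]
    · intro e he z hz
      simp only [Pi.add_apply, hf.glue_eq e he z hz, hg.glue_eq e he z hz]
      ring
    · intro e he
      obtain ⟨a, h1, h2⟩ := hf.node e he
      obtain ⟨b, h3, h4⟩ := hg.node e he
      exact ⟨a + b, by rw [neg_add]; exact h1.add h3, h2.add h4⟩
    · intro v z hz
      exact (norm_add_le _ _).trans (add_le_add (hC v z hz) (hD v z hz))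
  smul_mem' := by
    rintro c f ⟨hf, C, hC⟩
    refine ⟨⟨?_, fun v => (hf.holo v).const_smul c, fun v => (hf.holo_infty v).smul c, ?_, ?_⟩,
      ‖c‖ * C, ?_⟩
    · intro v z hz
      simp [hf.off_part v z hz]
    · intro e he z hz
      simp only [Pi.smul_apply, smul_eq_mul, hf.glue_eq e he z hz]
      ring
    · intro e he
      obtain ⟨a, h1, h2⟩ := hf.node e he
      exact ⟨c * a, by rw [← mul_neg]; exact h1.smul c, h2.smul c⟩
    · intro v z hz
      simp only [Pi.smul_apply, smul_eq_mul, norm_mul]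
      exact mul_le_mul_of_nonneg_left (hC v z hz) (norm_nonneg c)

/-- The space `H¹_∞(Σ_t)`.  It is a type of its own so that its topology is the one of the norm
below. -/
def H1 : Type _ := ↥(H1Submodule G X ρ t ε)

instance : AddCommGroup (H1 G X ρ t ε) := inferInstanceAs (AddCommGroup ↥(H1Submodule G X ρ t ε))

instance : Module ℂ (H1 G X ρ t ε) := inferInstanceAs (Module ℂ ↥(H1Submodule G X ρ t ε))

variable {G X ρ t ε}

/-- The coefficient `ω / dz` of a differential in the sphere `S_v`. -/
def H1.coeff (ω : H1 G X ρ t ε) (v : V) (z : ℂ) : ℂ := ω.1 v z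

theorem H1.coeff_zero (v : V) (z : ℂ) : (0 : H1 G X ρ t ε).coeff v z = 0 := rfl

theorem H1.coeff_add (ω η : H1 G X ρ t ε) (v : V) (z : ℂ) :
    (ω + η).coeff v z = ω.coeff v z + η.coeff v z := rfl

theorem H1.coeff_neg (ω : H1 G X ρ t ε) (v : V) (z : ℂ) :
    (-ω).coeff v z = -ω.coeff v z := rfl

theorem H1.coeff_smul (c : ℂ) (ω : H1 G X ρ t ε) (v : V) (z : ℂ) :
    (c • ω).coeff v z = c * ω.coeff v z := rfl

theorem H1.bddAbove (ω : H1 G X ρ t ε) :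
    BddAbove (Set.range fun x : (Σ v : V, ↥(core G X ε v)) => ‖ω.coeff x.1 x.2‖) := by
  obtain ⟨C, hC⟩ := ω.2.2
  exact ⟨C, by rintro _ ⟨⟨v, z, hz⟩, rfl⟩; exact hC v z hz⟩

variable (G X ρ t ε)

/-- The norm `‖ω‖_∞ = sup_v sup_{Ω_{v,ε}} |ω / dz|`. -/
def H1.supNorm : AddGroupSeminorm (H1 G X ρ t ε) where
  toFun ω := ⨆ x : (Σ v : V, ↥(core G X ε v)), ‖ω.coeff x.1 x.2‖
  map_zero' := by simp [H1.coeff_zero]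
  add_le' ω η := by
    refine Real.iSup_le (fun x => ?_)
      (add_nonneg (Real.iSup_nonneg fun _ => norm_nonneg _)
        (Real.iSup_nonneg fun _ => norm_nonneg _))
    rw [H1.coeff_add]
    exact (norm_add_le _ _).trans (add_le_add (le_ciSup ω.bddAbove x) (le_ciSup η.bddAbove x))
  neg' ω := by simp [H1.coeff_neg]

instance : SeminormedAddCommGroup (H1 G X ρ t ε) :=
  (H1.supNorm G X ρ t ε).toSeminormedAddCommGroup

variable {G X ρ t ε} in
theorem H1.norm_def (ω : H1 G X ρ t ε) :
    ‖ω‖ = ⨆ x : (Σ v : V, ↥(core G X ε v)), ‖ω.coeff x.1 x.2‖ := rfl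

instance : NormedSpace ℂ (H1 G X ρ t ε) where
  norm_smul_le c ω := by
    rw [H1.norm_def, H1.norm_def]
    refine Real.iSup_le (fun x => ?_)
      (mul_nonneg (norm_nonneg c) (Real.iSup_nonneg fun _ => norm_nonneg _))
    rw [H1.coeff_smul, norm_mul]
    exact mul_le_mul_of_nonneg_left (le_ciSup ω.bddAbove x) (norm_nonneg c)

variable {G X ρ t ε} in
/-- The period `∫_{γ_e} ω`, where `γ_e` is the homology class of `∂D_e^+` in `Σ_t`. It is computed
on the representative `|z_e^+| = s`, positively oriented, with `s` the middle of the interval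
`(|t_e| / ρ, ρ)`, and written in the coordinate `w = z_e^+`. -/
def H1.period (ω : H1 G X ρ t ε) (e : E) : ℂ :=
  ∮ w in C(0, (‖t e‖ / ρ + ρ) / 2),
    ω.coeff (G.tgt e) ((X.z e true).symm w) * deriv (X.z e true).symm w

end Surface

/-- The subspace of the bounded sequences `α` such that, for every vertex `v`, the sum of the `α_e`
over the edges `e` which start at `v` equals the sum over the edges which end at `v`. -/
def compatible {V E : Type*} (G : OrientedMultigraph V E) (hG : G.BoundedDegree) :
    Submodule ℂ (lp (fun _ : E => ℂ) ∞) where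
  carrier := {α | ∀ v, ∑ᶠ e ∈ {e | G.src e = v}, α e = ∑ᶠ e ∈ {e | G.tgt e = v}, α e}
  zero_mem' := by simp
  add_mem' := by
    intro α β hα hβ v
    obtain ⟨k, hk⟩ := hG
    have hfin : (G.edgesAt v).Finite := Set.finite_of_encard_le_coe (hk v)
    have h1 : {e | G.src e = v}.Finite := hfin.subset fun e he => Or.inl he
    have h2 : {e | G.tgt e = v}.Finite := hfin.subset fun e he => Or.inr he
    simp only [lp.coeFn_add, Pi.add_apply]
    rw [finsum_mem_add_distrib h1, finsum_mem_add_distrib h2, hα v, hβ v]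
  smul_mem' := by
    intro c α hα v
    obtain ⟨k, hk⟩ := hG
    have hfin : (G.edgesAt v).Finite := Set.finite_of_encard_le_coe (hk v)
    have h1 : {e | G.src e = v}.Finite := hfin.subset fun e he => Or.inl he
    have h2 : {e | G.tgt e = v}.Finite := hfin.subset fun e he => Or.inr he
    simp only [lp.coeFn_smul, Pi.smul_apply]
    rw [← smul_finsum_mem h1, ← smul_finsum_mem h2, hα v]

end OpeningNodes

end

/-! Each edge has two ends, indexed by `E × Bool`. Write `F i` for the coefficient of ω in the local
coordinate at the end `i` (`endForm`). Across an open neck the gluing condition says that `F i` is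
the pullback of `F (opp i)` under `ζ ↦ t / ζ` (`reflect`).

On one sphere, ω/dz is holomorphic off finitely many disks and tends to 0 at ∞. By Liouville it is
the sum of Cauchy integrals along the small curves |z_i| = |t|/(ρ/2), with a simple pole in place of
the integral when t = 0. Reflection moves the integral at `i` to the circle of radius ρ/2 at the
other end of the edge. Separating the pole at p_i gives `modelPart`: the pole a/(2πi(z - p_i)), with
a = ± the period, plus an error O(|t|) times the sup of `F (opp i)` on that circle
(`norm_modelPart_sub_pole_le`). The formula covers t = 0, where only the pole remains. Thus the
periods α and the family g of restrictions of the `F i` to the circles |z_i| = ρ/2 determine ω, and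
g solves an affine fixed point equation whose linear part is O(‖t‖_∞) on ℓ^∞ families of continuous
functions. Bounded degree keeps the constants uniform.

Surjectivity: for given α the equation is a contraction (`exists_fixedPoint`). A fixed point
satisfies the gluing conditions because the defect F_i - reflect F_{opp i} extends across the disk
at both ends, hence gives a holomorphic differential on a sphere, which is zero
(`eq_zero_of_eq_neg_reflect`, `endForm_modelSum_eq_reflect`). Since z · `modelPart` tends to
a/(2πi), regularity at ∞ is exactly the compatibility of α at the vertex.

Boundedness and injectivity: the norm only sees the core, so the circles |z_i| = ρ/2 must be
controlled from there. A contour integral bounds the periods, the maximum principle bounds the `F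
i`, each up to O(|t|) times the size at the other end, and the latter is absorbed
(`norm_endForm_le_of_small`). If all periods vanish only the O(|t|) terms survive, so ‖ω‖ ≤ ‖ω‖/2.
Completeness is transported from the closed subspace of compatible sequences. -/

noncomputable section

namespace OpeningNodes

/-! ### Cauchy integrals along curves, jumps, reflection, behaviour at infinity -/

section Analysis

open Complex Metric Set Filter MeasureTheory
open scoped Real

/-- The integral `(2πi)⁻¹ ∮ g(w) / (z - q(w)) dw` over the circle `|w| = r`. -/
def cauchyInt (r : ℝ) (g q : ℂ → ℂ) (z : ℂ) : ℂ :=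
  (2 * π * I)⁻¹ * ∮ w in C(0, r), g w * (z - q w)⁻¹

theorem two_pi_I_ne : (2 * π * I : ℂ) ≠ 0 := by simp [Real.pi_ne_zero]

theorem norm_two_pi_I : ‖(2 * π * I : ℂ)‖ = 2 * π := by
  simp [abs_of_pos Real.pi_pos]

theorem cauchyInt_congr {r : ℝ} (hr : 0 ≤ r) {g g' q q' : ℂ → ℂ}
    (hg : EqOn g g' (sphere 0 r)) (hq : EqOn q q' (sphere 0 r)) (z : ℂ) :
    cauchyInt r g q z = cauchyInt r g' q' z := by
  unfold cauchyInt
  congr 1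
  refine circleIntegral.integral_congr hr fun w hw => ?_
  simp only [hg hw, hq hw]

theorem norm_cauchyInt_le {r : ℝ} (hr : 0 ≤ r) {g q : ℂ → ℂ} {z : ℂ} {N : ℝ}
    (h : ∀ w ∈ sphere (0 : ℂ) r, ‖g w * (z - q w)⁻¹‖ ≤ N) : ‖cauchyInt r g q z‖ ≤ r * N := by
  have := circleIntegral.norm_two_pi_i_inv_smul_integral_le_of_norm_le_const hr h
  simpa [cauchyInt] using this

theorem circleIntegrable_cauchyInt {r : ℝ} (hr : 0 ≤ r) {g q : ℂ → ℂ}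
    (hg : ContinuousOn g (sphere 0 r)) (hq : ContinuousOn q (sphere 0 r)) {z : ℂ}
    (hz : z ∉ q '' sphere 0 r) : CircleIntegrable (fun w => g w * (z - q w)⁻¹) 0 r := by
  refine ContinuousOn.circleIntegrable hr (hg.mul ((continuousOn_const.sub hq).inv₀ ?_))
  intro w hw h
  exact hz ⟨w, hw, (sub_eq_zero.1 h).symm⟩

/-- Differentiation under the integral sign: the image curve is compact, so a point off it has a
neighbourhood at distance at least d/2 from the curve, which gives a constant dominating function.
-/
theorem differentiableOn_cauchyInt {r : ℝ} (hr : 0 ≤ r) {g q : ℂ → ℂ}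
    (hg : ContinuousOn g (sphere 0 r)) (hq : ContinuousOn q (sphere 0 r)) :
    DifferentiableOn ℂ (cauchyInt r g q) (q '' sphere 0 r)ᶜ := by
  intro z₀ hz₀
  apply DifferentiableAt.differentiableWithinAt
  have hK : IsCompact (q '' sphere 0 r) := (isCompact_sphere 0 r).image_of_continuousOn hq
  obtain ⟨d, hd, hball⟩ := Metric.isOpen_iff.1 hK.isClosed.isOpen_compl z₀ hz₀
  have hmem : ∀ θ : ℝ, circleMap 0 r θ ∈ sphere (0 : ℂ) r := circleMap_mem_sphere 0 hr
  have hfar : ∀ z ∈ ball z₀ (d / 2), ∀ θ : ℝ, d / 2 ≤ ‖z - q (circleMap 0 r θ)‖ := by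
    intro z hz θ
    have h1 : d ≤ ‖z₀ - q (circleMap 0 r θ)‖ := by
      by_contra! h
      have h' : q (circleMap 0 r θ) ∈ ball z₀ d := by rwa [mem_ball, dist_comm, dist_eq_norm]
      exact hball h' ⟨_, hmem θ, rfl⟩
    have h2 : ‖z₀ - q (circleMap 0 r θ)‖ ≤ ‖z - z₀‖ + ‖z - q (circleMap 0 r θ)‖ := by
      have := norm_sub_le (z - q (circleMap 0 r θ)) (z - z₀)
      simpa [add_comm] using this
    rw [mem_ball, dist_eq_norm] at hz
    linarith
  have hgc : Continuous fun θ : ℝ => g (circleMap 0 r θ) :=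
    hg.comp_continuous (continuous_circleMap 0 r) hmem
  have hqc : Continuous fun θ : ℝ => q (circleMap 0 r θ) :=
    hq.comp_continuous (continuous_circleMap 0 r) hmem
  obtain ⟨N, hN⟩ := (isCompact_sphere (0 : ℂ) r).exists_bound_of_continuousOn hg
  have hcont : ∀ z ∈ ball z₀ (d / 2), Continuous fun θ : ℝ =>
      deriv (circleMap 0 r) θ • (g (circleMap 0 r θ) * (z - q (circleMap 0 r θ))⁻¹) := by
    intro z hz
    simp only [deriv_circleMap]
    refine ((continuous_circleMap 0 r).mul continuous_const).smul
      (hgc.mul ((continuous_const.sub hqc).inv₀ fun θ h => ?_))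
    have := hfar z hz θ
    simp only [Pi.sub_apply] at h
    rw [h, norm_zero] at this
    linarith
  have hcont' : Continuous fun θ : ℝ =>
      deriv (circleMap 0 r) θ • (g (circleMap 0 r θ) * (-1 / (z₀ - q (circleMap 0 r θ)) ^ 2)) := by
    simp only [deriv_circleMap]
    refine ((continuous_circleMap 0 r).mul continuous_const).smul
      (hgc.mul (continuous_const.div ((continuous_const.sub hqc).pow 2) fun θ h => ?_))
    have := hfar z₀ (mem_ball_self (by positivity)) θ
    rw [pow_eq_zero_iff two_ne_zero] at h
    rw [h, norm_zero] at this
    linarith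
  have hmain := intervalIntegral.hasDerivAt_integral_of_dominated_loc_of_deriv_le
    (𝕜 := ℂ) (μ := volume) (a := 0) (b := 2 * π) (s := ball z₀ (d / 2)) (x₀ := z₀)
    (F := fun z θ => deriv (circleMap 0 r) θ • (g (circleMap 0 r θ) *
      (z - q (circleMap 0 r θ))⁻¹))
    (F' := fun z θ => deriv (circleMap 0 r) θ • (g (circleMap 0 r θ) *
      (-1 / (z - q (circleMap 0 r θ)) ^ 2)))
    (bound := fun _ => r * (N * (1 / (d / 2) ^ 2)))
    (ball_mem_nhds _ (by positivity)) ?_ ?_ ?_ ?_ ?_ ?_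
  · exact (hmain.2.differentiableAt).const_mul _
  · filter_upwards [ball_mem_nhds z₀ (half_pos hd)] with z hz
    exact (hcont z hz).aestronglyMeasurable
  · exact (hcont z₀ (mem_ball_self (by positivity))).intervalIntegrable _ _
  · exact hcont'.aestronglyMeasurable
  · refine Eventually.of_forall fun θ _ z hz => ?_
    have h1 := hfar z hz θ
    have h2 := hN _ (hmem θ)
    simp only [deriv_circleMap, norm_smul, norm_mul, norm_circleMap_zero, norm_I, mul_one,
      norm_div, norm_neg, norm_one, norm_pow, abs_of_nonneg hr]
    have hN0 : 0 ≤ N := (norm_nonneg _).trans h2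
    gcongr
  · exact intervalIntegrable_const
  · refine Eventually.of_forall fun θ _ z hz => ?_
    have h1 := hfar z hz θ
    have hne : z - q (circleMap 0 r θ) ≠ 0 := by
      intro h
      rw [h, norm_zero] at h1
      linarith
    have h2 : HasDerivAt (fun x => (x - q (circleMap 0 r θ))⁻¹)
        (-1 / (z - q (circleMap 0 r θ)) ^ 2) z := ((hasDerivAt_id' z).sub_const _).inv hne
    simp only [smul_eq_mul]
    exact (h2.const_mul (g (circleMap 0 r θ))).const_mul (deriv (circleMap 0 r) θ)

theorem tendsto_cauchyInt_cocompact {r : ℝ} (hr : 0 ≤ r) {g q : ℂ → ℂ}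
    (hg : ContinuousOn g (sphere 0 r)) (hq : ContinuousOn q (sphere 0 r)) :
    Tendsto (cauchyInt r g q) (cocompact ℂ) (𝓝 0) := by
  obtain ⟨N, hN⟩ := (isCompact_sphere (0 : ℂ) r).exists_bound_of_continuousOn hg
  obtain ⟨Q, hQ⟩ := (isCompact_sphere (0 : ℂ) r).exists_bound_of_continuousOn hq
  have h1 : Tendsto (fun z : ℂ => ‖z‖ - Q) (cocompact ℂ) atTop :=
    tendsto_atTop_add_const_right _ _ (tendsto_norm_cocompact_atTop)
  have h2 : Tendsto (fun z : ℂ => r * (N * (‖z‖ - Q)⁻¹)) (cocompact ℂ) (𝓝 0) := by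
    simpa using ((tendsto_inv_atTop_zero.comp h1).const_mul N).const_mul r
  refine squeeze_zero_norm' ?_ h2
  filter_upwards [h1.eventually (eventually_gt_atTop 0)] with z hz
  refine norm_cauchyInt_le hr fun w hw => ?_
  have h3 : ‖z‖ - Q ≤ ‖z - q w‖ := by
    have := norm_sub_norm_le z (q w)
    have := hQ w hw
    linarith
  have hN0 : 0 ≤ N := (norm_nonneg _).trans (hN w hw)
  rw [norm_mul, norm_inv]
  have := hN w hw
  gcongr

/-- From z/(z - q) = 1 + q/(z - q), the product is the normalised integral of `g` plus the Cauchy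
integral of `g * q`, and the latter tends to 0. -/
theorem tendsto_mul_cauchyInt {r : ℝ} (hr : 0 ≤ r) {g q : ℂ → ℂ}
    (hg : ContinuousOn g (sphere 0 r)) (hq : ContinuousOn q (sphere 0 r)) :
    Tendsto (fun z => z * cauchyInt r g q z) (cocompact ℂ)
      (𝓝 ((2 * π * I)⁻¹ * ∮ w in C(0, r), g w)) := by
  have h := (tendsto_cauchyInt_cocompact hr (hg.mul hq) hq).const_add
    ((2 * π * I)⁻¹ * ∮ w in C(0, r), g w)
  rw [add_zero] at h
  refine h.congr' ?_
  have hK : IsCompact (q '' sphere 0 r) := (isCompact_sphere 0 r).image_of_continuousOn hq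
  filter_upwards [hK.compl_mem_cocompact] with z hz
  have hi1 : CircleIntegrable g 0 r := ContinuousOn.circleIntegrable hr hg
  have hi2 := circleIntegrable_cauchyInt hr (hg.mul hq) hq hz
  unfold cauchyInt
  rw [← mul_add, ← circleIntegral.integral_add hi1 hi2, mul_left_comm z,
    ← circleIntegral.integral_const_mul z]
  congr 1
  refine circleIntegral.integral_congr hr fun w hw => ?_
  have hne : z - q w ≠ 0 := fun h => hz ⟨w, hw, (sub_eq_zero.1 h).symm⟩
  simp only [Pi.mul_apply]
  field_simp
  ring

/-- The difference between a Cauchy integral along a small curve around `p` and the corresponding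
simple pole at `p` is small. -/
theorem norm_cauchyInt_sub_pole_le {r : ℝ} (hr : 0 ≤ r) {g q : ℂ → ℂ}
    (hg : ContinuousOn g (sphere 0 r)) (hq : ContinuousOn q (sphere 0 r)) {p z : ℂ} {κ d N : ℝ}
    (hd : 0 < d) (hκ : κ ≤ d / 2) (hqκ : ∀ w ∈ sphere (0 : ℂ) r, ‖q w - p‖ ≤ κ)
    (hN : ∀ w ∈ sphere (0 : ℂ) r, ‖g w‖ ≤ N) (hz : d ≤ ‖z - p‖) :
    ‖(2 * π * I)⁻¹ * (∮ w in C(0, r), g w) * (z - p)⁻¹ - cauchyInt r g q z‖ ≤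
      r * (N * (2 * κ / d ^ 2)) := by
  have hfar : ∀ w ∈ sphere (0 : ℂ) r, d / 2 ≤ ‖z - q w‖ := by
    intro w hw
    have h1 := hqκ w hw
    have h2 : ‖z - p‖ ≤ ‖z - q w‖ + ‖q w - p‖ := by
      have := norm_add_le (z - q w) (q w - p)
      simpa using this
    linarith
  have hz' : z ∉ q '' sphere 0 r := by
    rintro ⟨w, hw, rfl⟩
    have := hfar w hw
    rw [sub_self, norm_zero] at this
    linarith
  have hzp : z - p ≠ 0 := by
    intro h
    rw [h, norm_zero] at hz
    linarith
  have hi1 : CircleIntegrable (fun w => (z - p)⁻¹ * g w) 0 r :=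
    (continuousOn_const.mul hg).circleIntegrable hr
  have hi2 := circleIntegrable_cauchyInt hr hg hq hz'
  have heq : (2 * π * I)⁻¹ * (∮ w in C(0, r), g w) * (z - p)⁻¹ - cauchyInt r g q z =
      (2 * π * I)⁻¹ • ∮ w in C(0, r), ((z - p)⁻¹ * g w - g w * (z - q w)⁻¹) := by
    rw [circleIntegral.integral_sub hi1 hi2, circleIntegral.integral_const_mul, cauchyInt,
      smul_eq_mul]
    ring
  rw [heq]
  refine circleIntegral.norm_two_pi_i_inv_smul_integral_le_of_norm_le_const hr fun w hw => ?_
  have hzq : z - q w ≠ 0 := by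
    intro h
    have := hfar w hw
    rw [h, norm_zero] at this
    linarith
  have : (z - p)⁻¹ * g w - g w * (z - q w)⁻¹ = g w * ((p - q w) / ((z - p) * (z - q w))) := by
    field_simp
    ring
  rw [this, norm_mul, norm_div, norm_mul, norm_sub_rev p]
  have hN0 : 0 ≤ N := (norm_nonneg _).trans (hN w hw)
  have hκ0 : 0 ≤ κ := (norm_nonneg _).trans (hqκ w hw)
  -- Here 1/(z-p) - 1/(z-q) = (p-q)/((z-p)(z-q)), with |z-p| ≥ d and |z-q| ≥ d/2.
  have h3 : ‖q w - p‖ / (‖z - p‖ * ‖z - q w‖) ≤ κ / (d * (d / 2)) := by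
    have := hfar w hw
    have := hqκ w hw
    gcongr
  have h4 : κ / (d * (d / 2)) = 2 * κ / d ^ 2 := by field_simp
  rw [← h4]
  have := hN w hw
  gcongr

/-- Independence of the radius, for functions which are holomorphic on an open annulus. -/
theorem circleIntegral_eq_of_annulus {s₀ s R ρ : ℝ} (hs : 0 < s) (h0 : s₀ < s) (h1 : s ≤ R)
    (h2 : R < ρ) {F : ℂ → ℂ} (hF : DifferentiableOn ℂ F {w | s₀ < ‖w‖ ∧ ‖w‖ < ρ}) :
    (∮ w in C(0, R), F w) = ∮ w in C(0, s), F w := by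
  have hopen : IsOpen {w : ℂ | s₀ < ‖w‖ ∧ ‖w‖ < ρ} :=
    (isOpen_lt continuous_const continuous_norm).inter (isOpen_lt continuous_norm continuous_const)
  refine circleIntegral_eq_of_differentiable_on_annulus_off_countable hs h1 countable_empty
    (hF.continuousOn.mono ?_) ?_
  · rintro w ⟨hw1, hw2⟩
    simp only [mem_closedBall, dist_zero_right, mem_ball, not_lt] at hw1 hw2
    exact ⟨h0.trans_le hw2, hw1.trans_lt h2⟩
  · rintro w ⟨⟨hw1, hw2⟩, -⟩
    simp only [mem_closedBall, dist_zero_right, mem_ball, not_le] at hw1 hw2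
    exact hF.differentiableAt (hopen.mem_nhds ⟨h0.trans hw2, hw1.trans h2⟩)

/-- Cauchy's integral formula on an annulus. -/
theorem circleIntegral_sub_circleIntegral_of_annulus {s₀ s R ρ : ℝ} (hs : 0 < s) (h0 : s₀ < s)
    (h2 : R < ρ) {F : ℂ → ℂ} (hF : DifferentiableOn ℂ F {w | s₀ < ‖w‖ ∧ ‖w‖ < ρ}) {ζ : ℂ}
    (hζ : s < ‖ζ‖) (hζ' : ‖ζ‖ < R) :
    (∮ w in C(0, R), F w * (w - ζ)⁻¹) - (∮ w in C(0, s), F w * (w - ζ)⁻¹) = 2 * π * I * F ζ := by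
  have hopen : IsOpen {w : ℂ | s₀ < ‖w‖ ∧ ‖w‖ < ρ} :=
    (isOpen_lt continuous_const continuous_norm).inter (isOpen_lt continuous_norm continuous_const)
  have hζm : ζ ∈ {w : ℂ | s₀ < ‖w‖ ∧ ‖w‖ < ρ} := ⟨h0.trans hζ, hζ'.trans h2⟩
  have hds : DifferentiableOn ℂ (dslope F ζ) {w | s₀ < ‖w‖ ∧ ‖w‖ < ρ} :=
    (differentiableOn_dslope (hopen.mem_nhds hζm)).2 hF
  have hR : 0 < R := hs.trans (hζ.trans hζ')
  -- The integral of `dslope F ζ` is the same on both circles, since the singularity at ζ is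
  -- removed. It splits into the Cauchy integral and F(ζ) times ∮ 1/(w-ζ), which is 2πi on the outer
  -- circle and 0 on the inner one.
  have key : ∀ t : ℝ, 0 < t → s₀ < t → t < ρ → t ≠ ‖ζ‖ → (∮ w in C(0, t), dslope F ζ w) =
      (∮ w in C(0, t), F w * (w - ζ)⁻¹) - F ζ * ∮ w in C(0, t), (w - ζ)⁻¹ := by
    intro t ht ht0 ht1 hne
    have hne' : ∀ w ∈ sphere (0 : ℂ) t, w ≠ ζ := by
      rintro w hw rfl
      exact hne (by simpa using hw.symm)
    have hsub : sphere (0 : ℂ) t ⊆ {w | s₀ < ‖w‖ ∧ ‖w‖ < ρ} := by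
      intro w hw
      rw [mem_sphere_zero_iff_norm] at hw
      exact ⟨by rw [hw]; exact ht0, by rw [hw]; exact ht1⟩
    have hinv : ContinuousOn (fun w : ℂ => (w - ζ)⁻¹) (sphere (0 : ℂ) t) :=
      (continuousOn_id.sub continuousOn_const).inv₀ fun w hw => sub_ne_zero.2 (hne' w hw)
    rw [← circleIntegral.integral_const_mul, ← circleIntegral.integral_sub]
    · refine circleIntegral.integral_congr ht.le fun w hw => ?_
      simp only [dslope_of_ne _ (hne' w hw), slope, vsub_eq_sub, smul_eq_mul]
      ring
    · exact ((hF.continuousOn.mono hsub).mul hinv).circleIntegrable ht.le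
    · exact (continuousOn_const.mul hinv).circleIntegrable ht.le
  have hann := circleIntegral_eq_of_annulus hs h0 (hζ.trans hζ').le h2 hds
  rw [key R hR (h0.trans (hζ.trans hζ')) h2 hζ'.ne', key s hs h0 (hζ.trans (hζ'.trans h2)) hζ.ne]
    at hann
  have hin : (∮ w in C(0, R), (w - ζ)⁻¹) = 2 * π * I :=
    circleIntegral.integral_sub_inv_of_mem_ball (by simpa using hζ')
  have hout : (∮ w in C(0, s), (w - ζ)⁻¹) = 0 := by
    refine circleIntegral_eq_zero_of_differentiable_on_off_countable hs.le countable_empty ?_ ?_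
    · refine (continuousOn_id.sub continuousOn_const).inv₀ fun w hw h => ?_
      simp only [Pi.sub_apply, id, sub_eq_zero] at h
      rw [mem_closedBall, dist_zero_right, h] at hw
      linarith
    · rintro w ⟨hw, -⟩
      refine (differentiableAt_id.sub_const _).inv fun h => ?_
      simp only [sub_eq_zero] at h
      rw [mem_ball, dist_zero_right, h] at hw
      linarith
  rw [hin, hout] at hann
  linear_combination hann

/-- The jump of a Cauchy integral along the image of a circle under a univalent function `ψ`. -/
theorem cauchyInt_jump {s₀ s R ρ : ℝ} (hs : 0 < s) (h0 : s₀ < s) (h2 : R < ρ) {F ψ : ℂ → ℂ}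
    (hF : DifferentiableOn ℂ F {w | s₀ < ‖w‖ ∧ ‖w‖ < ρ}) (hψ : DifferentiableOn ℂ ψ (ball 0 ρ))
    (hinj : InjOn ψ (ball 0 ρ)) {ζ : ℂ} (hζ : s < ‖ζ‖) (hζ' : ‖ζ‖ < R) (hd : deriv ψ ζ ≠ 0) :
    F ζ = (cauchyInt s F ψ (ψ ζ) - cauchyInt R F ψ (ψ ζ)) * deriv ψ ζ := by
  have hζm : ζ ∈ ball (0 : ℂ) ρ := by simpa using hζ'.trans h2
  have hds : DifferentiableOn ℂ (dslope ψ ζ) (ball 0 ρ) :=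
    (differentiableOn_dslope (isOpen_ball.mem_nhds hζm)).2 hψ
  have hsub : {w : ℂ | s₀ < ‖w‖ ∧ ‖w‖ < ρ} ⊆ ball 0 ρ := fun w hw => by simpa using hw.2
  have hne : ∀ w ∈ ball (0 : ℂ) ρ, dslope ψ ζ w ≠ 0 := by
    intro w hw
    by_cases h : w = ζ
    · rw [h, dslope_same]
      exact hd
    · rw [dslope_of_ne _ h, slope, vsub_eq_sub, smul_eq_mul]
      exact mul_ne_zero (inv_ne_zero (sub_ne_zero.2 h))
        (sub_ne_zero.2 fun h' => h (hinj hw hζm h'))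
  -- Injectivity makes `dslope ψ ζ` zero free, and F(w)/(ψ(ζ)-ψ(w)) = -(F/dslope)(w)/(w-ζ). So the
  -- claim is Cauchy's formula on the annulus for F/dslope, whose value at ζ is F(ζ)/ψ'(ζ).
  have hΦ : DifferentiableOn ℂ (fun w => F w * (dslope ψ ζ w)⁻¹) {w | s₀ < ‖w‖ ∧ ‖w‖ < ρ} :=
    hF.mul ((hds.mono hsub).inv fun w hw => hne w (hsub hw))
  have hmain := circleIntegral_sub_circleIntegral_of_annulus hs h0 h2 hΦ hζ hζ'
  have key : ∀ t : ℝ, 0 < t → t < ρ → t ≠ ‖ζ‖ →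
      (∮ w in C(0, t), F w * (dslope ψ ζ w)⁻¹ * (w - ζ)⁻¹) =
        -(2 * π * I * cauchyInt t F ψ (ψ ζ)) := by
    intro t ht ht1 hne'
    rw [cauchyInt, mul_inv_cancel_left₀ two_pi_I_ne, ← neg_one_mul,
      ← circleIntegral.integral_const_mul]
    refine circleIntegral.integral_congr ht.le fun w hw => ?_
    have hw1 : w ≠ ζ := by
      rintro rfl
      exact hne' (by simpa using hw.symm)
    have hw2 : w ∈ ball (0 : ℂ) ρ := by
      rw [mem_sphere_zero_iff_norm] at hw
      simpa [hw] using ht1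
    have hw3 : ψ w - ψ ζ ≠ 0 := sub_ne_zero.2 fun h' => hw1 (hinj hw2 hζm h')
    have hw4 : ψ ζ - ψ w ≠ 0 := sub_ne_zero.2 fun h' => hw1 (hinj hw2 hζm h'.symm)
    simp only [dslope_of_ne _ hw1, slope, vsub_eq_sub, smul_eq_mul]
    have hw5 : w - ζ ≠ 0 := sub_ne_zero.2 hw1
    rw [← neg_sub (ψ w), inv_neg, mul_inv, inv_inv]
    field_simp
  rw [key R (hs.trans (hζ.trans hζ')) h2 hζ'.ne', key s hs (hζ.trans (hζ'.trans h2)) hζ.ne,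
    dslope_same] at hmain
  have h3 : cauchyInt s F ψ (ψ ζ) - cauchyInt R F ψ (ψ ζ) = F ζ * (deriv ψ ζ)⁻¹ := by
    apply mul_left_cancel₀ two_pi_I_ne
    linear_combination hmain
  rw [h3, inv_mul_cancel_right₀ hd]

/-- The change of variables `ζ ↦ t / ζ` in circle integrals. -/
theorem circleIntegral_reflect {t : ℂ} (ht : t ≠ 0) {r : ℝ} (hr : 0 < r) (f : ℂ → ℂ) :
    (∮ w in C(0, ‖t‖ / r), f w) = ∮ w in C(0, r), f (t / w) * (t / w ^ 2) := by
  set u : ℝ → ℂ := fun θ => deriv (circleMap 0 (‖t‖ / r)) θ • f (circleMap 0 (‖t‖ / r) θ) with hu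
  have hper : Function.Periodic u (2 * π) := by
    intro θ
    simp only [hu, deriv_circleMap, periodic_circleMap (0 : ℂ) (‖t‖ / r) θ]
  -- The angle substitution θ ↦ arg t - θ realises ζ ↦ t/ζ. It reverses the circle, which absorbs
  -- the minus sign of d(t/ζ).
  have h1 : (∫ θ in (0 : ℝ)..2 * π, u (arg t - θ)) = ∫ θ in (0 : ℝ)..2 * π, u θ := by
    rw [intervalIntegral.integral_comp_sub_left (fun θ => u θ) (arg t)]
    have := hper.intervalIntegral_add_eq (arg t - 2 * π) 0
    simpa using this
  have h2 : ∀ θ : ℝ, circleMap 0 (‖t‖ / r) (arg t - θ) = t / circleMap 0 r θ := by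
    intro θ
    have hrc : (r : ℂ) ≠ 0 := by exact_mod_cast hr.ne'
    have h3 : t = ‖t‖ * exp (arg t * I) := (norm_mul_exp_arg_mul_I t).symm
    simp only [circleMap, zero_add]
    rw [eq_div_iff (mul_ne_zero hrc (exp_ne_zero _))]
    conv_rhs => rw [h3]
    push_cast
    rw [sub_mul, exp_sub]
    field_simp
  rw [circleIntegral, circleIntegral, ← h1]
  refine intervalIntegral.integral_congr fun θ _ => ?_
  have hne : circleMap 0 r θ ≠ 0 := circleMap_ne_center hr.ne'
  simp only [hu, deriv_circleMap, h2, smul_eq_mul]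
  field_simp

/-- Holomorphic functions on the pieces of an open cover, the pieces `D i` being pairwise disjoint,
which agree with a function on `W`, are the restrictions of one holomorphic function. -/
theorem exists_piecewise_differentiable {ι : Type*} {W : Set ℂ} {D : ι → Set ℂ} {u : ℂ → ℂ}
    {e : ι → ℂ → ℂ} (hW : IsOpen W) (hD : ∀ i, IsOpen (D i))
    (hdisj : ∀ i j, i ≠ j → Disjoint (D i) (D j)) (hu : DifferentiableOn ℂ u W)
    (he : ∀ i, DifferentiableOn ℂ (e i) (D i)) (heq : ∀ i, EqOn (e i) u (W ∩ D i)) :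
    ∃ Φ : ℂ → ℂ, EqOn Φ u W ∧ (∀ i, EqOn Φ (e i) (D i)) ∧
      DifferentiableOn ℂ Φ (W ∪ ⋃ i, D i) := by
  classical
  let Φ : ℂ → ℂ := fun z => if h : ∃ i, z ∈ D i then e h.choose z else u z
  have h1 : ∀ i, EqOn Φ (e i) (D i) := by
    intro i z hz
    have h : ∃ i, z ∈ D i := ⟨i, hz⟩
    have hi : h.choose = i := by
      by_contra hne
      exact (disjoint_left.1 (hdisj _ _ hne)) h.choose_spec hz
    simp only [Φ, dif_pos h, hi]
  have h2 : EqOn Φ u W := by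
    intro z hz
    by_cases h : ∃ i, z ∈ D i
    · obtain ⟨i, hi⟩ := h
      rw [h1 i hi, heq i ⟨hz, hi⟩]
    · simp only [Φ, dif_neg h]
  refine ⟨Φ, h2, h1, ?_⟩
  intro z hz
  apply DifferentiableAt.differentiableWithinAt
  rcases hz with hz | hz
  · exact (hu.differentiableAt (hW.mem_nhds hz)).congr_of_eventuallyEq
      (h2.eventuallyEq_of_mem (hW.mem_nhds hz))
  · obtain ⟨i, hi⟩ := mem_iUnion.1 hz
    exact ((he i).differentiableAt ((hD i).mem_nhds hi)).congr_of_eventuallyEq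
      ((h1 i).eventuallyEq_of_mem ((hD i).mem_nhds hi))

/-- Liouville's theorem: an entire function which tends to `0` at infinity vanishes. -/
theorem eq_zero_of_tendsto_cocompact {f : ℂ → ℂ} (hf : Differentiable ℂ f)
    (h : Tendsto f (cocompact ℂ) (𝓝 0)) (z : ℂ) : f z = 0 :=
  hf.apply_eq_of_tendsto_cocompact z h

theorem tendsto_inv_nhdsNE_cocompact :
    Tendsto (fun w : ℂ => w⁻¹) (𝓝[≠] 0) (cocompact ℂ) := by
  rw [← Metric.cobounded_eq_cocompact]
  exact Filter.tendsto_inv₀_nhdsNE_zero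

theorem tendsto_inv_cocompact_nhdsNE :
    Tendsto (fun w : ℂ => w⁻¹) (cocompact ℂ) (𝓝[≠] 0) := by
  rw [← Metric.cobounded_eq_cocompact]
  exact Filter.tendsto_inv₀_cobounded'

/-- With w = 1/z and g the coefficient at ∞, z f(z) = -w g(w). -/
theorem HolomorphicAtInfinity.tendsto_mul {f : ℂ → ℂ} (hf : HolomorphicAtInfinity f) :
    Tendsto (fun z => z * f z) (cocompact ℂ) (𝓝 0) := by
  obtain ⟨g, hg, hfg⟩ := hf
  have h1 : Tendsto (fun w : ℂ => -(w * g w)) (𝓝[≠] 0) (𝓝 0) := by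
    have : Tendsto (fun w : ℂ => -(w * g w)) (𝓝 0) (𝓝 (-(0 * g 0))) :=
      (continuousAt_id.mul hg.continuousAt).neg
    simp only [zero_mul, neg_zero] at this
    exact this.mono_left nhdsWithin_le_nhds
  have h2 := h1.comp tendsto_inv_cocompact_nhdsNE
  refine h2.congr' ?_
  have h3 := tendsto_inv_cocompact_nhdsNE.eventually hfg
  have h4 : ∀ᶠ z : ℂ in cocompact ℂ, z ≠ 0 := by
    filter_upwards [(isCompact_singleton (x := (0 : ℂ))).compl_mem_cocompact] with z hz using hz
  filter_upwards [h3, h4] with z hz hz0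
  simp only [Function.comp_apply, ← hz, inv_inv]
  field_simp

/-- Removable singularity: the coefficient G in w = 1/z satisfies w G(w) = -z f(z) → 0, that is G =
o(1/w). With the converse above, regularity at ∞ becomes a limit that is additive over the ends. -/
theorem HolomorphicAtInfinity.of_tendsto_mul {f : ℂ → ℂ}
    (hd : ∀ᶠ z in cocompact ℂ, DifferentiableAt ℂ f z)
    (h : Tendsto (fun z => z * f z) (cocompact ℂ) (𝓝 0)) : HolomorphicAtInfinity f := by
  set G : ℂ → ℂ := fun w => f w⁻¹ * (-(w ^ 2)⁻¹) with hG
  have hGd : ∀ᶠ w in 𝓝[≠] (0 : ℂ), DifferentiableAt ℂ G w := by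
    filter_upwards [tendsto_inv_nhdsNE_cocompact.eventually hd, self_mem_nhdsWithin] with w hw hw0
    have hw0 : w ≠ 0 := hw0
    refine (DifferentiableAt.comp w hw (differentiableAt_inv hw0)).mul
      (DifferentiableAt.neg (DifferentiableAt.inv (differentiableAt_id.pow 2) ?_))
    exact pow_ne_zero 2 hw0
  have hGw : Tendsto (fun w => w * G w) (𝓝[≠] 0) (𝓝 0) := by
    have h1 := (h.comp tendsto_inv_nhdsNE_cocompact).neg
    rw [neg_zero] at h1
    refine h1.congr' ?_
    filter_upwards [self_mem_nhdsWithin] with w hw0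
    have hw0 : w ≠ 0 := hw0
    simp only [Function.comp_apply, hG]
    field_simp
  have ho : (fun w => G w - G 0) =o[𝓝[≠] 0] fun w => (w - 0)⁻¹ := by
    rw [Asymptotics.isLittleO_iff_tendsto']
    · have h2 : Tendsto (fun w : ℂ => w * G w - w * G 0) (𝓝[≠] 0) (𝓝 0) := by
        have h3 : Tendsto (fun w : ℂ => w * G 0) (𝓝[≠] 0) (𝓝 0) := by
          have : Tendsto (fun w : ℂ => w * G 0) (𝓝 0) (𝓝 (0 * G 0)) :=
            continuousAt_id.mul continuousAt_const
          rw [zero_mul] at this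
          exact this.mono_left nhdsWithin_le_nhds
        simpa using hGw.sub h3
      refine h2.congr fun w => ?_
      simp only [sub_zero, div_inv_eq_mul]
      ring
    · filter_upwards [self_mem_nhdsWithin] with w hw0 h
      have hw0 : w ≠ 0 := hw0
      simp [hw0] at h
  obtain ⟨S, hS, hSd⟩ := eventually_iff_exists_mem.1 hGd
  have hdo := differentiableOn_update_limUnder_insert_of_isLittleO hS
    (fun w hw => (hSd w hw).differentiableWithinAt) ho
  have hnhds : insert 0 S ∈ 𝓝 (0 : ℂ) := by
    rw [← nhdsNE_sup_pure]
    exact Filter.mem_sup.2 ⟨mem_of_superset hS (subset_insert _ _), by simp⟩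
  refine ⟨_, hdo.analyticAt hnhds, ?_⟩
  filter_upwards [self_mem_nhdsWithin] with w hw0
  rw [Function.update_of_ne hw0]

end Analysis

/-! ### Coordinate disks comparable to round disks -/

section Charts

open Complex Metric Set Filter
open scoped Real

/-- A biholomorphic coordinate `φ` from a neighbourhood of `p` onto the disk `D(0, ρ)`, centered at
`p` and comparable to `z - p`. -/
structure IsDiskChart (φ : OpenPartialHomeomorph ℂ ℂ) (p : ℂ) (ρ c₁ c₂ : ℝ) : Prop where
  rho_pos : 0 < ρ
  c₁_pos : 0 < c₁
  c₂_pos : 0 < c₂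
  target_eq : φ.target = ball 0 ρ
  holo : DifferentiableOn ℂ φ φ.source
  holo_symm : DifferentiableOn ℂ φ.symm φ.target
  p_mem : p ∈ φ.source
  map_p : φ p = 0
  lower : ∀ z ∈ φ.source, c₁ * ‖φ z‖ ≤ ‖z - p‖
  upper : ∀ z ∈ φ.source, ‖z - p‖ ≤ c₂ * ‖φ z‖

/-- The closed disk `|φ| ≤ s`. -/
def closedDisk (φ : OpenPartialHomeomorph ℂ ℂ) (s : ℝ) : Set ℂ := {z | z ∈ φ.source ∧ ‖φ z‖ ≤ s}

/-- The open disk `|φ| < s`. -/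
def openDisk (φ : OpenPartialHomeomorph ℂ ℂ) (s : ℝ) : Set ℂ := {z | z ∈ φ.source ∧ ‖φ z‖ < s}

/-- The coefficient of the differential `f dz` in the coordinate `φ`. -/
def chartForm (φ : OpenPartialHomeomorph ℂ ℂ) (f : ℂ → ℂ) (ζ : ℂ) : ℂ :=
  f (φ.symm ζ) * deriv φ.symm ζ

theorem eventually_notMem_cocompact {K : Set ℂ} (hK : IsCompact K) : ∀ᶠ z in cocompact ℂ, z ∉ K :=
  hK.compl_mem_cocompact

theorem tendsto_zero_of_tendsto_mul {u : ℂ → ℂ} {L : ℂ}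
    (h : Tendsto (fun z => z * u z) (cocompact ℂ) (𝓝 L)) : Tendsto u (cocompact ℂ) (𝓝 0) := by
  have h1 : Tendsto (fun z : ℂ => z⁻¹) (cocompact ℂ) (𝓝 0) :=
    tendsto_inv_cocompact_nhdsNE.mono_right nhdsWithin_le_nhds
  have h2 := h1.mul h
  rw [zero_mul] at h2
  refine h2.congr' ?_
  filter_upwards [eventually_notMem_cocompact (isCompact_singleton (x := (0 : ℂ)))] with z hz
  rw [inv_mul_cancel_left₀ hz]

theorem tendsto_mul_inv_sub (p : ℂ) :
    Tendsto (fun z : ℂ => z * (z - p)⁻¹) (cocompact ℂ) (𝓝 1) := by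
  have h := tendsto_mul_cauchyInt (r := 1) zero_le_one (g := fun w => w⁻¹) (q := fun _ => p)
    (continuousOn_id.inv₀ fun w hw h => by
      rw [id] at h
      simp [h] at hw) continuousOn_const
  have h1 : (∮ w in C((0 : ℂ), 1), w⁻¹) = 2 * π * I := by
    simpa using circleIntegral.integral_sub_center_inv (0 : ℂ) one_ne_zero
  have h2 : ∀ z, cauchyInt 1 (fun w => w⁻¹) (fun _ => p) z = (z - p)⁻¹ := by
    intro z
    simp only [cauchyInt]
    simp_rw [mul_comm _ (z - p)⁻¹]
    rw [circleIntegral.integral_const_mul, h1, mul_comm, mul_assoc, mul_inv_cancel₀ two_pi_I_ne,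
      mul_one]
  simp only [h2, h1, inv_mul_cancel₀ two_pi_I_ne] at h
  exact h

namespace IsDiskChart

variable {φ : OpenPartialHomeomorph ℂ ℂ} {p : ℂ} {ρ c₁ c₂ : ℝ}

theorem mem_target (h : IsDiskChart φ p ρ c₁ c₂) {ζ : ℂ} : ζ ∈ φ.target ↔ ‖ζ‖ < ρ := by
  rw [h.target_eq, mem_ball_zero_iff]

theorem symm_mem (h : IsDiskChart φ p ρ c₁ c₂) {ζ : ℂ} (hζ : ‖ζ‖ < ρ) : φ.symm ζ ∈ φ.source :=
  φ.map_target (h.mem_target.2 hζ)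

theorem apply_symm (h : IsDiskChart φ p ρ c₁ c₂) {ζ : ℂ} (hζ : ‖ζ‖ < ρ) : φ (φ.symm ζ) = ζ :=
  φ.right_inv (h.mem_target.2 hζ)

theorem norm_lt (h : IsDiskChart φ p ρ c₁ c₂) {z : ℂ} (hz : z ∈ φ.source) : ‖φ z‖ < ρ :=
  h.mem_target.1 (φ.map_source hz)

theorem symm_zero (h : IsDiskChart φ p ρ c₁ c₂) : φ.symm 0 = p := by
  rw [← h.map_p, φ.left_inv h.p_mem]

theorem injOn_symm (h : IsDiskChart φ p ρ c₁ c₂) : InjOn φ.symm (ball 0 ρ) := by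
  rw [← h.target_eq]
  exact φ.symm.injOn

theorem differentiableOn_symm (h : IsDiskChart φ p ρ c₁ c₂) :
    DifferentiableOn ℂ φ.symm (ball 0 ρ) := by
  rw [← h.target_eq]
  exact h.holo_symm

theorem differentiableAt_symm (h : IsDiskChart φ p ρ c₁ c₂) {ζ : ℂ} (hζ : ‖ζ‖ < ρ) :
    DifferentiableAt ℂ φ.symm ζ :=
  h.differentiableOn_symm.differentiableAt (isOpen_ball.mem_nhds (by simpa using hζ))

theorem differentiableAt (h : IsDiskChart φ p ρ c₁ c₂) {z : ℂ} (hz : z ∈ φ.source) :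
    DifferentiableAt ℂ φ z :=
  h.holo.differentiableAt (φ.open_source.mem_nhds hz)

theorem deriv_mul_deriv_symm (h : IsDiskChart φ p ρ c₁ c₂) {ζ : ℂ} (hζ : ‖ζ‖ < ρ) :
    deriv φ (φ.symm ζ) * deriv φ.symm ζ = 1 := by
  rw [← deriv_comp ζ (h.differentiableAt (h.symm_mem hζ)) (h.differentiableAt_symm hζ)]
  have : φ ∘ φ.symm =ᶠ[𝓝 ζ] id := by
    filter_upwards [φ.open_target.mem_nhds (h.mem_target.2 hζ)] with w hw
    exact φ.right_inv hw
  rw [this.deriv_eq, deriv_id]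

theorem deriv_symm_ne_zero (h : IsDiskChart φ p ρ c₁ c₂) {ζ : ℂ} (hζ : ‖ζ‖ < ρ) :
    deriv φ.symm ζ ≠ 0 :=
  right_ne_zero_of_mul_eq_one (h.deriv_mul_deriv_symm hζ)

theorem norm_symm_sub_le (h : IsDiskChart φ p ρ c₁ c₂) {ζ : ℂ} (hζ : ‖ζ‖ < ρ) :
    ‖φ.symm ζ - p‖ ≤ c₂ * ‖ζ‖ := by
  simpa only [h.apply_symm hζ] using h.upper _ (h.symm_mem hζ)

theorem le_norm_symm_sub (h : IsDiskChart φ p ρ c₁ c₂) {ζ : ℂ} (hζ : ‖ζ‖ < ρ) :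
    c₁ * ‖ζ‖ ≤ ‖φ.symm ζ - p‖ := by
  simpa only [h.apply_symm hζ] using h.lower _ (h.symm_mem hζ)

theorem symm_mem_openDisk (h : IsDiskChart φ p ρ c₁ c₂) {ζ : ℂ} {s : ℝ} (hζ : ‖ζ‖ < ρ)
    (hs : ‖ζ‖ < s) : φ.symm ζ ∈ openDisk φ s :=
  ⟨h.symm_mem hζ, by rwa [h.apply_symm hζ]⟩

theorem symm_notMem_closedDisk (h : IsDiskChart φ p ρ c₁ c₂) {ζ : ℂ} {s : ℝ} (hζ : ‖ζ‖ < ρ)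
    (hs : s < ‖ζ‖) : φ.symm ζ ∉ closedDisk φ s := fun h' => by
  have := h'.2
  rw [h.apply_symm hζ] at this
  linarith

theorem closedDisk_eq_image (h : IsDiskChart φ p ρ c₁ c₂) {s : ℝ} (hs : s < ρ) :
    closedDisk φ s = φ.symm '' closedBall 0 s := by
  ext z
  constructor
  · rintro ⟨hz, hzs⟩
    exact ⟨φ z, by simpa using hzs, φ.left_inv hz⟩
  · rintro ⟨ζ, hζ, rfl⟩
    rw [mem_closedBall_zero_iff] at hζ
    exact ⟨h.symm_mem (hζ.trans_lt hs), by rwa [h.apply_symm (hζ.trans_lt hs)]⟩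

theorem isCompact_closedDisk (h : IsDiskChart φ p ρ c₁ c₂) {s : ℝ} (hs : s < ρ) :
    IsCompact (closedDisk φ s) := by
  rw [h.closedDisk_eq_image hs]
  exact (isCompact_closedBall 0 s).image_of_continuousOn
    (h.differentiableOn_symm.continuousOn.mono (closedBall_subset_ball hs))

theorem isOpen_openDisk (s : ℝ) : IsOpen (openDisk φ s) := by
  have := φ.isOpen_inter_preimage (isOpen_ball (x := (0 : ℂ)) (ε := s))
  convert this using 1
  ext z
  simp [openDisk]

/-- Connectedness argument. For m < c₁ρ, the points of the source with |z - p| < m lie in the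
compact set |φ| ≤ m/c₁ inside the source, so the source has no boundary point in the ball. -/
theorem ball_subset_source (h : IsDiskChart φ p ρ c₁ c₂) : ball p (c₁ * ρ) ⊆ φ.source := by
  refine (convex_ball p (c₁ * ρ)).isPreconnected.subset_of_closure_inter_subset φ.open_source
    ⟨p, mem_ball_self (mul_pos h.c₁_pos h.rho_pos), h.p_mem⟩ ?_
  rintro z ⟨hz, hzb⟩
  rw [mem_ball, dist_eq_norm] at hzb
  obtain ⟨m, hm1, hm2⟩ := exists_between hzb
  have hs : m / c₁ < ρ := by
    rw [div_lt_iff₀ h.c₁_pos]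
    linarith
  have hcl : z ∈ closure (φ.source ∩ {w | ‖w - p‖ < m}) := by
    have hopen : IsOpen {w : ℂ | ‖w - p‖ < m} :=
      isOpen_lt (continuous_id.sub continuous_const).norm continuous_const
    exact (hopen.closure_inter) ⟨hz, hm1⟩
  have hsub : φ.source ∩ {w | ‖w - p‖ < m} ⊆ closedDisk φ (m / c₁) := by
    rintro w ⟨hw, hwm⟩
    refine ⟨hw, ?_⟩
    rw [le_div_iff₀ h.c₁_pos, mul_comm]
    exact (h.lower w hw).trans (le_of_lt hwm)
  exact (closure_minimal hsub (h.isCompact_closedDisk hs).isClosed hcl).1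

/-- Cauchy's estimate on the disk of radius ρ/4 around ζ, where |φ.symm - p| ≤ c₂ρ. -/
theorem norm_deriv_symm_le (h : IsDiskChart φ p ρ c₁ c₂) {ζ : ℂ} (hζ : ‖ζ‖ = ρ / 2) :
    ‖deriv φ.symm ζ‖ ≤ 4 * c₂ := by
  have hρ := h.rho_pos
  have hsub : closedBall ζ (ρ / 4) ⊆ ball 0 ρ := by
    intro w hw
    rw [mem_closedBall, dist_eq_norm] at hw
    have := norm_add_le (w - ζ) ζ
    rw [sub_add_cancel] at this
    rw [mem_ball_zero_iff]
    linarith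
  have hd : DiffContOnCl ℂ (fun w => φ.symm w - p) (ball ζ (ρ / 4)) := by
    refine DifferentiableOn.diffContOnCl ?_
    rw [closure_ball _ (by positivity)]
    exact (h.differentiableOn_symm.mono hsub).sub_const p
  have := norm_deriv_le_of_forall_mem_sphere_norm_le (C := c₂ * ρ) (by positivity) hd
    fun w hw => by
      have hw' : ‖w‖ < ρ := by simpa using hsub (sphere_subset_closedBall hw)
      exact (h.norm_symm_sub_le hw').trans (mul_le_mul_of_nonneg_left hw'.le h.c₂_pos.le)
  rw [deriv_sub_const] at this
  convert this using 1
  field_simp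

theorem differentiableOn_chartForm (h : IsDiskChart φ p ρ c₁ c₂) {f : ℂ → ℂ} {U S : Set ℂ}
    (hf : DifferentiableOn ℂ f U) (hS : S ⊆ ball 0 ρ) (hSU : MapsTo φ.symm S U) :
    DifferentiableOn ℂ (chartForm φ f) S :=
  (hf.comp (h.differentiableOn_symm.mono hS) hSU).mul
    ((h.differentiableOn_symm.deriv isOpen_ball).mono hS)

theorem differentiableOn_chartForm_annulus (h : IsDiskChart φ p ρ c₁ c₂) {f : ℂ → ℂ} {s : ℝ}
    (hf : DifferentiableOn ℂ f (φ.source \ closedDisk φ s)) :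
    DifferentiableOn ℂ (chartForm φ f) {w | s < ‖w‖ ∧ ‖w‖ < ρ} :=
  h.differentiableOn_chartForm hf (fun w hw => by simpa using hw.2)
    fun w hw => ⟨h.symm_mem hw.2, h.symm_notMem_closedDisk hw.2 hw.1⟩

theorem chartForm_apply (h : IsDiskChart φ p ρ c₁ c₂) {f : ℂ → ℂ} {z : ℂ} (hz : z ∈ φ.source) :
    chartForm φ f (φ z) * deriv φ z = f z := by
  have := h.deriv_mul_deriv_symm (h.norm_lt hz)
  rw [φ.left_inv hz] at this
  rw [chartForm, φ.left_inv hz, mul_assoc, mul_comm (deriv _ _), this, mul_one]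

theorem continuousOn_symm_sphere (h : IsDiskChart φ p ρ c₁ c₂) {s : ℝ} (hs : s < ρ) :
    ContinuousOn φ.symm (sphere 0 s) :=
  h.differentiableOn_symm.continuousOn.mono
    (sphere_subset_closedBall.trans (closedBall_subset_ball hs))

theorem differentiableOn_cauchyInt_outer (h : IsDiskChart φ p ρ c₁ c₂) {s : ℝ} (hs0 : 0 ≤ s)
    (hs : s < ρ) {F : ℂ → ℂ} (hF : ContinuousOn F (sphere 0 s)) :
    DifferentiableOn ℂ (cauchyInt s F φ.symm) (closedDisk φ s)ᶜ := by
  refine (differentiableOn_cauchyInt hs0 hF (h.continuousOn_symm_sphere hs)).mono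
    (compl_subset_compl.2 ?_)
  rw [h.closedDisk_eq_image hs]
  exact image_mono sphere_subset_closedBall

theorem differentiableOn_cauchyInt_inner (h : IsDiskChart φ p ρ c₁ c₂) {s : ℝ} (hs0 : 0 ≤ s)
    (hs : s < ρ) {F : ℂ → ℂ} (hF : ContinuousOn F (sphere 0 s)) :
    DifferentiableOn ℂ (cauchyInt s F φ.symm) (openDisk φ s) := by
  refine (differentiableOn_cauchyInt hs0 hF (h.continuousOn_symm_sphere hs)).mono ?_
  rintro z ⟨-, hz⟩ ⟨w, hw, rfl⟩
  rw [mem_sphere_zero_iff_norm] at hw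
  rw [h.apply_symm (hw.trans_lt hs)] at hz
  linarith

/-- Cauchy's formula for the part of a topological disk between two level curves. -/
theorem eq_cauchyInt_sub_cauchyInt (h : IsDiskChart φ p ρ c₁ c₂) {f : ℂ → ℂ} {s₀ s R : ℝ}
    (hs : 0 < s) (hs₀ : s₀ < s) (hR : R < ρ)
    (hf : DifferentiableOn ℂ f (φ.source \ closedDisk φ s₀)) {z : ℂ} (hz : z ∈ φ.source)
    (hsz : s < ‖φ z‖) (hzR : ‖φ z‖ < R) :
    f z = cauchyInt s (chartForm φ f) φ.symm z - cauchyInt R (chartForm φ f) φ.symm z := by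
  have hne := h.deriv_symm_ne_zero (h.norm_lt hz)
  have := cauchyInt_jump hs hs₀ hR (h.differentiableOn_chartForm_annulus hf)
    h.differentiableOn_symm h.injOn_symm hsz hzR hne
  rw [chartForm, φ.left_inv hz] at this
  exact mul_right_cancel₀ hne this

theorem isOpen_compl_closedDisk (h : IsDiskChart φ p ρ c₁ c₂) {s : ℝ} (hs : s < ρ) :
    IsOpen (closedDisk φ s)ᶜ :=
  (h.isCompact_closedDisk hs).isClosed.isOpen_compl

/-- The residue at infinity. -/
theorem circleIntegral_chartForm (h : IsDiskChart φ p ρ c₁ c₂) {u : ℂ → ℂ} {L : ℂ} {s R : ℝ}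
    (hs : 0 ≤ s) (hsR : s < R) (hR : R < ρ) (hu : DifferentiableOn ℂ u (closedDisk φ s)ᶜ)
    (hL : Tendsto (fun z => z * u z) (cocompact ℂ) (𝓝 L)) :
    (∮ w in C(0, R), chartForm φ u w) = 2 * π * I * L := by
  -- An intermediate radius is needed: `u` is holomorphic only off the closed disk of radius s, and
  -- s may be 0.
  obtain ⟨s₁, h1, h2⟩ := exists_between hsR
  have hs₁ : 0 < s₁ := hs.trans_lt h1
  have hs₁ρ : s₁ < ρ := h2.trans hR
  have hF : DifferentiableOn ℂ (chartForm φ u) {w | s < ‖w‖ ∧ ‖w‖ < ρ} :=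
    h.differentiableOn_chartForm_annulus (hu.mono fun z hz => hz.2)
  have hc : ∀ m, s < m → m < ρ → ContinuousOn (chartForm φ u) (sphere 0 m) := by
    intro m hm hm'
    refine hF.continuousOn.mono fun w hw => ?_
    rw [mem_sphere_zero_iff_norm] at hw
    exact ⟨by rw [hw]; exact hm, by rw [hw]; exact hm'⟩
  have hcl : closedDisk φ s ⊆ closedDisk φ s₁ := fun z hz => ⟨hz.1, hz.2.trans h1.le⟩
  -- By Cauchy's formula, u minus its Cauchy integral on |φ| = s₁ extends inside as minus the Cauchy
  -- integral on |φ| = R. The extension is entire and tends to 0, so u equals the former integral,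
  -- and L is read off from `tendsto_mul_cauchyInt`.
  obtain ⟨Φ, hΦ1, -, hΦ⟩ := exists_piecewise_differentiable (ι := Unit) (W := (closedDisk φ s₁)ᶜ)
    (D := fun _ => openDisk φ R) (u := fun z => u z - cauchyInt s₁ (chartForm φ u) φ.symm z)
    (e := fun _ z => - cauchyInt R (chartForm φ u) φ.symm z)
    (h.isOpen_compl_closedDisk hs₁ρ) (fun _ => isOpen_openDisk R)
    (fun i j hij => (hij rfl).elim)
    ((hu.mono (compl_subset_compl.2 hcl)).sub
      (h.differentiableOn_cauchyInt_outer hs₁.le hs₁ρ (hc s₁ h1 hs₁ρ)))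
    (fun _ => (h.differentiableOn_cauchyInt_inner (hs.trans hsR.le) hR (hc R hsR hR)).neg)
    (fun _ z hz => by
      have hz1 : s₁ < ‖φ z‖ := by
        by_contra! hlt
        exact hz.1 ⟨hz.2.1, hlt⟩
      have := h.eq_cauchyInt_sub_cauchyInt hs₁ h1 hR (hu.mono fun z hz => hz.2) hz.2.1 hz1 hz.2.2
      simp only
      rw [this]
      ring)
  have huniv : (closedDisk φ s₁)ᶜ ∪ ⋃ _ : Unit, openDisk φ R = univ := by
    refine eq_univ_of_forall fun z => ?_
    by_cases hz : z ∈ closedDisk φ s₁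
    · exact Or.inr (mem_iUnion.2 ⟨(), hz.1, hz.2.trans_lt h2⟩)
    · exact Or.inl hz
  rw [huniv, differentiableOn_univ] at hΦ
  have hev := eventually_notMem_cocompact (h.isCompact_closedDisk hs₁ρ)
  have hlim : Tendsto Φ (cocompact ℂ) (𝓝 0) := by
    have := (tendsto_zero_of_tendsto_mul hL).sub
      (tendsto_cauchyInt_cocompact hs₁.le (hc s₁ h1 hs₁ρ) (h.continuousOn_symm_sphere hs₁ρ))
    rw [sub_zero] at this
    refine this.congr' ?_
    filter_upwards [hev] with z hz
    exact (hΦ1 hz).symm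
  have hlim2 := tendsto_mul_cauchyInt hs₁.le (hc s₁ h1 hs₁ρ) (h.continuousOn_symm_sphere hs₁ρ)
  have heq : L = (2 * π * I)⁻¹ * ∮ w in C(0, s₁), chartForm φ u w := by
    refine tendsto_nhds_unique (hL.congr' ?_) hlim2
    filter_upwards [hev] with z hz
    have h3 := hΦ1 hz
    rw [eq_zero_of_tendsto_cocompact hΦ hlim z] at h3
    rw [sub_eq_zero.1 h3.symm]
  rw [circleIntegral_eq_of_annulus hs₁ h1 h2.le hR hF, heq, mul_inv_cancel_left₀ two_pi_I_ne]

end IsDiskChart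

end Charts

/-! ### Model singular parts, and the decomposition of a function into singular parts -/

section Models

open Complex Metric Set Filter
open scoped Real

/-- The pullback of the differential `F dζ` under `ζ ↦ t / ζ`. -/
def reflect (t : ℂ) (F : ℂ → ℂ) (ζ : ℂ) : ℂ := -(t / ζ ^ 2) * F (t / ζ)

theorem reflect_reflect {t : ℂ} (ht : t ≠ 0) (F : ℂ → ℂ) {ζ : ℂ} (hζ : ζ ≠ 0) :
    reflect t (reflect t F) ζ = F ζ := by
  have h1 : t / (t / ζ) = ζ := by field_simp
  simp only [reflect, h1]
  field_simp

theorem norm_div_mem_annulus {t ζ : ℂ} {a b : ℝ} (ht : t ≠ 0)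
    (hζ : ‖t‖ / b < ‖ζ‖) (hζ' : ‖ζ‖ < a) (hb : 0 < b) : ‖t‖ / a < ‖t / ζ‖ ∧ ‖t / ζ‖ < b := by
  have ht' : 0 < ‖t‖ := norm_pos_iff.2 ht
  have h0 : 0 < ‖ζ‖ := (by positivity : 0 ≤ ‖t‖ / b).trans_lt hζ
  rw [norm_div]
  constructor
  · exact div_lt_div_of_pos_left ht' h0 hζ'
  · rw [div_lt_iff₀ h0, mul_comm]
    exact (div_lt_iff₀ hb).1 hζ

theorem differentiableOn_reflect {t : ℂ} (ht : t ≠ 0) {F : ℂ → ℂ} {a b : ℝ} (hb : 0 < b)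
    (hF : DifferentiableOn ℂ F {w | ‖t‖ / a < ‖w‖ ∧ ‖w‖ < b}) :
    DifferentiableOn ℂ (reflect t F) {w | ‖t‖ / b < ‖w‖ ∧ ‖w‖ < a} := by
  have h0 : ∀ w ∈ {w : ℂ | ‖t‖ / b < ‖w‖ ∧ ‖w‖ < a}, w ≠ 0 := by
    rintro w ⟨hw, -⟩ rfl
    rw [norm_zero] at hw
    exact absurd hw (not_lt.2 (by positivity))
  have hdiv : ∀ (c : ℂ) (k : ℕ), DifferentiableOn ℂ (fun w => c / w ^ k)
      {w : ℂ | ‖t‖ / b < ‖w‖ ∧ ‖w‖ < a} := fun c k =>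
    (differentiableOn_const c).div (differentiableOn_id.pow k) fun w hw => pow_ne_zero k (h0 w hw)
  refine (hdiv t 2).neg.mul (hF.comp (by simpa using hdiv t 1) fun w hw => ?_)
  exact norm_div_mem_annulus ht hw.1 hw.2 hb

/-- The minus sign appears because ζ ↦ t/ζ reverses the orientation of circles. The factor `k` is
the constant 1 for periods and the Cauchy kernel for `cauchyInt_reflect`. -/
theorem circleIntegral_reflect_eq {t : ℂ} (ht : t ≠ 0) {r : ℝ} (hr : 0 < r) (F k : ℂ → ℂ) :
    (∮ w in C(0, ‖t‖ / r), reflect t F w * k w) = -∮ w in C(0, r), F w * k (t / w) := by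
  rw [circleIntegral_reflect ht hr, ← neg_one_mul, ← circleIntegral.integral_const_mul]
  refine circleIntegral.integral_congr hr.le fun w hw => ?_
  have hw0 : w ≠ 0 := by
    rintro rfl
    simp [hr.ne] at hw
  have h1 : t / (t / w) = w := by field_simp
  simp only [reflect, h1]
  field_simp

theorem cauchyInt_reflect {t : ℂ} (ht : t ≠ 0) {r : ℝ} (hr : 0 < r) (F q : ℂ → ℂ) (z : ℂ) :
    cauchyInt (‖t‖ / r) (reflect t F) q z = -cauchyInt r F (fun w => q (t / w)) z := by
  rw [cauchyInt, circleIntegral_reflect_eq ht hr, cauchyInt]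
  ring

theorem cauchyInt_const (r : ℝ) (g : ℂ → ℂ) (p z : ℂ) :
    cauchyInt r g (fun _ => p) z = (2 * π * I)⁻¹ * (∮ w in C(0, r), g w) * (z - p)⁻¹ := by
  simp only [cauchyInt]
  simp_rw [mul_comm _ (z - p)⁻¹]
  rw [circleIntegral.integral_const_mul]
  ring

/-- The part of a differential which is singular at the end `φ` of an opened node with parameter
`t`, in terms of the period `a` of the differential around this end, and of its coefficient `g` on
the circle of radius `r` at the other end. -/
def modelPart (φ : OpenPartialHomeomorph ℂ ℂ) (p : ℂ) (r : ℝ) (t a : ℂ) (g : ℂ → ℂ) (z : ℂ) : ℂ :=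
  (2 * π * I)⁻¹ * (a + ∮ w in C(0, r), g w) * (z - p)⁻¹ -
    cauchyInt r g (fun w => φ.symm (t / w)) z

/-- When `a` is the true period, the pole term cancels and only the Cauchy integral, carried across
the neck, is left. The pole term makes `modelPart` meaningful for t = 0 and for any `g`, in
particular for the iterates of the fixed point map. -/
theorem modelPart_eq_cauchyInt {φ : OpenPartialHomeomorph ℂ ℂ} {p : ℂ} {r : ℝ} {t a : ℂ}
    {g : ℂ → ℂ} (ht : t ≠ 0) (hr : 0 < r) (ha : a = -∮ w in C(0, r), g w) (z : ℂ) :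
    modelPart φ p r t a g z = cauchyInt (‖t‖ / r) (reflect t g) φ.symm z := by
  rw [modelPart, cauchyInt_reflect ht hr, ha]
  ring

namespace IsDiskChart

variable {φ : OpenPartialHomeomorph ℂ ℂ} {p : ℂ} {ρ c₁ c₂ : ℝ}

/-- At t = 0 the curve w ↦ φ.symm (t / w) collapses to p, and its Cauchy integral cancels the ∮g
part of the pole. -/
theorem modelPart_zero (h : IsDiskChart φ p ρ c₁ c₂) (r : ℝ) (a : ℂ) (g : ℂ → ℂ) (z : ℂ) :
    modelPart φ p r 0 a g z = (2 * π * I)⁻¹ * a * (z - p)⁻¹ := by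
  simp only [modelPart, zero_div, h.symm_zero, cauchyInt_const]
  ring

theorem norm_div_of_mem_sphere {t w : ℂ} {r : ℝ} (hw : w ∈ sphere (0 : ℂ) r) :
    ‖t / w‖ = ‖t‖ / r := by
  rw [mem_sphere_zero_iff_norm] at hw
  rw [norm_div, hw]

theorem continuousOn_symm_div (h : IsDiskChart φ p ρ c₁ c₂) {r : ℝ} {t : ℂ} (hr : 0 < r)
    (ht : ‖t‖ / r < ρ) : ContinuousOn (fun w => φ.symm (t / w)) (sphere 0 r) := by
  refine h.differentiableOn_symm.continuousOn.comp
    (continuousOn_const.div continuousOn_id fun w hw h0 => ?_) fun w hw => ?_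
  · simp [h0, hr.ne] at hw
  · rw [mem_ball_zero_iff, norm_div_of_mem_sphere hw]
    exact ht

theorem p_mem_closedDisk (h : IsDiskChart φ p ρ c₁ c₂) {s : ℝ} (hs : 0 ≤ s) :
    p ∈ closedDisk φ s := ⟨h.p_mem, by rw [h.map_p, norm_zero]; exact hs⟩

theorem differentiableOn_modelPart (h : IsDiskChart φ p ρ c₁ c₂) {r : ℝ} {t a : ℂ} {g : ℂ → ℂ}
    (hr : 0 < r) (ht : ‖t‖ / r < ρ) (hg : ContinuousOn g (sphere 0 r)) :
    DifferentiableOn ℂ (modelPart φ p r t a g) (closedDisk φ (‖t‖ / r))ᶜ := by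
  refine DifferentiableOn.sub ?_ ((differentiableOn_cauchyInt hr.le hg
    (h.continuousOn_symm_div hr ht)).mono (compl_subset_compl.2 ?_))
  · refine (differentiableOn_const _).mul ((differentiableOn_id.sub_const p).inv fun z hz h0 => ?_)
    have h0 : z = p := sub_eq_zero.1 h0
    exact hz (h0 ▸ h.p_mem_closedDisk (by positivity))
  · rintro _ ⟨w, hw, rfl⟩
    have h1 : ‖t / w‖ < ρ := by rwa [norm_div_of_mem_sphere hw]
    exact ⟨h.symm_mem h1, by rw [h.apply_symm h1, norm_div_of_mem_sphere hw]⟩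

/-- The contributions of ∮g in the two terms cancel, so the residue at infinity depends on `a`
alone. The periods are thus prescribed before `g` is known. -/
theorem tendsto_mul_modelPart (h : IsDiskChart φ p ρ c₁ c₂) {r : ℝ} {t a : ℂ} {g : ℂ → ℂ}
    (hr : 0 < r) (ht : ‖t‖ / r < ρ) (hg : ContinuousOn g (sphere 0 r)) :
    Tendsto (fun z => z * modelPart φ p r t a g z) (cocompact ℂ) (𝓝 ((2 * π * I)⁻¹ * a)) := by
  have h1 := ((tendsto_mul_inv_sub p).const_mul
    ((2 * π * I)⁻¹ * (a + ∮ w in C(0, r), g w))).sub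
    (tendsto_mul_cauchyInt hr.le hg (h.continuousOn_symm_div hr ht))
  have h2 : (2 * π * I)⁻¹ * (a + ∮ w in C(0, r), g w) * 1 -
      (2 * π * I)⁻¹ * (∮ w in C(0, r), g w) = (2 * π * I)⁻¹ * a := by ring
  rw [h2] at h1
  refine h1.congr fun z => ?_
  rw [modelPart]
  ring

/-- The curve w ↦ φ.symm (t / w) lies within κ = c₂|t|/r of p, and the length factor r cancels. This
gain of |t| is the source of the contraction and of every absorption argument. -/
theorem norm_modelPart_sub_pole_le (h : IsDiskChart φ p ρ c₁ c₂) {r : ℝ} {t a : ℂ} {g : ℂ → ℂ}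
    (hr : 0 < r) (ht : ‖t‖ / r < ρ) (hg : ContinuousOn g (sphere 0 r)) {z : ℂ} {d N : ℝ}
    (hd : 0 < d) (htd : c₂ * (‖t‖ / r) ≤ d / 2) (hN : ∀ w ∈ sphere (0 : ℂ) r, ‖g w‖ ≤ N)
    (hz : d ≤ ‖z - p‖) :
    ‖modelPart φ p r t a g z - (2 * π * I)⁻¹ * a * (z - p)⁻¹‖ ≤ 2 * c₂ / d ^ 2 * ‖t‖ * N := by
  have h1 := norm_cauchyInt_sub_pole_le hr.le hg (h.continuousOn_symm_div hr ht) hd htd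
    (fun w hw => by
      rw [← norm_div_of_mem_sphere hw]
      exact h.norm_symm_sub_le (by rwa [norm_div_of_mem_sphere hw])) hN hz
  have h2 : modelPart φ p r t a g z - (2 * π * I)⁻¹ * a * (z - p)⁻¹ =
      ((2 * π * I)⁻¹ * (∮ w in C(0, r), g w) * (z - p)⁻¹ -
        cauchyInt r g (fun w => φ.symm (t / w)) z) := by
    rw [modelPart]
    ring
  rw [h2]
  exact h1.trans (le_of_eq (by field_simp))

theorem norm_modelPart_le (h : IsDiskChart φ p ρ c₁ c₂) {r : ℝ} {t a : ℂ} {g : ℂ → ℂ}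
    (hr : 0 < r) (ht : ‖t‖ / r < ρ) (hg : ContinuousOn g (sphere 0 r)) {z : ℂ} {d N : ℝ}
    (hd : 0 < d) (htd : c₂ * (‖t‖ / r) ≤ d / 2) (hN : ∀ w ∈ sphere (0 : ℂ) r, ‖g w‖ ≤ N)
    (hz : d ≤ ‖z - p‖) :
    ‖modelPart φ p r t a g z‖ ≤ ‖a‖ / d + 2 * c₂ / d ^ 2 * ‖t‖ * N := by
  rw [← add_sub_cancel ((2 * π * I)⁻¹ * a * (z - p)⁻¹) (modelPart φ p r t a g z)]
  refine (norm_add_le _ _).trans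
    (add_le_add ?_ (h.norm_modelPart_sub_pole_le hr ht hg hd htd hN hz))
  rw [norm_mul, norm_mul, norm_inv, norm_inv, norm_two_pi_I, div_eq_mul_inv]
  have h3 : (2 * π)⁻¹ ≤ 1 := inv_le_one_of_one_le₀ (by linarith [Real.pi_gt_three])
  have h4 : (2 * π)⁻¹ * ‖a‖ ≤ 1 * ‖a‖ := by gcongr
  have h5 : ‖z - p‖⁻¹ ≤ d⁻¹ := by gcongr
  rw [one_mul] at h4
  exact mul_le_mul h4 h5 (by positivity) (by positivity)

/-- A differential which crosses an open neck is, near this neck, the sum of its model part and of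
a holomorphic differential. -/
theorem exists_sub_modelPart_extension (h : IsDiskChart φ p ρ c₁ c₂) {f : ℂ → ℂ} {r : ℝ} {t : ℂ}
    (ht : t ≠ 0) (hr : 0 < r) (hrρ : r < ρ) (htr : ‖t‖ / r < r)
    (hf : DifferentiableOn ℂ f (φ.source \ closedDisk φ (‖t‖ / ρ))) {g : ℂ → ℂ}
    (hg : ∀ ζ, ‖t‖ / ρ < ‖ζ‖ → ‖ζ‖ < ρ → chartForm φ f ζ = reflect t g ζ) :
    (∮ w in C(0, r), chartForm φ f w) = (-∮ w in C(0, r), g w) ∧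
      ∃ e : ℂ → ℂ, DifferentiableOn ℂ e (openDisk φ r) ∧
        ∀ z ∈ openDisk φ r, z ∉ closedDisk φ (‖t‖ / r) →
          f z = modelPart φ p r t (∮ w in C(0, r), chartForm φ f w) g z + e z := by
  have ht' : 0 < ‖t‖ := norm_pos_iff.2 ht
  have h0 : ‖t‖ / ρ < ‖t‖ / r := div_lt_div_of_pos_left ht' hr hrρ
  have hpos : 0 < ‖t‖ / r := by positivity
  have hF := h.differentiableOn_chartForm_annulus hf
  have hEq : EqOn (chartForm φ f) (reflect t g) (sphere 0 (‖t‖ / r)) := by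
    intro w hw
    rw [mem_sphere_zero_iff_norm] at hw
    exact hg w (by rw [hw]; exact h0) (by rw [hw]; exact htr.trans hrρ)
  have h1 : (∮ w in C(0, r), chartForm φ f w) = -∮ w in C(0, r), g w := by
    rw [circleIntegral_eq_of_annulus hpos h0 htr.le hrρ hF,
      circleIntegral.integral_congr hpos.le hEq]
    simpa using circleIntegral_reflect_eq ht hr g fun _ => 1
  -- Cauchy's formula writes f as an inner minus an outer integral. The inner one is the model part,
  -- and the outer one is holomorphic inside |φ| < r.
  refine ⟨h1, fun z => -cauchyInt r (chartForm φ f) φ.symm z, ?_, ?_⟩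
  · refine (h.differentiableOn_cauchyInt_inner hr.le hrρ (hF.continuousOn.mono fun w hw => ?_)).neg
    rw [mem_sphere_zero_iff_norm] at hw
    exact ⟨by rw [hw]; exact h0.trans htr, by rw [hw]; exact hrρ⟩
  · intro z hz hz'
    have hz1 : ‖t‖ / r < ‖φ z‖ := by
      by_contra! hlt
      exact hz' ⟨hz.1, hlt⟩
    rw [modelPart_eq_cauchyInt ht hr h1, h.eq_cauchyInt_sub_cauchyInt hpos h0 hrρ hf hz.1 hz1 hz.2,
      cauchyInt_congr hpos.le hEq fun _ _ => rfl]
    ring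

/-- The same at a node. -/
theorem exists_sub_pole_extension (h : IsDiskChart φ p ρ c₁ c₂) {f : ℂ → ℂ} {r : ℝ} {b : ℂ}
    (hr : 0 < r) (hrρ : r < ρ) (hf : DifferentiableOn ℂ f (φ.source \ closedDisk φ 0))
    (hb : HasSimplePoleAt f p b) (g : ℂ → ℂ) :
    (∮ w in C(0, r), chartForm φ f w) = 2 * π * I * b ∧
      ∃ e : ℂ → ℂ, DifferentiableOn ℂ e (openDisk φ r) ∧
        ∀ z ∈ openDisk φ r, z ∉ closedDisk φ 0 →
          f z = modelPart φ p r 0 (∮ w in C(0, r), chartForm φ f w) g z + e z := by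
  obtain ⟨G, hG, hfG⟩ := hb
  have hdisk : closedDisk φ 0 = {p} := by
    ext z
    constructor
    · rintro ⟨hz, hz0⟩
      have := h.upper z hz
      rw [norm_le_zero_iff.1 hz0, norm_zero, mul_zero] at this
      exact sub_eq_zero.1 (norm_le_zero_iff.1 this)
    · rintro rfl
      exact h.p_mem_closedDisk le_rfl
  set e : ℂ → ℂ := fun z => if z = p then G p else f z - b * (z - p)⁻¹ with he
  have hopen : IsOpen (φ.source \ closedDisk φ 0) := by
    rw [hdisk]
    exact φ.open_source.sdiff isClosed_singleton
  have hed : DifferentiableOn ℂ e φ.source := by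
    intro z hz
    apply DifferentiableAt.differentiableWithinAt
    by_cases hzp : z = p
    · subst hzp
      refine hG.differentiableAt.congr_of_eventuallyEq ?_
      rw [eventually_nhdsWithin_iff] at hfG
      filter_upwards [hfG] with w hw
      by_cases hwz : w = z
      · simp [he, hwz]
      · simp only [he, if_neg hwz, hw hwz]
        ring
    · have hmem : z ∈ φ.source \ closedDisk φ 0 := ⟨hz, by rw [hdisk]; exact hzp⟩
      have hsub : z - p ≠ 0 := sub_ne_zero.2 hzp
      have : DifferentiableAt ℂ (fun w => f w - b * (w - p)⁻¹) z :=
        (hf.differentiableAt (hopen.mem_nhds hmem)).sub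
          (((differentiableAt_id.sub_const p).inv hsub).const_mul b)
      refine this.congr_of_eventuallyEq ?_
      filter_upwards [isOpen_ne.mem_nhds hzp] with w hw
      simp only [he, if_neg hw]
  have hfe : ∀ z, z ≠ p → f z = b * (z - p)⁻¹ + e z := by
    intro z hz
    simp only [he, if_neg hz]
    ring
  -- The period of the pole comes from its residue at infinity, since |φ| = r is not a round circle
  -- in z; the holomorphic remainder contributes 0.
  have hint : (∮ w in C(0, r), chartForm φ f w) = 2 * π * I * b := by
    have h1 : (∮ w in C(0, r), chartForm φ (fun z => b * (z - p)⁻¹) w) = 2 * π * I * b := by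
      refine h.circleIntegral_chartForm le_rfl hr hrρ ?_ ?_
      · rw [hdisk]
        exact (differentiableOn_const b).mul ((differentiableOn_id.sub_const p).inv
          fun z hz => sub_ne_zero.2 hz)
      · have := (tendsto_mul_inv_sub p).const_mul b
        rw [mul_one] at this
        exact this.congr fun z => by ring
    have hde : DifferentiableOn ℂ (chartForm φ e) (ball 0 ρ) :=
      h.differentiableOn_chartForm hed subset_rfl fun w hw => h.symm_mem (by simpa using hw)
    have h2 : (∮ w in C(0, r), chartForm φ e w) = 0 := by
      refine circleIntegral_eq_zero_of_differentiable_on_off_countable hr.le countable_empty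
        (hde.continuousOn.mono (closedBall_subset_ball hrρ)) ?_
      rintro w ⟨hw, -⟩
      exact hde.differentiableAt (isOpen_ball.mem_nhds (ball_subset_ball hrρ.le hw))
    have hsph : ∀ w ∈ sphere (0 : ℂ) r, φ.symm w ≠ p := by
      intro w hw hwp
      rw [mem_sphere_zero_iff_norm] at hw
      have := h.le_norm_symm_sub (hw.trans_lt hrρ)
      rw [hwp, sub_self, norm_zero, hw] at this
      exact absurd this (not_le.2 (mul_pos h.c₁_pos hr))
    have hb1 : ContinuousOn (chartForm φ (fun z => b * (z - p)⁻¹)) (sphere 0 r) := by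
      have h3 : DifferentiableOn ℂ (fun z => b * (z - p)⁻¹) ({p}ᶜ : Set ℂ) :=
        (differentiableOn_const b).mul ((differentiableOn_id.sub_const p).inv
          fun z hz => sub_ne_zero.2 hz)
      exact (h.differentiableOn_chartForm h3
        (sphere_subset_closedBall.trans (closedBall_subset_ball hrρ)) hsph).continuousOn
    have hb2 : ContinuousOn (chartForm φ e) (sphere 0 r) :=
      hde.continuousOn.mono (sphere_subset_closedBall.trans (closedBall_subset_ball hrρ))
    have h3 := circleIntegral.integral_add (hb1.circleIntegrable hr.le)
      (hb2.circleIntegrable hr.le)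
    rw [h1, h2, add_zero] at h3
    rw [← h3]
    refine circleIntegral.integral_congr hr.le fun w hw => ?_
    simp only [chartForm, hfe _ (hsph w hw)]
    ring
  refine ⟨hint, e, hed.mono fun z hz => hz.1, fun z hz hz' => ?_⟩
  rw [hdisk] at hz'
  rw [h.modelPart_zero, hint, inv_mul_cancel_left₀ two_pi_I_ne, hfe z hz']

end IsDiskChart

/-- A function which is holomorphic outside finitely many disjoint topological disks, and vanishes
at infinity, is the sum of its singular parts. -/
theorem eq_sum_of_local_extension {ι : Type*} (S : Finset ι) {φ : ι → OpenPartialHomeomorph ℂ ℂ}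
    {p : ι → ℂ} {ρ c₁ c₂ : ℝ} (h : ∀ i ∈ S, IsDiskChart (φ i) (p i) ρ c₁ c₂)
    (hdisj : ∀ i ∈ S, ∀ j ∈ S, i ≠ j → Disjoint (φ i).source (φ j).source) {s : ι → ℝ} {R : ℝ}
    (hsR : ∀ i ∈ S, s i < R) (hR : R < ρ) {f : ℂ → ℂ} {m e : ι → ℂ → ℂ}
    (hf : DifferentiableOn ℂ f {z | ∀ i ∈ S, z ∉ closedDisk (φ i) (s i)})
    (hm : ∀ i ∈ S, DifferentiableOn ℂ (m i) (closedDisk (φ i) (s i))ᶜ)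
    (he : ∀ i ∈ S, DifferentiableOn ℂ (e i) (openDisk (φ i) R))
    (heq : ∀ i ∈ S, ∀ z ∈ openDisk (φ i) R, z ∉ closedDisk (φ i) (s i) → f z = m i z + e i z)
    (hf0 : Tendsto f (cocompact ℂ) (𝓝 0)) (hm0 : ∀ i ∈ S, Tendsto (m i) (cocompact ℂ) (𝓝 0))
    {z : ℂ} (hz : ∀ i ∈ S, z ∉ closedDisk (φ i) (s i)) : f z = ∑ i ∈ S, m i z := by
  classical
  set W : Set ℂ := {z | ∀ i ∈ S, z ∉ closedDisk (φ i) (s i)} with hWdef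
  have hW : IsOpen W := by
    have : W = ⋂ i ∈ S, (closedDisk (φ i) (s i))ᶜ := by
      ext z
      simp [hWdef]
    rw [this]
    exact isOpen_biInter_finset fun i hi => (h i hi).isOpen_compl_closedDisk ((hsR i hi).trans hR)
  -- The function f - Σ m_i extends over the i-th disk as e_i - Σ_{j≠i} m_j, because the other m_j
  -- are holomorphic there. The resulting entire function vanishes by Liouville.
  obtain ⟨Φ, hΦ1, -, hΦ⟩ := exists_piecewise_differentiable (ι := S) (W := W)
    (D := fun i => openDisk (φ i) R) (u := fun z => f z - ∑ i ∈ S, m i z)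
    (e := fun i z => e i z - ∑ j ∈ S.erase i, m j z) hW (fun i => IsDiskChart.isOpen_openDisk R)
    (fun i j hij => (hdisj i i.2 j j.2 (fun h => hij (Subtype.ext h))).mono
      (fun z hz => hz.1) (fun z hz => hz.1))
    (hf.sub (DifferentiableOn.fun_sum fun i hi => (hm i hi).mono fun z hz => hz i hi))
    (fun i => (he i i.2).sub (DifferentiableOn.fun_sum fun j hj => (hm j
      (Finset.mem_of_mem_erase hj)).mono fun z hz hz' => disjoint_left.1
      (hdisj i i.2 j (Finset.mem_of_mem_erase hj) (Finset.ne_of_mem_erase hj).symm) hz.1 hz'.1))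
    (fun i z hz => by
      simp only
      rw [heq i i.2 z hz.2 (hz.1 i i.2), ← Finset.add_sum_erase S (fun i => m i z) i.2]
      ring)
  have huniv : W ∪ ⋃ i : S, openDisk (φ i) R = univ := by
    refine eq_univ_of_forall fun z => ?_
    by_cases hzW : z ∈ W
    · exact Or.inl hzW
    · simp only [hWdef, mem_ofPred_eq, not_forall, not_not] at hzW
      obtain ⟨i, hi, hzi⟩ := hzW
      exact Or.inr (mem_iUnion.2 ⟨⟨i, hi⟩, hzi.1, hzi.2.trans_lt (hsR i hi)⟩)
  rw [huniv, differentiableOn_univ] at hΦ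
  have hev : ∀ᶠ z in cocompact ℂ, z ∈ W := by
    rw [hWdef]
    exact (eventually_all_finset S).2 fun i hi =>
      eventually_notMem_cocompact ((h i hi).isCompact_closedDisk ((hsR i hi).trans hR))
  have hlim : Tendsto Φ (cocompact ℂ) (𝓝 0) := by
    have := hf0.sub (tendsto_finsetSum S hm0)
    rw [Finset.sum_const_zero, sub_zero] at this
    refine this.congr' ?_
    filter_upwards [hev] with z hz
    exact (hΦ1 hz).symm
  have h3 := hΦ1 hz
  rw [eq_zero_of_tendsto_cocompact hΦ hlim z] at h3
  exact sub_eq_zero.1 h3.symm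

end Models

/-! ### Regular differentials as sums of singular parts; the residue theorem -/

section Decomposition

open Complex Metric Set Filter
open scoped Real

variable {V E : Type*} {G : OrientedMultigraph V E} {X : NodeCoordinates E} {ρ c₁ c₂ ε : ℝ}
  {t : E → ℂ} {f : V → ℂ → ℂ}

/-- The other end of the same edge. -/
def opp (i : E × Bool) : E × Bool := (i.1, !i.2)

/-- The sign of an end: `-1` at the start of an edge and `1` at its end. -/
def sgn (b : Bool) : ℂ := if b then 1 else -1

theorem norm_sgn (b : Bool) : ‖sgn b‖ = 1 := by cases b <;> simp [sgn]

/-- The vertex of an end. -/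
def vtx (G : OrientedMultigraph V E) (i : E × Bool) : V := G.vert i.1 i.2

/-- The coefficient of a differential in the local coordinate at an end. -/
def endForm (G : OrientedMultigraph V E) (X : NodeCoordinates E) (f : V → ℂ → ℂ) (i : E × Bool) :
    ℂ → ℂ := chartForm (X.z i.1 i.2) (f (vtx G i))

/-- The complement in `ℂ` of the closed disks `|z_e^±| ≤ |t_e| / r` at the vertex `v`. -/
def region (G : OrientedMultigraph V E) (X : NodeCoordinates E) (t : E → ℂ) (r : ℝ) (v : V) :
    Set ℂ := {z | ∀ i : E × Bool, vtx G i = v → z ∉ closedDisk (X.z i.1 i.2) (‖t i.1‖ / r)}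

theorem part_eq_region (v : V) : part G X ρ t v = region G X t ρ v := by
  ext z
  exact ⟨fun h i hi hz => h i.1 i.2 hi hz, fun h e b hb hz => h (e, b) hb hz⟩

theorem closedDisk_mono {φ : OpenPartialHomeomorph ℂ ℂ} {a b : ℝ} (hab : a ≤ b) :
    closedDisk φ a ⊆ closedDisk φ b := fun _ hz => ⟨hz.1, hz.2.trans hab⟩

theorem region_anti {r r' : ℝ} (hr : 0 < r) (hr' : r ≤ r') (v : V) :
    region G X t r v ⊆ region G X t r' v := fun _ hz i hi hz' =>
  hz i hi (closedDisk_mono (div_le_div_of_nonneg_left (norm_nonneg _) hr hr') hz')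

namespace NodeCoordinates.Admissible

theorem chart (h : X.Admissible G ρ c₁ c₂) (i : E × Bool) :
    IsDiskChart (X.z i.1 i.2) (X.p i.1 i.2) ρ c₁ c₂ where
  rho_pos := h.rho_pos
  c₁_pos := h.c₁_pos
  c₂_pos := h.c₂_pos
  target_eq := h.target_eq _ _
  holo := h.holo _ _
  holo_symm := h.holo_symm _ _
  p_mem := h.p_mem _ _
  map_p := h.z_p _ _
  lower := h.lower _ _
  upper := h.upper _ _

theorem disjoint_source (h : X.Admissible G ρ c₁ c₂) {i j : E × Bool} (hij : i ≠ j)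
    (hv : vtx G i = vtx G j) : Disjoint (X.z i.1 i.2).source (X.z j.1 j.2).source :=
  h.disjoint i.1 i.2 j.1 j.2 hij hv

/-- The open ball of radius c₁ρ at p_i lies in its own disk, hence misses the open disk of j; then
so does its closure. The strict inequality allows ε = ρc₁ later. -/
theorem lt_norm_sub (h : X.Admissible G ρ c₁ c₂) {i j : E × Bool} (hij : i ≠ j)
    (hv : vtx G i = vtx G j) {z : ℂ} (hz : z ∈ (X.z j.1 j.2).source) :
    c₁ * ρ < ‖z - X.p i.1 i.2‖ := by
  by_contra! hle
  have h1 : Disjoint (ball (X.p i.1 i.2) (c₁ * ρ)) (X.z j.1 j.2).source :=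
    (h.disjoint_source hij hv).mono_left (h.chart i).ball_subset_source
  have h2 := h1.closure_left (X.z j.1 j.2).open_source
  rw [closure_ball _ (mul_pos h.c₁_pos h.rho_pos).ne'] at h2
  exact disjoint_left.1 h2 (by rwa [mem_closedBall, dist_eq_norm]) hz

theorem sdiff_subset_region (h : X.Admissible G ρ c₁ c₂) (i : E × Bool) (r : ℝ) :
    (X.z i.1 i.2).source \ closedDisk (X.z i.1 i.2) (‖t i.1‖ / r) ⊆ region G X t r (vtx G i) := by
  rintro z ⟨hz, hz'⟩ j hj hzj
  by_cases hij : i = j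
  · exact hz' (hij ▸ hzj)
  · exact disjoint_left.1 (h.disjoint_source hij hj.symm) hz hzj.1

end NodeCoordinates.Admissible

/-- The bound ρ²/4 puts the circle |z_i| = |t|/(ρ/2), which is the image of the circle of radius ρ/2
at the other end, strictly inside |z_i| = ρ/2. -/
theorem period_radius {a ρ : ℝ} (hρ : 0 < ρ) (ha : a < ρ ^ 2 / 4) :
    a / (ρ / 2) < ρ / 2 := by
  rw [div_lt_iff₀ (by positivity)]
  nlinarith

/-- The singular part of a differential at the end `i`. -/
def endPart (G : OrientedMultigraph V E) (X : NodeCoordinates E) (r : ℝ) (t : E → ℂ)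
    (f : V → ℂ → ℂ) (α : E → ℂ) (i : E × Bool) : ℂ → ℂ :=
  modelPart (X.z i.1 i.2) (X.p i.1 i.2) r (t i.1) (sgn i.2 * α i.1) (endForm G X f (opp i))

theorem deriv_glue (h : X.Admissible G ρ c₁ c₂) {e : E} (he : t e ≠ 0) {ζ : ℂ}
    (hζ : ‖t e‖ / ρ < ‖ζ‖) (hζ' : ‖ζ‖ < ρ) :
    deriv (glue X t e) ((X.z e false).symm ζ) = deriv (X.z e true).symm (t e / ζ) *
      (-(t e / ζ ^ 2) * deriv (X.z e false) ((X.z e false).symm ζ)) := by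
  have hρ := h.rho_pos
  have hζ0 : ζ ≠ 0 := by
    rintro rfl
    rw [norm_zero] at hζ
    exact absurd hζ (not_lt.2 (by positivity))
  have c0 := h.chart (e, false)
  have c1 := h.chart (e, true)
  simp only at c0 c1
  have hz := c0.symm_mem hζ'
  have happ := c0.apply_symm hζ'
  have hw : ‖t e / ζ‖ < ρ := (norm_div_mem_annulus he hζ hζ' hρ).2
  have h1 := (c0.differentiableAt hz).hasDerivAt
  have h2 : HasDerivAt (fun z => t e / X.z e false z)
      (-(t e / ζ ^ 2) * deriv (X.z e false) ((X.z e false).symm ζ))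
      ((X.z e false).symm ζ) := by
    have h3 := (hasDerivAt_const ((X.z e false).symm ζ) (t e)).div h1 (by rwa [happ])
    rw [happ] at h3
    refine h3.congr_deriv ?_
    field_simp
    ring
  have h4 : HasDerivAt (X.z e true).symm (deriv (X.z e true).symm (t e / ζ))
      (t e / X.z e false ((X.z e false).symm ζ)) := by
    rw [happ]
    exact (c1.differentiableAt_symm hw).hasDerivAt
  exact (HasDerivAt.comp (h := fun z => t e / X.z e false z) ((X.z e false).symm ζ) h4 h2).deriv

/-- The gluing condition along an open neck, in the local coordinates. -/
theorem glue_eq_iff (h : X.Admissible G ρ c₁ c₂) (f : V → ℂ → ℂ) {e : E} (he : t e ≠ 0) {ζ : ℂ}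
    (hζ : ‖t e‖ / ρ < ‖ζ‖) (hζ' : ‖ζ‖ < ρ) :
    f (G.src e) ((X.z e false).symm ζ) = f (G.tgt e) (glue X t e ((X.z e false).symm ζ)) *
        deriv (glue X t e) ((X.z e false).symm ζ) ↔
      endForm G X f (e, false) ζ = reflect (t e) (endForm G X f (e, true)) ζ := by
  have c0 := h.chart (e, false)
  simp only at c0
  have hmul := c0.deriv_mul_deriv_symm hζ'
  have hne := c0.deriv_symm_ne_zero hζ'
  rw [deriv_glue h he hζ hζ', glue, c0.apply_symm hζ']
  change _ ↔ f (G.src e) ((X.z e false).symm ζ) * deriv (X.z e false).symm ζ =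
    -(t e / ζ ^ 2) *
      (f (G.tgt e) ((X.z e true).symm (t e / ζ)) * deriv (X.z e true).symm (t e / ζ))
  rw [← mul_left_inj' hne]
  have : f (G.tgt e) ((X.z e true).symm (t e / ζ)) * (deriv (X.z e true).symm (t e / ζ) *
      (-(t e / ζ ^ 2) * deriv (X.z e false) ((X.z e false).symm ζ))) *
        deriv (X.z e false).symm ζ =
      -(t e / ζ ^ 2) *
        (f (G.tgt e) ((X.z e true).symm (t e / ζ)) * deriv (X.z e true).symm (t e / ζ)) := by
    linear_combination (-(t e / ζ ^ 2) * (f (G.tgt e) ((X.z e true).symm (t e / ζ)) *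
      deriv (X.z e true).symm (t e / ζ))) * hmul
  rw [this]

namespace IsRegularDifferential

theorem differentiableOn_region (hf : IsRegularDifferential G X ρ t f) {r : ℝ} (hr : 0 < r)
    (hrρ : r ≤ ρ) (v : V) : DifferentiableOn ℂ (f v) (region G X t r v) :=
  (hf.holo v).mono (by rw [part_eq_region]; exact region_anti hr hrρ v)

theorem differentiableOn_sdiff (hf : IsRegularDifferential G X ρ t f)
    (h : X.Admissible G ρ c₁ c₂) (i : E × Bool) :
    DifferentiableOn ℂ (f (vtx G i))
      ((X.z i.1 i.2).source \ closedDisk (X.z i.1 i.2) (‖t i.1‖ / ρ)) :=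
  (hf.differentiableOn_region h.rho_pos le_rfl _).mono (h.sdiff_subset_region i ρ)

theorem differentiableOn_endForm (hf : IsRegularDifferential G X ρ t f)
    (h : X.Admissible G ρ c₁ c₂) (i : E × Bool) :
    DifferentiableOn ℂ (endForm G X f i) {w | ‖t i.1‖ / ρ < ‖w‖ ∧ ‖w‖ < ρ} :=
  (h.chart i).differentiableOn_chartForm_annulus (hf.differentiableOn_sdiff h i)

theorem continuousOn_endForm (hf : IsRegularDifferential G X ρ t f)
    (h : X.Admissible G ρ c₁ c₂) (i : E × Bool) (ht : ‖t i.1‖ < ρ ^ 2 / 4) :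
    ContinuousOn (endForm G X f i) (sphere 0 (ρ / 2)) := by
  have hρ := h.rho_pos
  refine (hf.differentiableOn_endForm h i).continuousOn.mono fun w hw => ?_
  rw [mem_sphere_zero_iff_norm] at hw
  rw [mem_ofPred_eq, hw]
  refine ⟨?_, by linarith⟩
  rw [div_lt_iff₀ hρ]
  nlinarith

/-- The definition glues only from the start of an edge to its end; the other direction follows
because `reflect` is an involution. -/
theorem endForm_eq_reflect (hf : IsRegularDifferential G X ρ t f) (h : X.Admissible G ρ c₁ c₂)
    (i : E × Bool) (ht : t i.1 ≠ 0) {ζ : ℂ} (hζ : ‖t i.1‖ / ρ < ‖ζ‖) (hζ' : ‖ζ‖ < ρ) :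
    endForm G X f i ζ = reflect (t i.1) (endForm G X f (opp i)) ζ := by
  have hρ := h.rho_pos
  have key : ∀ (e : E), t e ≠ 0 → ∀ ζ : ℂ, ‖t e‖ / ρ < ‖ζ‖ → ‖ζ‖ < ρ →
      endForm G X f (e, false) ζ = reflect (t e) (endForm G X f (e, true)) ζ := by
    intro e he ζ hζ hζ'
    have c0 := h.chart (e, false)
    simp only at c0
    exact (glue_eq_iff h f he hζ hζ').1 (hf.glue_eq e he _
      ⟨c0.symm_mem hζ', by rwa [c0.apply_symm hζ']⟩)
  obtain ⟨e, b⟩ := i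
  cases b
  · exact key e ht ζ hζ hζ'
  · have hζ0 : ζ ≠ 0 := by
      rintro rfl
      rw [norm_zero] at hζ
      exact absurd hζ (not_lt.2 (by positivity))
    have hann := norm_div_mem_annulus ht hζ hζ' hρ
    rw [reflect]
    simp only [opp, Bool.not_true]
    rw [key e ht _ hann.1 hann.2]
    have := reflect_reflect ht (endForm G X f (e, true)) hζ0
    rw [reflect] at this
    exact this.symm

/-- The singular parts of a regular differential are its `endPart`s. -/
theorem exists_extension (hf : IsRegularDifferential G X ρ t f) (h : X.Admissible G ρ c₁ c₂)
    {α : E → ℂ} (hα : ∀ e, α e = ∮ w in C(0, ρ / 2), endForm G X f (e, true) w)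
    (i : E × Bool) (ht : ‖t i.1‖ < ρ ^ 2 / 4) :
    ∃ k : ℂ → ℂ, DifferentiableOn ℂ k (openDisk (X.z i.1 i.2) (ρ / 2)) ∧
      ∀ z ∈ openDisk (X.z i.1 i.2) (ρ / 2), z ∉ closedDisk (X.z i.1 i.2) (‖t i.1‖ / (ρ / 2)) →
        f (vtx G i) z = endPart G X (ρ / 2) t f α i z + k z := by
  have hρ := h.rho_pos
  have hr : 0 < ρ / 2 := by positivity
  have hrρ : ρ / 2 < ρ := by linarith
  by_cases ht0 : t i.1 = 0
  · have hdiff := hf.differentiableOn_sdiff h i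
    rw [ht0, norm_zero, zero_div] at hdiff
    obtain ⟨a, ha0, ha1⟩ := hf.node i.1 ht0
    have h1 := ((h.chart (i.1, true)).exists_sub_pole_extension hr hrρ
      (by
        have := hf.differentiableOn_sdiff h (i.1, true)
        simp only [ht0, norm_zero, zero_div] at this
        exact this) (show HasSimplePoleAt (f (vtx G (i.1, true))) _ a from ha1) 0).1
    have hαa : α i.1 = 2 * π * I * a := (hα i.1).trans h1
    have hpole : HasSimplePoleAt (f (vtx G i)) (X.p i.1 i.2) (sgn i.2 * a) := by
      obtain ⟨e, b⟩ := i
      cases b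
      · simpa [sgn, vtx, OrientedMultigraph.vert] using ha0
      · simpa [sgn, vtx, OrientedMultigraph.vert] using ha1
    obtain ⟨h2, k, hk, hfk⟩ := (h.chart i).exists_sub_pole_extension hr hrρ hdiff hpole
      (endForm G X f (opp i))
    refine ⟨k, hk, fun z hz hz' => ?_⟩
    rw [ht0, norm_zero, zero_div] at hz'
    rw [hfk z hz hz', endPart, ht0, h2, hαa]
    congr 2
    ring
  · obtain ⟨h1, k, hk, hfk⟩ := (h.chart i).exists_sub_modelPart_extension ht0 hr hrρ
      (period_radius hρ ht) (hf.differentiableOn_sdiff h i) (g := endForm G X f (opp i))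
      (fun ζ hζ hζ' => hf.endForm_eq_reflect h i ht0 hζ hζ')
    refine ⟨k, hk, fun z hz hz' => ?_⟩
    have h2 : (∮ w in C(0, ρ / 2), chartForm (X.z i.1 i.2) (f (vtx G i)) w) =
        sgn i.2 * α i.1 := by
      obtain ⟨e, b⟩ := i
      rw [hα]
      cases b
      · rw [h1]
        simp [sgn, opp]
      · simp [sgn, endForm]
    rw [hfk z hz hz', h2, endPart]

theorem tendsto_mul (hf : IsRegularDifferential G X ρ t f) (v : V) :
    Tendsto (fun z => z * f v z) (cocompact ℂ) (𝓝 0) := (hf.holo_infty v).tendsto_mul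

theorem differentiableOn_endPart (hf : IsRegularDifferential G X ρ t f)
    (h : X.Admissible G ρ c₁ c₂) (α : E → ℂ) (i : E × Bool) (ht : ‖t i.1‖ < ρ ^ 2 / 4) :
    DifferentiableOn ℂ (endPart G X (ρ / 2) t f α i)
      (closedDisk (X.z i.1 i.2) (‖t i.1‖ / (ρ / 2)))ᶜ := by
  have hρ := h.rho_pos
  exact (h.chart i).differentiableOn_modelPart (by positivity)
    ((period_radius hρ ht).trans (by linarith)) (hf.continuousOn_endForm h (opp i) ht)

theorem tendsto_mul_endPart (hf : IsRegularDifferential G X ρ t f)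
    (h : X.Admissible G ρ c₁ c₂) (α : E → ℂ) (i : E × Bool) (ht : ‖t i.1‖ < ρ ^ 2 / 4) :
    Tendsto (fun z => z * endPart G X (ρ / 2) t f α i z) (cocompact ℂ)
      (𝓝 ((2 * π * I)⁻¹ * (sgn i.2 * α i.1))) := by
  have hρ := h.rho_pos
  exact (h.chart i).tendsto_mul_modelPart (by positivity)
    ((period_radius hρ ht).trans (by linarith)) (hf.continuousOn_endForm h (opp i) ht)

/-- A regular differential is the sum of its singular parts at the ends of edges. -/
theorem eq_sum_endPart (hf : IsRegularDifferential G X ρ t f) (h : X.Admissible G ρ c₁ c₂)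
    {α : E → ℂ} (hα : ∀ e, α e = ∮ w in C(0, ρ / 2), endForm G X f (e, true) w)
    (ht : ∀ e, ‖t e‖ < ρ ^ 2 / 4) {v : V} {S : Finset (E × Bool)}
    (hS : ∀ i, i ∈ S ↔ vtx G i = v) {z : ℂ} (hz : z ∈ region G X t (ρ / 2) v) :
    f v z = ∑ i ∈ S, endPart G X (ρ / 2) t f α i z := by
  have hρ := h.rho_pos
  choose k hk hfk using fun i : E × Bool => hf.exists_extension h hα i (ht i.1)
  refine eq_sum_of_local_extension S (fun i _ => h.chart i) (fun i hi j hj hij =>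
    h.disjoint_source hij (((hS i).1 hi).trans ((hS j).1 hj).symm))
    (s := fun i => ‖t i.1‖ / (ρ / 2)) (R := ρ / 2) (fun i _ => period_radius hρ (ht i.1))
    (by linarith) ((hf.differentiableOn_region (r := ρ / 2) (by positivity) (by linarith) v).mono
      fun z hz i hi => hz i ((hS i).2 hi))
    (fun i _ => hf.differentiableOn_endPart h α i (ht i.1)) (fun i _ => hk i)
    (fun i hi z hz hz' => ?_) (tendsto_zero_of_tendsto_mul (hf.tendsto_mul v))
    (fun i _ => tendsto_zero_of_tendsto_mul (hf.tendsto_mul_endPart h α i (ht i.1)))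
    (fun i hi => hz i ((hS i).1 hi))
  rw [← (hS i).1 hi]
  exact hfk i z hz hz'

theorem eventually_mem_region (h : X.Admissible G ρ c₁ c₂) (ht : ∀ e, ‖t e‖ < ρ ^ 2 / 4) {v : V}
    {S : Finset (E × Bool)} (hS : ∀ i, i ∈ S ↔ vtx G i = v) :
    ∀ᶠ z in cocompact ℂ, z ∈ region G X t (ρ / 2) v := by
  have hρ := h.rho_pos
  have := (eventually_all_finset (l := cocompact ℂ) S
    (p := fun i z => z ∉ closedDisk (X.z i.1 i.2) (‖t i.1‖ / (ρ / 2)))).2 fun i _ =>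
    eventually_notMem_cocompact ((h.chart i).isCompact_closedDisk
      ((period_radius hρ (ht i.1)).trans (by linarith)))
  filter_upwards [this] with z hz i hi using hz i ((hS i).2 hi)

/-- The residue theorem on the spheres. -/
theorem sum_sgn_mul_eq_zero (hf : IsRegularDifferential G X ρ t f) (h : X.Admissible G ρ c₁ c₂)
    {α : E → ℂ} (hα : ∀ e, α e = ∮ w in C(0, ρ / 2), endForm G X f (e, true) w)
    (ht : ∀ e, ‖t e‖ < ρ ^ 2 / 4) {v : V} {S : Finset (E × Bool)}
    (hS : ∀ i, i ∈ S ↔ vtx G i = v) : ∑ i ∈ S, sgn i.2 * α i.1 = 0 := by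
  -- Compare two values of lim z f(z): it is 0 by regularity at ∞, and the sum of the residues by
  -- the decomposition.
  have h1 := tendsto_finsetSum S fun i _ => hf.tendsto_mul_endPart h α i (ht i.1)
  have h2 : Tendsto (fun z => z * f v z) (cocompact ℂ)
      (𝓝 (∑ i ∈ S, (2 * π * I)⁻¹ * (sgn i.2 * α i.1))) := by
    refine h1.congr' ?_
    filter_upwards [eventually_mem_region h ht hS] with z hz
    rw [hf.eq_sum_endPart h hα ht hS hz, Finset.mul_sum]
  have h3 := tendsto_nhds_unique h2 (hf.tendsto_mul v)
  rw [← Finset.mul_sum] at h3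
  exact (mul_eq_zero.1 h3).resolve_left (inv_ne_zero two_pi_I_ne)

end IsRegularDifferential

end Decomposition

/-! ### A priori estimates from the core to the necks -/

section Bounds

open Complex Metric Set Filter
open scoped Real

variable {V E : Type*} {G : OrientedMultigraph V E} {X : NodeCoordinates E} {ρ c₁ c₂ ε : ℝ}
  {t : E → ℂ} {f : V → ℂ → ℂ}

namespace NodeCoordinates.Admissible

theorem notMem_source_of_norm_sub_le (h : X.Admissible G ρ c₁ c₂) (hε' : ε ≤ ρ * c₁)
    {i j : E × Bool} (hij : i ≠ j) (hv : vtx G i = vtx G j) {z : ℂ}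
    (hz : ‖z - X.p i.1 i.2‖ ≤ ε) : z ∉ (X.z j.1 j.2).source := fun hzj => by
  have := h.lt_norm_sub hij hv hzj
  linarith [mul_comm ρ c₁]

theorem le_norm_sub_of_notMem (h : X.Admissible G ρ c₁ c₂) {j : E × Bool} {z : ℂ}
    (hz : z ∉ (X.z j.1 j.2).source) : c₁ * ρ ≤ ‖z - X.p j.1 j.2‖ := by
  by_contra! hlt
  exact hz ((h.chart j).ball_subset_source (by rwa [mem_ball, dist_eq_norm]))

theorem mem_core (h : X.Admissible G ρ c₁ c₂) (hε' : ε ≤ ρ * c₁) {i : E × Bool} {z : ℂ}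
    (hzi : ε ≤ ‖z - X.p i.1 i.2‖)
    (hz : ∀ j, i ≠ j → vtx G i = vtx G j → z ∉ (X.z j.1 j.2).source) :
    z ∈ core G X ε (vtx G i) := by
  intro e b hv
  by_cases hij : i = (e, b)
  · subst hij
    exact hzi
  · have := h.le_norm_sub_of_notMem (hz (e, b) hij hv.symm)
    linarith [mul_comm ρ c₁]

/-- At the end's own center this is c₁ρ/2 ≥ ε/2, and at the others `lt_norm_sub`. Since these
circles may leave the core, estimates of model parts use d = ε/2; `SmallParameters.le_eps` is the
condition κ ≤ d/2 for this d. -/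
theorem half_le_norm_sub (h : X.Admissible G ρ c₁ c₂) (hε : 0 < ε) (hε' : ε ≤ ρ * c₁)
    {i j : E × Bool} (hv : vtx G i = vtx G j) {w : ℂ} (hw : w ∈ sphere (0 : ℂ) (ρ / 2)) :
    ε / 2 ≤ ‖(X.z i.1 i.2).symm w - X.p j.1 j.2‖ := by
  have hρ := h.rho_pos
  rw [mem_sphere_zero_iff_norm] at hw
  have hwρ : ‖w‖ < ρ := by linarith
  by_cases hij : j = i
  · subst hij
    have := (h.chart j).le_norm_symm_sub hwρ
    rw [hw] at this
    linarith
  · have := h.lt_norm_sub hij hv.symm ((h.chart i).symm_mem hwρ)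
    linarith [mul_comm ρ c₁]

theorem core_subset_region (h : X.Admissible G ρ c₁ c₂) (hε : 0 < ε)
    (ht : ∀ e, c₂ * (‖t e‖ / (ρ / 2)) ≤ ε / 2 / 2) (v : V) :
    core G X ε v ⊆ region G X t (ρ / 2) v := by
  intro z hz i hi hzi
  have h1 := hz i.1 i.2 hi
  have h2 := (h.chart i).upper z hzi.1
  have h3 := mul_le_mul_of_nonneg_left hzi.2 h.c₂_pos.le
  have h4 := ht i.1
  linarith

theorem symm_mem_region (h : X.Admissible G ρ c₁ c₂) (ht : ∀ e, ‖t e‖ < ρ ^ 2 / 4)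
    (i : E × Bool) {w : ℂ} (hw : w ∈ sphere (0 : ℂ) (ρ / 2)) :
    (X.z i.1 i.2).symm w ∈ region G X t (ρ / 2) (vtx G i) := by
  have hρ := h.rho_pos
  rw [mem_sphere_zero_iff_norm] at hw
  have hwρ : ‖w‖ < ρ := by linarith
  refine h.sdiff_subset_region i (ρ / 2) ⟨(h.chart i).symm_mem hwρ,
    (h.chart i).symm_notMem_closedDisk hwρ ?_⟩
  rw [hw]
  exact period_radius hρ (ht _)

end NodeCoordinates.Admissible

/-- The hypotheses on the size of the parameters `t_e` under which the geometric estimates hold. -/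
structure SmallParameters (ρ c₂ ε : ℝ) (t : E → ℂ) : Prop where
  lt_sq : ∀ e, ‖t e‖ < ρ ^ 2 / 4
  le_eps : ∀ e, c₂ * (‖t e‖ / (ρ / 2)) ≤ ε / 2 / 2

namespace IsRegularDifferential

variable {α : E → ℂ} {S : V → Finset (E × Bool)}

theorem norm_endPart_le (hf : IsRegularDifferential G X ρ t f) (h : X.Admissible G ρ c₁ c₂)
    (hε : 0 < ε) (hs : SmallParameters ρ c₂ ε t) (α : E → ℂ) (i : E × Bool) {N : ℝ}
    (hN : ∀ w ∈ sphere (0 : ℂ) (ρ / 2), ‖endForm G X f (opp i) w‖ ≤ N) {z : ℂ}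
    (hz : ε / 2 ≤ ‖z - X.p i.1 i.2‖) :
    ‖endPart G X (ρ / 2) t f α i z‖ ≤
      ‖α i.1‖ / (ε / 2) + 2 * c₂ / (ε / 2) ^ 2 * ‖t i.1‖ * N := by
  have hρ := h.rho_pos
  have := (h.chart i).norm_modelPart_le (a := sgn i.2 * α i.1) (by positivity)
    ((period_radius hρ (hs.lt_sq i.1)).trans (by linarith))
    (hf.continuousOn_endForm h (opp i) (hs.lt_sq i.1)) (by positivity) (hs.le_eps i.1) hN hz
  rwa [norm_mul, norm_sgn, one_mul] at this

/-- The remainder is the sum of the singular parts at the other ends of the vertex. Their disks miss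
the round closed ball of radius ε at p_i, so it is holomorphic up to the boundary of that ball. -/
theorem exists_rest (hf : IsRegularDifferential G X ρ t f) (h : X.Admissible G ρ c₁ c₂)
    (hε' : ε ≤ ρ * c₁) (hS : ∀ v i, i ∈ S v ↔ vtx G i = v)
    (hα : ∀ e, α e = ∮ w in C(0, ρ / 2), endForm G X f (e, true) w)
    (ht : ∀ e, ‖t e‖ < ρ ^ 2 / 4) (i : E × Bool) :
    ∃ R : ℂ → ℂ, DifferentiableOn ℂ R (closedBall (X.p i.1 i.2) ε) ∧
      ∀ z ∈ region G X t (ρ / 2) (vtx G i),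
        f (vtx G i) z = endPart G X (ρ / 2) t f α i z + R z := by
  classical
  refine ⟨fun z => ∑ j ∈ (S (vtx G i)).erase i, endPart G X (ρ / 2) t f α j z,
    DifferentiableOn.fun_sum fun j hj => (hf.differentiableOn_endPart h α j (ht j.1)).mono ?_, ?_⟩
  · intro z hz hzj
    rw [mem_closedBall, dist_eq_norm] at hz
    exact h.notMem_source_of_norm_sub_le hε' (Finset.ne_of_mem_erase hj).symm
      ((hS _ _).1 (Finset.mem_of_mem_erase hj)).symm hz hzj.1
  · intro z hz
    rw [hf.eq_sum_endPart h hα ht (hS _) hz,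
      ← Finset.add_sum_erase _ (fun j => endPart G X (ρ / 2) t f α j z) ((hS _ _).2 rfl)]

/-- A period is controlled by the differential on the core, up to a small multiple of its size on
the neck. -/
theorem norm_period_le (hf : IsRegularDifferential G X ρ t f) (h : X.Admissible G ρ c₁ c₂)
    (hε : 0 < ε) (hε' : ε ≤ ρ * c₁) (hS : ∀ v i, i ∈ S v ↔ vtx G i = v)
    (hα : ∀ e, α e = ∮ w in C(0, ρ / 2), endForm G X f (e, true) w)
    (hs : SmallParameters ρ c₂ ε t) {M N : ℝ} (hM : ∀ v, ∀ z ∈ core G X ε v, ‖f v z‖ ≤ M)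
    (i : E × Bool) (hN : ∀ w ∈ sphere (0 : ℂ) (ρ / 2), ‖endForm G X f (opp i) w‖ ≤ N) :
    ‖α i.1‖ ≤ 2 * π * ε * (M + 2 * c₂ / (ε / 2) ^ 2 * ‖t i.1‖ * N) := by
  have hρ := h.rho_pos
  obtain ⟨R, hR, hfR⟩ := hf.exists_rest h hε' hS hα hs.lt_sq i
  set p := X.p i.1 i.2 with hp
  have hpole : ContinuousOn (fun z => (2 * π * I)⁻¹ * (sgn i.2 * α i.1) * (z - p)⁻¹)
      (sphere p ε) := by
    refine continuousOn_const.mul ((continuousOn_id.sub continuousOn_const).inv₀ fun z hz h0 => ?_)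
    have h0 : z = p := sub_eq_zero.1 h0
    rw [h0] at hz
    simp [hε.ne] at hz
  have hR0 : (∮ z in C(p, ε), R z) = 0 :=
    (DifferentiableOn.diffContOnCl (by rwa [closure_ball _ hε.ne'])).circleIntegral_eq_zero hε.le
  have hpole1 : (∮ z in C(p, ε), (2 * π * I)⁻¹ * (sgn i.2 * α i.1) * (z - p)⁻¹) =
      sgn i.2 * α i.1 := by
    rw [circleIntegral.integral_const_mul, circleIntegral.integral_sub_center_inv p hε.ne',
      mul_comm, mul_inv_cancel_left₀ two_pi_I_ne]
  have hsum := circleIntegral.integral_add (hpole.circleIntegrable hε.le)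
    ((hR.continuousOn.mono sphere_subset_closedBall).circleIntegrable hε.le)
  rw [hR0, hpole1, add_zero] at hsum
  have hnorm : ‖α i.1‖ = ‖sgn i.2 * α i.1‖ := by rw [norm_mul, norm_sgn, one_mul]
  rw [hnorm, ← hsum]
  refine circleIntegral.norm_integral_le_of_norm_le_const hε.le fun z hz => ?_
  rw [mem_sphere_iff_norm] at hz
  have hcore : z ∈ core G X ε (vtx G i) := h.mem_core hε' hz.ge fun j hij hv =>
    h.notMem_source_of_norm_sub_le hε' hij hv hz.le
  have h1 := hfR z (h.core_subset_region hε hs.le_eps _ hcore)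
  have h2 := (h.chart i).norm_modelPart_sub_pole_le (a := sgn i.2 * α i.1) (by positivity)
    ((period_radius hρ (hs.lt_sq i.1)).trans (by linarith))
    (hf.continuousOn_endForm h (opp i) (hs.lt_sq i.1)) (by positivity) (hs.le_eps i.1) hN
    (show ε / 2 ≤ ‖z - p‖ by linarith)
  -- On |z - p| = ε, inside the core, pole + R differs from f only by the O(|t|) error of the model
  -- part. Its integral is the signed period, as R contributes 0.
  have h3 : (2 * π * I)⁻¹ * (sgn i.2 * α i.1) * (z - p)⁻¹ + R z = f (vtx G i) z -
      (endPart G X (ρ / 2) t f α i z - (2 * π * I)⁻¹ * (sgn i.2 * α i.1) * (z - p)⁻¹) := by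
    rw [h1]
    ring
  rw [h3]
  exact (norm_sub_le _ _).trans (add_le_add (hM _ _ hcore) h2)

/-- The maximum principle on a disk around an end. -/
theorem norm_endForm_le (hf : IsRegularDifferential G X ρ t f) (h : X.Admissible G ρ c₁ c₂)
    (hε : 0 < ε) (hε' : ε ≤ ρ * c₁) (hS : ∀ v i, i ∈ S v ↔ vtx G i = v)
    (hα : ∀ e, α e = ∮ w in C(0, ρ / 2), endForm G X f (e, true) w)
    (hs : SmallParameters ρ c₂ ε t) {M N : ℝ} (hM : ∀ v, ∀ z ∈ core G X ε v, ‖f v z‖ ≤ M)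
    (i : E × Bool) (hN : ∀ w ∈ sphere (0 : ℂ) (ρ / 2), ‖endForm G X f (opp i) w‖ ≤ N)
    {w : ℂ} (hw : w ∈ sphere (0 : ℂ) (ρ / 2)) :
    ‖endForm G X f i w‖ ≤ 4 * c₂ * ((1 + 8 * π) * M) +
      4 * c₂ * ((8 * π + 2) * (2 * c₂ / (ε / 2) ^ 2)) * ‖t i.1‖ * N := by
  have hρ := h.rho_pos
  have hc₂ := h.c₂_pos
  obtain ⟨R, hR, hfR⟩ := hf.exists_rest h hε' hS hα hs.lt_sq i
  have hw' := hw
  rw [mem_sphere_zero_iff_norm] at hw'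
  have hN0 : 0 ≤ N := (norm_nonneg _).trans (hN w hw)
  have hper := hf.norm_period_le h hε hε' hS hα hs hM i hN
  set k := 2 * c₂ / (ε / 2) ^ 2 * ‖t i.1‖ * N with hk
  have hk0 : 0 ≤ k := by positivity
  -- Here 4π = 2πε / (ε/2).
  have hper2 : ‖α i.1‖ / (ε / 2) ≤ 4 * π * (M + k) := by
    rw [div_le_iff₀ (by positivity)]
    linarith
  set z := (X.z i.1 i.2).symm w with hz
  have hdz := h.half_le_norm_sub hε hε' (i := i) (j := i) rfl hw
  have hM0 : 0 ≤ M := by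
    have hcore : X.p i.1 i.2 + ε ∈ core G X ε (vtx G i) := by
      have hn : ‖X.p i.1 i.2 + ε - X.p i.1 i.2‖ = ε := by
        rw [add_sub_cancel_left, norm_real, Real.norm_of_nonneg hε.le]
      exact h.mem_core hε' hn.ge fun j hij hv => h.notMem_source_of_norm_sub_le hε' hij hv hn.le
    exact (norm_nonneg _).trans (hM _ _ hcore)
  have hfz : ‖f (vtx G i) z‖ ≤ (1 + 8 * π) * M + (8 * π + 2) * k := by
    have hπ := Real.pi_pos
    -- Either z lies in the core, or it lies in the ball of radius ε, where R is bounded by its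
    -- values on the boundary. Then M + (4π(M+k)+k) for R and 4π(M+k)+k for the singular part add up
    -- to the stated constants.
    by_cases hzε : ε ≤ ‖z - X.p i.1 i.2‖
    · have hcore : z ∈ core G X ε (vtx G i) := h.mem_core hε' hzε fun j hij hv hzj =>
        disjoint_left.1 (h.disjoint_source hij hv) ((h.chart i).symm_mem (by linarith)) hzj
      have := hM _ _ hcore
      nlinarith [mul_nonneg hπ.le hM0, mul_nonneg hπ.le hk0]
    · have hRz : ‖R z‖ ≤ M + (4 * π * (M + k) + k) := by
        refine norm_le_of_forall_mem_frontier_norm_le (U := ball (X.p i.1 i.2) ε) isBounded_ball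
          (DifferentiableOn.diffContOnCl (by rwa [closure_ball _ hε.ne'])) (fun y hy => ?_)
          (subset_closure (by
            rw [mem_ball, dist_eq_norm]
            exact not_le.1 hzε))
        rw [frontier_ball _ hε.ne', mem_sphere_iff_norm] at hy
        have hcore : y ∈ core G X ε (vtx G i) := h.mem_core hε' hy.ge fun j hij hv =>
          h.notMem_source_of_norm_sub_le hε' hij hv hy.le
        have h1 := hfR y (h.core_subset_region hε hs.le_eps _ hcore)
        have h2 := hf.norm_endPart_le h hε hs α i hN (z := y) (by linarith)
        have h3 : R y = f (vtx G i) y - endPart G X (ρ / 2) t f α i y := by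
          rw [h1]
          ring
        rw [h3]
        refine (norm_sub_le _ _).trans (add_le_add (hM _ _ hcore) ?_)
        linarith
      have h2 := hf.norm_endPart_le h hε hs α i hN hdz
      rw [hfR z (h.symm_mem_region hs.lt_sq i hw)]
      refine (norm_add_le _ _).trans ?_
      nlinarith
  have hd := (h.chart i).norm_deriv_symm_le hw'
  calc ‖endForm G X f i w‖ = ‖f (vtx G i) z‖ * ‖deriv (X.z i.1 i.2).symm w‖ := norm_mul _ _
    _ ≤ ((1 + 8 * π) * M + (8 * π + 2) * k) * (4 * c₂) := by gcongr
    _ = _ := by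
      rw [hk]
      ring

/-- On the necks, a differential is controlled by its values on the core. -/
theorem norm_endForm_le_of_small (hf : IsRegularDifferential G X ρ t f)
    (h : X.Admissible G ρ c₁ c₂) (hε : 0 < ε) (hε' : ε ≤ ρ * c₁)
    (hS : ∀ v i, i ∈ S v ↔ vtx G i = v)
    (hα : ∀ e, α e = ∮ w in C(0, ρ / 2), endForm G X f (e, true) w)
    (hs : SmallParameters ρ c₂ ε t) {M : ℝ} (hM : ∀ v, ∀ z ∈ core G X ε v, ‖f v z‖ ≤ M)
    (ht : ∀ e, 4 * c₂ * ((8 * π + 2) * (2 * c₂ / (ε / 2) ^ 2)) * ‖t e‖ ≤ 1 / 2)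
    (i : E × Bool) {w : ℂ} (hw : w ∈ sphere (0 : ℂ) (ρ / 2)) :
    ‖endForm G X f i w‖ ≤ 2 * (4 * c₂ * ((1 + 8 * π) * M)) := by
  have hne : (sphere (0 : ℂ) (ρ / 2)).Nonempty := ⟨w, hw⟩
  obtain ⟨e, b⟩ := i
  choose m hm hmax using fun b => (isCompact_sphere (0 : ℂ) (ρ / 2)).exists_isMaxOn hne
    (hf.continuousOn_endForm h (e, b) (hs.lt_sq e)).norm
  have hmax : ∀ b, ∀ w ∈ sphere (0 : ℂ) (ρ / 2), ‖endForm G X f (e, b) w‖ ≤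
      ‖endForm G X f (e, b) (m b)‖ := fun b w hw => hmax b hw
  -- At the side of the edge with the larger maximum, the bound for the opposite side is at most
  -- this maximum, so it can be absorbed with factor 1/2. Working edge by edge with attained maxima
  -- needs no prior uniform bound over all edges.
  have key : ∀ b, (∀ b', ‖endForm G X f (e, b') (m b')‖ ≤ ‖endForm G X f (e, b) (m b)‖) →
      ‖endForm G X f (e, b) (m b)‖ ≤ 2 * (4 * c₂ * ((1 + 8 * π) * M)) := by
    intro b hb
    have h1 := hf.norm_endForm_le h hε hε' hS hα hs hM (e, b)
      (fun w hw => (hmax (!b) w hw).trans (hb (!b))) (hm b)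
    have h2 := mul_le_mul_of_nonneg_right (ht e) (norm_nonneg (endForm G X f (e, b) (m b)))
    simp only at h1
    linarith
  rcases le_total ‖endForm G X f (e, true) (m true)‖ ‖endForm G X f (e, false) (m false)‖ with
    hle | hle
  · have hall : ∀ b', ‖endForm G X f (e, b') (m b')‖ ≤ ‖endForm G X f (e, false) (m false)‖ := by
      intro b'
      cases b'
      exacts [le_rfl, hle]
    exact (hmax b w hw).trans ((hall b).trans (key false hall))
  · have hall : ∀ b', ‖endForm G X f (e, b') (m b')‖ ≤ ‖endForm G X f (e, true) (m true)‖ := by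
      intro b'
      cases b'
      exacts [hle, le_rfl]
    exact (hmax b w hw).trans ((hall b).trans (key true hall))

/-- A differential whose coefficients vanish on the circles `|z_e^±| = ρ / 2`, and whose periods
vanish, is zero. -/
theorem eq_zero_of_endForm (hf : IsRegularDifferential G X ρ t f) (h : X.Admissible G ρ c₁ c₂)
    (hS : ∀ v i, i ∈ S v ↔ vtx G i = v) (ht : ∀ e, ‖t e‖ < ρ ^ 2 / 4)
    (h0 : ∀ i, ∀ w ∈ sphere (0 : ℂ) (ρ / 2), endForm G X f i w = 0) : f = 0 := by
  have hρ := h.rho_pos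
  have hr : (0 : ℝ) < ρ / 2 := by positivity
  have hint : ∀ i, (∮ w in C(0, ρ / 2), endForm G X f i w) = 0 := by
    intro i
    rw [circleIntegral.integral_congr hr.le (g := fun _ => (0 : ℂ)) fun w hw => h0 i w hw]
    simp [circleIntegral]
  have hreg : ∀ v, ∀ z ∈ region G X t (ρ / 2) v, f v z = 0 := by
    intro v z hz
    rw [hf.eq_sum_endPart h (α := 0) (fun e => (hint _).symm) ht (hS v) hz]
    refine Finset.sum_eq_zero fun i _ => ?_
    rw [endPart, modelPart, hint, cauchyInt_congr hr.le (g' := fun _ => 0)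
      (fun w hw => h0 (opp i) w hw) (fun w _ => rfl)]
    simp [cauchyInt, circleIntegral]
  ext v z
  by_cases hpart : z ∈ part G X ρ t v
  · by_cases hz : z ∈ region G X t (ρ / 2) v
    · exact hreg v z hz
    -- The remaining points satisfy |t|/ρ < |z_i| ≤ |t|/(ρ/2). Reflection sends them to |z_{opp i}|
    -- ≥ ρ/2 at the other end, where f is already known to vanish.
    · simp only [region, mem_ofPred_eq, not_forall, not_not] at hz
      obtain ⟨i, rfl, hzi⟩ := hz
      rw [part_eq_region] at hpart
      have hann : ‖t i.1‖ / ρ < ‖X.z i.1 i.2 z‖ := by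
        by_contra! hle
        exact hpart i rfl ⟨hzi.1, hle⟩
      have hti : t i.1 ≠ 0 := by
        intro h0
        have h1 := hzi.2
        rw [h0, norm_zero, zero_div] at h1 hann
        linarith
      have hζ := (h.chart i).norm_lt hzi.1
      have hmem := norm_div_mem_annulus hti hann hζ hρ
      have hge : ‖t i.1‖ / (ρ / 2) < ‖t i.1 / X.z i.1 i.2 z‖ := by
        refine (period_radius hρ (ht _)).trans_le ?_
        have hpos : 0 < ‖X.z i.1 i.2 z‖ := (by positivity : 0 ≤ ‖t i.1‖ / ρ).trans_lt hann
        rw [norm_div, le_div_iff₀ hpos, mul_comm]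
        exact (le_div_iff₀ hr).1 hzi.2
      have hz0 : endForm G X f (opp i) (t i.1 / X.z i.1 i.2 z) = 0 := by
        refine mul_eq_zero_of_left (hreg _ _ (h.sdiff_subset_region (opp i) (ρ / 2)
          ⟨(h.chart (opp i)).symm_mem hmem.2,
            (h.chart (opp i)).symm_notMem_closedDisk hmem.2 hge⟩)) _
      have h1 := hf.endForm_eq_reflect h i hti hann hζ
      rw [reflect, hz0, mul_zero] at h1
      have h2 := (h.chart i).chartForm_apply (f := f (vtx G i)) hzi.1
      rw [← h2]
      change endForm G X f i _ * _ = 0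
      rw [h1, zero_mul]
  · exact hf.off_part v z hpart

end IsRegularDifferential

end Bounds

/-! ### From a fixed point to a regular differential -/

section Construction

open Complex Metric Set Filter
open scoped Real

/-- If a function on the annulus `‖t‖ / r < ‖ζ‖ < r` extends to the disk, and so does its image
under the reflection `ζ ↦ t / ζ`, then it vanishes. -/
theorem eq_zero_of_eq_neg_reflect {t : ℂ} (ht : t ≠ 0) {r : ℝ} (hr : 0 < r) (htr : ‖t‖ / r < r)
    {Δ Δ' : ℂ → ℂ}
    (h : ∀ s, ‖t‖ / r < s → s < r → ∃ k : ℂ → ℂ, DifferentiableOn ℂ k (ball 0 s) ∧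
      ∀ ζ, ‖t‖ / r < ‖ζ‖ → ‖ζ‖ < s → Δ ζ = k ζ)
    (h' : ∀ s, ‖t‖ / r < s → s < r → ∃ k : ℂ → ℂ, DifferentiableOn ℂ k (ball 0 s) ∧
      ∀ ζ, ‖t‖ / r < ‖ζ‖ → ‖ζ‖ < s → Δ' ζ = k ζ)
    (hΔ : ∀ ζ, ‖t‖ / r < ‖ζ‖ → ‖ζ‖ < r → Δ ζ = -reflect t Δ' ζ) {ζ : ℂ} (hζ : ‖t‖ / r < ‖ζ‖)
    (hζ' : ‖ζ‖ < r) : Δ ζ = 0 := by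
  have ht' : 0 < ‖t‖ := norm_pos_iff.2 ht
  have htr' : ‖t‖ < r ^ 2 := by
    rw [div_lt_iff₀ hr] at htr
    linarith [sq r]
  have hsq : Real.sqrt ‖t‖ < r := (Real.sqrt_lt' hr).2 htr'
  -- Taking s > √|t| makes the annulus |t|/s < |w| < s nonempty, so the disk |w| < s and the
  -- exterior |w| > |t|/s cover the plane.
  obtain ⟨s, hs1, hs2⟩ := exists_between (max_lt hζ' hsq)
  have hs3 : ‖ζ‖ < s := (le_max_left _ _).trans_lt hs1
  have hs : 0 < s := (norm_nonneg ζ).trans_lt hs3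
  have hs4 : ‖t‖ < s ^ 2 := (Real.sqrt_lt' hs).1 ((le_max_right _ _).trans_lt hs1)
  have hs5 : ‖t‖ / s < s := by
    rw [div_lt_iff₀ hs, ← sq]
    exact hs4
  have hs6 : ‖t‖ / r < ‖t‖ / s := div_lt_div_of_pos_left ht' hs hs2
  obtain ⟨k, hk, hΔk⟩ := h s (hs6.trans hs5) hs2
  obtain ⟨k', hk', hΔk'⟩ := h' s (hs6.trans hs5) hs2
  have hne : ∀ w : ℂ, ‖t‖ / s < ‖w‖ → w ≠ 0 := by
    rintro w hw rfl
    rw [norm_zero] at hw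
    exact absurd hw (not_lt.2 (by positivity))
  have hsmall : ∀ w : ℂ, ‖t‖ / s < ‖w‖ → ‖t / w‖ < s := by
    intro w hw
    rw [norm_div, div_lt_iff₀ (norm_pos_iff.2 (hne w hw)), mul_comm]
    exact (div_lt_iff₀ hs).1 hw
  have hdiv : ∀ (c : ℂ) (n : ℕ), DifferentiableOn ℂ (fun w => c / w ^ n)
      {w : ℂ | ‖t‖ / s < ‖w‖} := fun c n =>
    (differentiableOn_const c).div (differentiableOn_id.pow n) fun w hw => pow_ne_zero n (hne w hw)
  -- The extension k on the disk and -reflect k' outside agree on the annulus. As k' is continuous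
  -- at 0, reflect k' is O(1/w²) at infinity, and Liouville applies.
  obtain ⟨Φ, hΦ1, hΦ2, hΦ⟩ := exists_piecewise_differentiable (ι := Unit)
    (W := {w : ℂ | ‖t‖ / s < ‖w‖}) (D := fun _ => ball 0 s) (u := fun w => -reflect t k' w)
    (e := fun _ => k) (isOpen_lt continuous_const continuous_norm) (fun _ => isOpen_ball)
    (fun i j hij => (hij rfl).elim)
    ((hdiv t 2).neg.mul (hk'.comp (by simpa using hdiv t 1) fun w hw => by
      rw [mem_ball_zero_iff]
      exact hsmall w hw)).neg (fun _ => hk)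
    (fun _ w hw => by
      have hw2 : ‖w‖ < s := by simpa using hw.2
      have hann := norm_div_mem_annulus ht hw.1 hw2 hs
      rw [← hΔk w (hs6.trans hw.1) hw2, hΔ w (hs6.trans hw.1) (hw2.trans hs2)]
      simp only [reflect]
      rw [hΔk' _ (hs6.trans hann.1) hann.2])
  have huniv : {w : ℂ | ‖t‖ / s < ‖w‖} ∪ ⋃ _ : Unit, ball (0 : ℂ) s = univ := by
    refine eq_univ_of_forall fun w => ?_
    by_cases hw : ‖t‖ / s < ‖w‖
    · exact Or.inl hw
    · exact Or.inr (mem_iUnion.2 ⟨(), by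
        rw [mem_ball_zero_iff]
        exact (not_lt.1 hw).trans_lt hs5⟩)
  rw [huniv, differentiableOn_univ] at hΦ
  have hinv : Tendsto (fun w : ℂ => w⁻¹) (cocompact ℂ) (𝓝 0) :=
    tendsto_inv_cocompact_nhdsNE.mono_right nhdsWithin_le_nhds
  have hlim : Tendsto Φ (cocompact ℂ) (𝓝 0) := by
    have h1 : Tendsto (fun w : ℂ => t / w) (cocompact ℂ) (𝓝 0) := by
      simpa [div_eq_mul_inv] using hinv.const_mul t
    have h2 : Tendsto (fun w : ℂ => t / w ^ 2) (cocompact ℂ) (𝓝 0) := by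
      simpa [div_eq_mul_inv] using (hinv.pow 2).const_mul t
    have hk0 : ContinuousAt k' 0 :=
      (hk'.differentiableAt (isOpen_ball.mem_nhds (mem_ball_self hs))).continuousAt
    have h3 := (h2.neg.mul (hk0.tendsto.comp h1)).neg
    simp only [neg_zero, zero_mul] at h3
    refine h3.congr' ?_
    filter_upwards [(isCompact_closedBall (0 : ℂ) (‖t‖ / s)).compl_mem_cocompact] with w hw
    have hw : ‖t‖ / s < ‖w‖ := by simpa using hw
    exact (hΦ1 hw).symm
  rw [hΔk ζ hζ hs3, ← hΦ2 () (show ζ ∈ ball 0 s by simpa using hs3)]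
  exact eq_zero_of_tendsto_cocompact hΦ hlim ζ

variable {V E : Type*} {G : OrientedMultigraph V E} {X : NodeCoordinates E} {ρ c₁ c₂ ε : ℝ}
  {t : E → ℂ}

/-- The sum of model parts, at the ends of edges at one vertex, defined by a family `g` of functions
on the circles of radius `r`. -/
def modelSum (X : NodeCoordinates E) (r : ℝ) (t α : E → ℂ) (S : Finset (E × Bool))
    (g : E × Bool → ℂ → ℂ) (z : ℂ) : ℂ :=
  ∑ i ∈ S, modelPart (X.z i.1 i.2) (X.p i.1 i.2) r (t i.1) (sgn i.2 * α i.1) (g (opp i)) z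

theorem isOpen_region (h : X.Admissible G ρ c₁ c₂) {r : ℝ} (ht : ∀ e, ‖t e‖ / r < ρ)
    {S : V → Finset (E × Bool)} (hS : ∀ v i, i ∈ S v ↔ vtx G i = v) (v : V) :
    IsOpen (region G X t r v) := by
  have : region G X t r v = ⋂ i ∈ S v, (closedDisk (X.z i.1 i.2) (‖t i.1‖ / r))ᶜ := by
    ext z
    simp [region, hS]
  rw [this]
  exact isOpen_biInter_finset fun i _ => (h.chart i).isOpen_compl_closedDisk (ht i.1)

section

variable {S : V → Finset (E × Bool)} {α : E → ℂ} {g : E × Bool → ℂ → ℂ}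

theorem differentiableOn_model (h : X.Admissible G ρ c₁ c₂) (ht : ∀ e, ‖t e‖ < ρ ^ 2 / 4)
    (hg : ∀ i, ContinuousOn (g i) (sphere 0 (ρ / 2))) (a : ℂ) (i : E × Bool) :
    DifferentiableOn ℂ (modelPart (X.z i.1 i.2) (X.p i.1 i.2) (ρ / 2) (t i.1) a (g (opp i)))
      (closedDisk (X.z i.1 i.2) (‖t i.1‖ / (ρ / 2)))ᶜ := by
  have hρ := h.rho_pos
  exact (h.chart i).differentiableOn_modelPart (by positivity)
    ((period_radius hρ (ht i.1)).trans (by linarith)) (hg _)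

theorem differentiableOn_modelSum_erase [DecidableEq (E × Bool)] (h : X.Admissible G ρ c₁ c₂)
    (ht : ∀ e, ‖t e‖ < ρ ^ 2 / 4) (hS : ∀ v i, i ∈ S v ↔ vtx G i = v)
    (hg : ∀ i, ContinuousOn (g i) (sphere 0 (ρ / 2))) (i : E × Bool) :
    DifferentiableOn ℂ (modelSum X (ρ / 2) t α ((S (vtx G i)).erase i) g) (X.z i.1 i.2).source := by
  refine DifferentiableOn.fun_sum fun j hj => (differentiableOn_model h ht hg _ j).mono ?_
  intro z hz hzj
  exact disjoint_left.1 (h.disjoint_source (Finset.ne_of_mem_erase hj).symm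
    ((hS _ _).1 (Finset.mem_of_mem_erase hj)).symm) hz hzj.1

theorem modelSum_eq_add [DecidableEq (E × Bool)] (hS : ∀ v i, i ∈ S v ↔ vtx G i = v) (r : ℝ)
    (i : E × Bool) (z : ℂ) : modelSum X r t α (S (vtx G i)) g z =
      modelPart (X.z i.1 i.2) (X.p i.1 i.2) r (t i.1) (sgn i.2 * α i.1) (g (opp i)) z +
        modelSum X r t α ((S (vtx G i)).erase i) g z := by
  have hi : i ∈ S (vtx G i) := (hS (vtx G i) i).2 rfl
  simp only [modelSum]
  rw [← Finset.add_sum_erase _ _ hi]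

theorem differentiableOn_modelSum (h : X.Admissible G ρ c₁ c₂) (ht : ∀ e, ‖t e‖ < ρ ^ 2 / 4)
    (hS : ∀ v i, i ∈ S v ↔ vtx G i = v) (hg : ∀ i, ContinuousOn (g i) (sphere 0 (ρ / 2)))
    (v : V) :
    DifferentiableOn ℂ (modelSum X (ρ / 2) t α (S v) g) (region G X t (ρ / 2) v) :=
  DifferentiableOn.fun_sum fun i hi => (differentiableOn_model h ht hg _ i).mono
    fun _ hz => hz i ((hS v i).1 hi)

theorem differentiableOn_endForm_modelSum (h : X.Admissible G ρ c₁ c₂)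
    (ht : ∀ e, ‖t e‖ < ρ ^ 2 / 4) (hS : ∀ v i, i ∈ S v ↔ vtx G i = v)
    (hg : ∀ i, ContinuousOn (g i) (sphere 0 (ρ / 2))) (i : E × Bool) :
    DifferentiableOn ℂ (endForm G X (fun v => modelSum X (ρ / 2) t α (S v) g) i)
      {w | ‖t i.1‖ / (ρ / 2) < ‖w‖ ∧ ‖w‖ < ρ} :=
  (h.chart i).differentiableOn_chartForm_annulus
    ((differentiableOn_modelSum h ht hS hg _).mono (h.sdiff_subset_region i _))

theorem tendsto_mul_modelSum (h : X.Admissible G ρ c₁ c₂) (ht : ∀ e, ‖t e‖ < ρ ^ 2 / 4)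
    (hg : ∀ i, ContinuousOn (g i) (sphere 0 (ρ / 2))) (v : V)
    (hα : ∑ i ∈ S v, sgn i.2 * α i.1 = 0) :
    Tendsto (fun z => z * modelSum X (ρ / 2) t α (S v) g z) (cocompact ℂ) (𝓝 0) := by
  have hρ := h.rho_pos
  have h1 := tendsto_finsetSum (S v) fun i _ =>
    (h.chart i).tendsto_mul_modelPart (a := sgn i.2 * α i.1) (t := t i.1) (by positivity)
      ((period_radius hρ (ht i.1)).trans (by linarith)) (hg (opp i))
  rw [← Finset.mul_sum, hα, mul_zero] at h1
  refine h1.congr fun z => ?_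
  rw [modelSum, Finset.mul_sum]

/-- The periods of a sum of model parts. -/
theorem circleIntegral_endForm_modelSum (h : X.Admissible G ρ c₁ c₂)
    (ht : ∀ e, ‖t e‖ < ρ ^ 2 / 4) (hS : ∀ v i, i ∈ S v ↔ vtx G i = v)
    (hg : ∀ i, ContinuousOn (g i) (sphere 0 (ρ / 2))) (i : E × Bool) :
    (∮ w in C(0, ρ / 2), endForm G X (fun v => modelSum X (ρ / 2) t α (S v) g) i w) =
      sgn i.2 * α i.1 := by
  classical
  have hρ := h.rho_pos
  have hr : 0 < ρ / 2 := by positivity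
  have hrρ : ρ / 2 < ρ := by linarith
  have htr := period_radius hρ (ht i.1)
  set a := sgn i.2 * α i.1
  set m := modelPart (X.z i.1 i.2) (X.p i.1 i.2) (ρ / 2) (t i.1) a (g (opp i)) with hm
  set R := modelSum X (ρ / 2) t α ((S (vtx G i)).erase i) g with hR
  have hmd := differentiableOn_model h ht hg a i
  -- The part of the end itself has period `a` by its residue at infinity; the other parts are
  -- holomorphic in this disk and contribute 0.
  have h1 : (∮ w in C(0, ρ / 2), chartForm (X.z i.1 i.2) m w) = a := by
    rw [(h.chart i).circleIntegral_chartForm (by positivity) htr hrρ hmd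
      ((h.chart i).tendsto_mul_modelPart hr (htr.trans hrρ) (hg _)),
      mul_inv_cancel_left₀ two_pi_I_ne]
  have hRd : DifferentiableOn ℂ (chartForm (X.z i.1 i.2) R) (ball 0 ρ) :=
    (h.chart i).differentiableOn_chartForm (differentiableOn_modelSum_erase h ht hS hg i)
      subset_rfl fun w hw => (h.chart i).symm_mem (by simpa using hw)
  have h2 : (∮ w in C(0, ρ / 2), chartForm (X.z i.1 i.2) R w) = 0 := by
    refine circleIntegral_eq_zero_of_differentiable_on_off_countable hr.le countable_empty
      (hRd.continuousOn.mono (closedBall_subset_ball hrρ)) ?_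
    rintro w ⟨hw, -⟩
    exact hRd.differentiableAt (isOpen_ball.mem_nhds (ball_subset_ball hrρ.le hw))
  have hc1 : ContinuousOn (chartForm (X.z i.1 i.2) m) (sphere 0 (ρ / 2)) := by
    refine ((h.chart i).differentiableOn_chartForm_annulus
      (hmd.mono fun z hz => hz.2)).continuousOn.mono fun w hw => ?_
    rw [mem_sphere_zero_iff_norm] at hw
    rw [mem_ofPred_eq, hw]
    exact ⟨htr, hrρ⟩
  have hc2 : ContinuousOn (chartForm (X.z i.1 i.2) R) (sphere 0 (ρ / 2)) :=
    hRd.continuousOn.mono (sphere_subset_closedBall.trans (closedBall_subset_ball hrρ))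
  have h3 := circleIntegral.integral_add (hc1.circleIntegrable hr.le) (hc2.circleIntegrable hr.le)
  rw [h1, h2, add_zero] at h3
  rw [← h3]
  refine circleIntegral.integral_congr hr.le fun w _ => ?_
  simp only [endForm, chartForm, modelSum_eq_add hS (ρ / 2) i, hm, hR]
  ring

/-- The sum of model parts built from a family `g` with the fixed point property satisfies the
gluing conditions. -/
theorem endForm_modelSum_eq_reflect (h : X.Admissible G ρ c₁ c₂) (ht : ∀ e, ‖t e‖ < ρ ^ 2 / 4)
    (hS : ∀ v i, i ∈ S v ↔ vtx G i = v) (hg : ∀ i, ContinuousOn (g i) (sphere 0 (ρ / 2)))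
    (hfix : ∀ i, ∀ w ∈ sphere (0 : ℂ) (ρ / 2),
      g i w = endForm G X (fun v => modelSum X (ρ / 2) t α (S v) g) i w)
    (i : E × Bool) (hti : t i.1 ≠ 0) {ζ : ℂ} (hζ : ‖t i.1‖ / (ρ / 2) < ‖ζ‖) (hζ' : ‖ζ‖ < ρ / 2) :
    endForm G X (fun v => modelSum X (ρ / 2) t α (S v) g) i ζ =
      reflect (t i.1) (endForm G X (fun v => modelSum X (ρ / 2) t α (S v) g) (opp i)) ζ := by
  classical
  have hρ := h.rho_pos
  have hr : 0 < ρ / 2 := by positivity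
  have hrρ : ρ / 2 < ρ := by linarith
  set F := endForm G X (fun v => modelSum X (ρ / 2) t α (S v) g) with hF
  have hFd : ∀ i : E × Bool, DifferentiableOn ℂ (F i) {w | ‖t i.1‖ / (ρ / 2) < ‖w‖ ∧ ‖w‖ < ρ} :=
    differentiableOn_endForm_modelSum h ht hS hg
  -- Let P = reflect F_{opp i}. By the fixed point property the singular part at i is the Cauchy
  -- integral of P on the inner circle. The jump formula writes P as ψ' times the inner integral
  -- minus the one on |w| = s, with ψ the inverse coordinate. So F_i - P is ψ' times the remaining
  -- parts plus the integral on |w| = s, which is holomorphic on the whole disk |ζ| < s. The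
  -- restriction s < ρ/2 is the outer limit of the annulus where P is holomorphic.
  have hext : ∀ i : E × Bool, t i.1 ≠ 0 → ∀ s, ‖t i.1‖ / (ρ / 2) < s → s < ρ / 2 →
      ∃ k : ℂ → ℂ, DifferentiableOn ℂ k (ball 0 s) ∧ ∀ ζ, ‖t i.1‖ / (ρ / 2) < ‖ζ‖ → ‖ζ‖ < s →
        F i ζ - reflect (t i.1) (F (opp i)) ζ = k ζ := by
    intro i hti s hs1 hs2
    have hs : 0 < s := (by positivity : (0 : ℝ) ≤ ‖t i.1‖ / (ρ / 2)).trans_lt hs1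
    have hpos : 0 < ‖t i.1‖ / (ρ / 2) := div_pos (norm_pos_iff.2 hti) hr
    have hlt : ‖t i.1‖ / ρ < ‖t i.1‖ / (ρ / 2) :=
      div_lt_div_of_pos_left (norm_pos_iff.2 hti) hr hrρ
    have hint : sgn i.2 * α i.1 = -∮ w in C(0, ρ / 2), F (opp i) w := by
      rw [hF, circleIntegral_endForm_modelSum h ht hS hg (opp i)]
      obtain ⟨e, b⟩ := i
      cases b <;> simp [sgn, opp]
    have hmodel : ∀ z, modelPart (X.z i.1 i.2) (X.p i.1 i.2) (ρ / 2) (t i.1) (sgn i.2 * α i.1)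
        (g (opp i)) z = cauchyInt (‖t i.1‖ / (ρ / 2)) (reflect (t i.1) (F (opp i)))
          (X.z i.1 i.2).symm z := by
      intro z
      rw [← modelPart_eq_cauchyInt (p := X.p i.1 i.2) hti hr hint z, modelPart, modelPart,
        circleIntegral.integral_congr hr.le (hfix (opp i)),
        cauchyInt_congr hr.le (hfix (opp i)) fun w _ => rfl]
    have hP : DifferentiableOn ℂ (reflect (t i.1) (F (opp i)))
        {w | ‖t i.1‖ / ρ < ‖w‖ ∧ ‖w‖ < ρ / 2} :=
      differentiableOn_reflect hti hρ (hFd (opp i))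
    have hsub : ball (0 : ℂ) (ρ / 2) ⊆ ball 0 ρ := ball_subset_ball hrρ.le
    refine ⟨chartForm (X.z i.1 i.2) (fun z => modelSum X (ρ / 2) t α ((S (vtx G i)).erase i) g z +
      cauchyInt s (reflect (t i.1) (F (opp i))) (X.z i.1 i.2).symm z), ?_, ?_⟩
    · refine (h.chart i).differentiableOn_chartForm (U := openDisk (X.z i.1 i.2) s)
        (((differentiableOn_modelSum_erase h ht hS hg i).mono fun z hz => hz.1).add
          ((h.chart i).differentiableOn_cauchyInt_inner hs.le (hs2.trans hrρ)
            (hP.continuousOn.mono fun w hw => ?_))) (ball_subset_ball (hs2.trans hrρ).le)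
        fun w hw => ?_
      · rw [mem_sphere_zero_iff_norm] at hw
        rw [mem_ofPred_eq, hw]
        exact ⟨hlt.trans hs1, hs2⟩
      · have hw : ‖w‖ < s := by simpa using hw
        exact (h.chart i).symm_mem_openDisk (hw.trans (hs2.trans hrρ)) hw
    · intro ζ hζ hζ'
      have hζρ : ‖ζ‖ < ρ := hζ'.trans (hs2.trans hrρ)
      have hj := cauchyInt_jump hpos hlt hs2 hP ((h.chart i).differentiableOn_symm.mono hsub)
        ((h.chart i).injOn_symm.mono hsub) hζ hζ' ((h.chart i).deriv_symm_ne_zero hζρ)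
      have hFi : F i ζ = modelSum X (ρ / 2) t α (S (vtx G i)) g ((X.z i.1 i.2).symm ζ) *
          deriv (X.z i.1 i.2).symm ζ := rfl
      rw [hj, hFi, modelSum_eq_add hS, hmodel, chartForm]
      ring
  -- The defects at the two ends are exchanged by `reflect` up to sign, because `reflect` is an
  -- involution.
  refine sub_eq_zero.1 (eq_zero_of_eq_neg_reflect (Δ := fun ζ => F i ζ -
    reflect (t i.1) (F (opp i)) ζ) (Δ' := fun ζ => F (opp i) ζ - reflect (t i.1) (F i) ζ) hti hr
    (period_radius hρ (ht _)) (hext i hti) ?_ ?_ hζ hζ')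
  · have := hext (opp i) hti
    simpa only [opp, Bool.not_not] using this
  · intro w hw _
    have hw0 : w ≠ 0 := by
      rintro rfl
      rw [norm_zero] at hw
      exact absurd hw (not_lt.2 (by positivity))
    have h1 := reflect_reflect hti (F i) hw0
    have h2 : reflect (t i.1) (fun ζ => F (opp i) ζ - reflect (t i.1) (F i) ζ) w =
        reflect (t i.1) (F (opp i)) w - reflect (t i.1) (reflect (t i.1) (F i)) w := by
      simp only [reflect]
      ring
    rw [h2, h1]
    ring

/-- A family `g` with the fixed point property defines a regular differential. -/
theorem exists_regularDifferential (h : X.Admissible G ρ c₁ c₂) (ht : ∀ e, ‖t e‖ < ρ ^ 2 / 4)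
    (hS : ∀ v i, i ∈ S v ↔ vtx G i = v) (hα : ∀ v, ∑ i ∈ S v, sgn i.2 * α i.1 = 0)
    (hg : ∀ i, ContinuousOn (g i) (sphere 0 (ρ / 2)))
    (hfix : ∀ i, ∀ w ∈ sphere (0 : ℂ) (ρ / 2),
      g i w = endForm G X (fun v => modelSum X (ρ / 2) t α (S v) g) i w) :
    ∃ f : V → ℂ → ℂ, IsRegularDifferential G X ρ t f ∧
      (∀ v, ∀ z ∈ region G X t (ρ / 2) v, f v z = modelSum X (ρ / 2) t α (S v) g z) ∧
      ∀ e, (∮ w in C(0, ρ / 2), endForm G X f (e, true) w) = α e := by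
  classical
  have hρ := h.rho_pos
  have hr : 0 < ρ / 2 := by positivity
  have hrρ : ρ / 2 < ρ := by linarith
  set F := endForm G X (fun v => modelSum X (ρ / 2) t α (S v) g) with hF
  have hFd : ∀ i : E × Bool, DifferentiableOn ℂ (F i) {w | ‖t i.1‖ / (ρ / 2) < ‖w‖ ∧ ‖w‖ < ρ} :=
    differentiableOn_endForm_modelSum h ht hS hg
  have hFP : ∀ i : E × Bool, t i.1 ≠ 0 → ∀ ζ, ‖t i.1‖ / (ρ / 2) < ‖ζ‖ → ‖ζ‖ < ρ / 2 →
      F i ζ = reflect (t i.1) (F (opp i)) ζ := fun i hti ζ hζ hζ' =>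
    endForm_modelSum_eq_reflect h ht hS hg hfix i hti hζ hζ'
  let D : E × Bool → Set ℂ := fun i =>
    openDisk (X.z i.1 i.2) (ρ / 2) \ closedDisk (X.z i.1 i.2) (‖t i.1‖ / ρ)
  have htρ : ∀ e, ‖t e‖ / ρ < ρ := by
    intro e
    rw [div_lt_iff₀ hρ]
    nlinarith [ht e]
  have hregion_open : ∀ v, IsOpen (region G X t (ρ / 2) v) := isOpen_region h
    (fun e => (period_radius hρ (ht e)).trans hrρ) hS
  -- The model sum is defined only for |z_i| > |t|/(ρ/2), while the surface reaches down to |t|/ρ.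
  -- On the annulus |t|/ρ < |z_i| < ρ/2 the differential is defined by reflecting the model sum of
  -- the other end; the two definitions agree on the overlap by `hFP`.
  choose Φ hΦ1 hΦ2 hΦ using fun v : V => exists_piecewise_differentiable
    (ι := {i : E × Bool // vtx G i = v ∧ t i.1 ≠ 0}) (W := region G X t (ρ / 2) v)
    (D := fun i => D i) (u := modelSum X (ρ / 2) t α (S v) g)
    (e := fun i z => reflect (t i.1.1) (F (opp i)) (X.z i.1.1 i.1.2 z) *
      deriv (X.z i.1.1 i.1.2) z) (hregion_open v)
    (fun i => (IsDiskChart.isOpen_openDisk _).sdiff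
      ((h.chart i.1).isCompact_closedDisk (htρ _)).isClosed)
    (fun i j hij => (h.disjoint_source (fun h => hij (Subtype.ext h))
      (i.2.1.trans j.2.1.symm)).mono (fun z hz => hz.1.1) (fun z hz => hz.1.1))
    (differentiableOn_modelSum h ht hS hg v)
    (fun i => by
      have hsrc : D i ⊆ (X.z i.1.1 i.1.2).source := fun z hz => hz.1.1
      refine DifferentiableOn.mul ((differentiableOn_reflect i.2.2 hρ (hFd (opp i))).comp
        ((h.chart i.1).holo.mono hsrc) fun z hz => ⟨?_, hz.1.2⟩)
        (((h.chart i.1).holo.deriv (X.z i.1.1 i.1.2).open_source).mono hsrc)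
      by_contra hle
      exact hz.2 ⟨hz.1.1, not_lt.1 hle⟩)
    (fun i z hz => by
      obtain ⟨⟨e, b⟩, rfl, hti⟩ := i
      have hz1 : ‖t e‖ / (ρ / 2) < ‖X.z e b z‖ := by
        by_contra hle
        exact hz.1 (e, b) rfl ⟨hz.2.1.1, not_lt.1 hle⟩
      have h1 := hFP (e, b) hti _ hz1 hz.2.1.2
      simp only at h1 ⊢
      rw [← h1]
      exact (h.chart (e, b)).chartForm_apply hz.2.1.1)
  have hcover : ∀ v, part G X ρ t v ⊆ region G X t (ρ / 2) v ∪
      ⋃ i : {i : E × Bool // vtx G i = v ∧ t i.1 ≠ 0}, D i := by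
    intro v z hz
    by_cases hzr : z ∈ region G X t (ρ / 2) v
    · exact Or.inl hzr
    · simp only [region, mem_ofPred_eq, not_forall, not_not] at hzr
      obtain ⟨i, hi, hzi⟩ := hzr
      rw [part_eq_region] at hz
      have hti : t i.1 ≠ 0 := by
        intro h0
        have := hz i hi
        rw [h0, norm_zero, zero_div] at this hzi
        exact this hzi
      exact Or.inr (mem_iUnion.2 ⟨⟨i, hi, hti⟩,
        ⟨hzi.1, hzi.2.trans_lt (period_radius hρ (ht _))⟩, hz i hi⟩)
  have hpart : ∀ v, region G X t (ρ / 2) v ⊆ part G X ρ t v := fun v => by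
    rw [part_eq_region]
    exact region_anti hr hrρ.le v
  let f : V → ℂ → ℂ := fun v z => if z ∈ part G X ρ t v then Φ v z else 0
  have hf1 : ∀ v, ∀ z ∈ region G X t (ρ / 2) v, f v z = modelSum X (ρ / 2) t α (S v) g z := by
    intro v z hz
    simp only [f, if_pos (hpart v hz)]
    exact hΦ1 v hz
  have hE1 : ∀ i ζ, ‖t i.1‖ / (ρ / 2) < ‖ζ‖ → ‖ζ‖ < ρ → endForm G X f i ζ = F i ζ := by
    intro i ζ hζ hζ'
    simp only [hF, endForm, chartForm]
    rw [hf1 _ _ (h.sdiff_subset_region i (ρ / 2) ⟨(h.chart i).symm_mem hζ',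
      (h.chart i).symm_notMem_closedDisk hζ' hζ⟩)]
  have hE2 : ∀ i : E × Bool, t i.1 ≠ 0 → ∀ ζ, ‖t i.1‖ / ρ < ‖ζ‖ → ‖ζ‖ < ρ / 2 →
      endForm G X f i ζ = reflect (t i.1) (F (opp i)) ζ := by
    intro i hti ζ hζ hζ'
    have hζρ := hζ'.trans hrρ
    have hzD : (X.z i.1 i.2).symm ζ ∈ D i := ⟨(h.chart i).symm_mem_openDisk hζρ hζ',
      (h.chart i).symm_notMem_closedDisk hζρ hζ⟩
    have hzp : (X.z i.1 i.2).symm ζ ∈ part G X ρ t (vtx G i) := by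
      rw [part_eq_region]
      exact h.sdiff_subset_region i ρ ⟨hzD.1.1, hzD.2⟩
    have h1 := hΦ2 (vtx G i) ⟨i, rfl, hti⟩ hzD
    have h2 := (h.chart i).deriv_mul_deriv_symm hζρ
    have h3 := (h.chart i).apply_symm hζρ
    simp only at h1
    simp only [endForm, chartForm, f, if_pos hzp]
    rw [h1, h3, mul_assoc, h2, mul_one]
  refine ⟨f, ⟨fun v z hz => if_neg hz, fun v => ?_, fun v => ?_, fun e he z hz => ?_,
    fun e he => ?_⟩, hf1, fun e => ?_⟩
  · refine ((hΦ v).mono (hcover v)).congr fun z hz => if_pos hz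
  · have hev := IsRegularDifferential.eventually_mem_region h ht (hS v)
    refine HolomorphicAtInfinity.of_tendsto_mul ?_
      ((tendsto_mul_modelSum h ht hg v (hα v)).congr' ?_)
    · filter_upwards [hev] with z hz
      refine ((differentiableOn_modelSum (α := α) h ht hS hg v).differentiableAt
        ((hregion_open v).mem_nhds hz)).congr_of_eventuallyEq ?_
      filter_upwards [(hregion_open v).mem_nhds hz] with w hw using hf1 v w hw
    · filter_upwards [hev] with z hz
      rw [hf1 v z hz]
  · have c0 := h.chart (e, false)
    have hz1 := (h.chart (e, false)).norm_lt hz.1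
    simp only at hz1
    have hann := norm_div_mem_annulus he hz.2 hz1 hρ
    have hmain := (glue_eq_iff h f he hz.2 hz1).2 ?_
    · rwa [(X.z e false).left_inv hz.1] at hmain
    -- Of two glued points, one satisfies |z_i| < ρ/2 and carries the reflected definition, while
    -- the other lies in the range of the model sum. Which one it is depends on |z_e^-|; in the
    -- second case the involution is used.
    · by_cases hlt : ‖X.z e false z‖ < ρ / 2
      · have h1 := hE2 (e, false) he _ hz.2 hlt
        rw [h1]
        simp only [reflect, opp, Bool.not_false]
        have h2 := norm_div_mem_annulus he hz.2 hlt hρ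
        rw [hE1 (e, true) _ h2.1 h2.2]
      · have hge : ρ / 2 ≤ ‖X.z e false z‖ := not_lt.1 hlt
        have hdiv : ‖t e / X.z e false z‖ ≤ ‖t e‖ / (ρ / 2) := by
          rw [norm_div]
          exact div_le_div_of_nonneg_left (norm_nonneg _) hr hge
        have hsmall := period_radius hρ (ht e)
        have h1 := hE1 (e, false) (X.z e false z) (hsmall.trans_le hge) hz1
        have h2 := hE2 (e, true) he _ hann.1 (hdiv.trans_lt hsmall)
        have hz0 : X.z e false z ≠ 0 := norm_pos_iff.1 (hr.trans_le hge)
        have h3 := reflect_reflect he (F (e, false)) hz0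
        rw [h1, ← h3]
        simp only [reflect] at h2 ⊢
        rw [h2]
        simp only [opp, Bool.not_true]
  -- At t = 0 the model part is exactly the pole, and the parts of the other ends are holomorphic at
  -- p.
  · have key : ∀ b, HasSimplePoleAt (f (vtx G (e, b))) (X.p e b)
        (sgn b * ((2 * π * I)⁻¹ * α e)) := by
      intro b
      have c := h.chart (e, b)
      simp only at c
      refine ⟨modelSum X (ρ / 2) t α ((S (vtx G (e, b))).erase (e, b)) g,
        (differentiableOn_modelSum_erase h ht hS hg (e, b)).analyticAt
          ((X.z e b).open_source.mem_nhds c.p_mem), ?_⟩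
      filter_upwards [self_mem_nhdsWithin, nhdsWithin_le_nhds ((X.z e b).open_source.mem_nhds
        c.p_mem)] with z hz hzs
      have hz : z ≠ X.p e b := hz
      have hzr : z ∈ region G X t (ρ / 2) (vtx G (e, b)) := by
        refine h.sdiff_subset_region (e, b) (ρ / 2) ⟨hzs, fun hzd => hz ?_⟩
        have h1 := c.upper z hzs
        have h2 := hzd.2
        simp only [he, norm_zero, zero_div] at h2
        rw [norm_le_zero_iff.1 h2, norm_zero, mul_zero] at h1
        exact sub_eq_zero.1 (norm_le_zero_iff.1 h1)
      rw [hf1 _ z hzr, modelSum_eq_add hS (ρ / 2) (e, b) z]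
      simp only [he, c.modelPart_zero]
      ring
    refine ⟨(2 * π * I)⁻¹ * α e, ?_, ?_⟩
    · have := key false
      simpa [sgn, vtx, OrientedMultigraph.vert] using this
    · have := key true
      simpa [sgn, vtx, OrientedMultigraph.vert] using this
  · have h1 := circleIntegral_endForm_modelSum (α := α) h ht hS hg (e, true)
    simp only [sgn, if_true, one_mul] at h1
    rw [← h1]
    refine circleIntegral.integral_congr hr.le fun w hw => ?_
    rw [mem_sphere_zero_iff_norm] at hw
    exact hE1 (e, true) w (by rw [hw]; exact period_radius hρ (ht e)) (by rw [hw]; exact hrρ)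

end

end Construction

/-! ### The contraction on families of functions on circles -/

section FixedPoint

open Complex Metric Set Filter
open scoped Real

/-- The model part is linear in the pair (a, g). Two iterates with the same periods therefore differ
by a model part with a = 0, in which only the O(|t|) term is present. -/
theorem modelPart_sub {φ : OpenPartialHomeomorph ℂ ℂ} {p : ℂ} {ρ c₁ c₂ : ℝ}
    (h : IsDiskChart φ p ρ c₁ c₂) {r : ℝ} {t : ℂ} (hr : 0 < r) (ht : ‖t‖ / r < ρ) (a a' : ℂ)
    {g g' : ℂ → ℂ} (hg : ContinuousOn g (sphere 0 r)) (hg' : ContinuousOn g' (sphere 0 r)) {z : ℂ}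
    (hz : z ∉ closedDisk φ (‖t‖ / r)) :
    modelPart φ p r t a g z - modelPart φ p r t a' g' z =
      modelPart φ p r t (a - a') (fun w => g w - g' w) z := by
  have hq := h.continuousOn_symm_div hr ht
  have hz' : z ∉ (fun w => φ.symm (t / w)) '' sphere 0 r := by
    rintro ⟨w, hw, rfl⟩
    have h1 : ‖t / w‖ = ‖t‖ / r := IsDiskChart.norm_div_of_mem_sphere hw
    have h2 : ‖t / w‖ < ρ := h1.trans_lt ht
    exact hz ⟨h.symm_mem h2, by rw [h.apply_symm h2, h1]⟩
  have h1 := circleIntegral.integral_sub (hg.circleIntegrable hr.le) (hg'.circleIntegrable hr.le)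
  have h2 := circleIntegral.integral_sub (circleIntegrable_cauchyInt hr.le hg hq hz')
    (circleIntegrable_cauchyInt hr.le hg' hq hz')
  simp only [modelPart, cauchyInt, h1, sub_mul, h2]
  ring

/-- Extension by zero of a function on a circle. -/
def sphereExtend {r : ℝ} (g : C(sphere (0 : ℂ) r, ℂ)) (w : ℂ) : ℂ := by
  classical exact if h : w ∈ sphere (0 : ℂ) r then g ⟨w, h⟩ else 0

theorem sphereExtend_apply {r : ℝ} (g : C(sphere (0 : ℂ) r, ℂ)) {w : ℂ}
    (hw : w ∈ sphere (0 : ℂ) r) : sphereExtend g w = g ⟨w, hw⟩ := dif_pos hw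

theorem continuousOn_sphereExtend {r : ℝ} (g : C(sphere (0 : ℂ) r, ℂ)) :
    ContinuousOn (sphereExtend g) (sphere 0 r) := by
  rw [continuousOn_iff_continuous_domRestrict]
  refine g.continuous.congr fun w => ?_
  rw [domRestrict_apply, sphereExtend_apply g w.2]

theorem norm_sphereExtend_le {r : ℝ} (g : C(sphere (0 : ℂ) r, ℂ)) {w : ℂ}
    (hw : w ∈ sphere (0 : ℂ) r) : ‖sphereExtend g w‖ ≤ ‖g‖ := by
  rw [sphereExtend_apply g hw]
  exact g.norm_coe_le_norm _

variable {V E : Type*} {G : OrientedMultigraph V E} {X : NodeCoordinates E} {ρ c₁ c₂ ε : ℝ}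
  {t : E → ℂ} {S : V → Finset (E × Bool)} {α : E → ℂ}

theorem norm_modelSum_le (h : X.Admissible G ρ c₁ c₂) (hε : 0 < ε)
    (hs : SmallParameters ρ c₂ ε t) {g : E × Bool → ℂ → ℂ}
    (hg : ∀ i, ContinuousOn (g i) (sphere 0 (ρ / 2))) {A N τ : ℝ} (hA : ∀ e, ‖α e‖ ≤ A)
    (hτ : ∀ e, ‖t e‖ ≤ τ) (hN0 : 0 ≤ N) (hN : ∀ i, ∀ w ∈ sphere (0 : ℂ) (ρ / 2), ‖g i w‖ ≤ N)
    {T : Finset (E × Bool)} {z : ℂ} (hz : ∀ i ∈ T, ε / 2 ≤ ‖z - X.p i.1 i.2‖) :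
    ‖modelSum X (ρ / 2) t α T g z‖ ≤
      T.card * (A / (ε / 2) + 2 * c₂ / (ε / 2) ^ 2 * τ * N) := by
  have hρ := h.rho_pos
  have hc₂ := h.c₂_pos
  rw [← nsmul_eq_mul]
  refine (norm_sum_le _ _).trans (Finset.sum_le_card_nsmul _ _ _ fun i hi => ?_)
  have h1 := (h.chart i).norm_modelPart_le (a := sgn i.2 * α i.1) (by positivity)
    ((period_radius hρ (hs.lt_sq i.1)).trans (by linarith)) (hg (opp i)) (by positivity)
    (hs.le_eps i.1) (hN (opp i)) (hz i hi)
  rw [norm_mul, norm_sgn, one_mul] at h1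
  refine h1.trans ?_
  have h2 := hA i.1
  have h3 := hτ i.1
  gcongr

/-- The restrictions to the circles `|z_e^±| = ρ / 2` of a sum of model parts. -/
def restrictModel (h : X.Admissible G ρ c₁ c₂) (ht : ∀ e, ‖t e‖ < ρ ^ 2 / 4)
    (hS : ∀ v i, i ∈ S v ↔ vtx G i = v) (α : E → ℂ)
    (g : E × Bool → C(sphere (0 : ℂ) (ρ / 2), ℂ)) (i : E × Bool) :
    C(sphere (0 : ℂ) (ρ / 2), ℂ) where
  toFun w := endForm G X
    (fun v => modelSum X (ρ / 2) t α (S v) fun i => sphereExtend (g i)) i w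
  continuous_toFun := by
    have hρ := h.rho_pos
    have h1 := (differentiableOn_endForm_modelSum (α := α) h ht hS
      (fun i => continuousOn_sphereExtend (g i)) i).continuousOn
    have h2 : ContinuousOn (endForm G X
        (fun v => modelSum X (ρ / 2) t α (S v) fun i => sphereExtend (g i)) i)
        (sphere 0 (ρ / 2)) := by
      refine h1.mono fun w hw => ?_
      rw [mem_sphere_zero_iff_norm] at hw
      rw [mem_ofPred_eq, hw]
      exact ⟨period_radius hρ (ht _), by linarith⟩
    exact h2.domRestrict

theorem norm_endForm_modelSum_le (h : X.Admissible G ρ c₁ c₂) (hε : 0 < ε) (hε' : ε ≤ ρ * c₁)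
    (hs : SmallParameters ρ c₂ ε t) (hS : ∀ v i, i ∈ S v ↔ vtx G i = v) {k : ℕ}
    (hk : ∀ v, (S v).card ≤ k) {g : E × Bool → ℂ → ℂ}
    (hg : ∀ i, ContinuousOn (g i) (sphere 0 (ρ / 2))) {A N τ : ℝ} (hA0 : 0 ≤ A) (hτ0 : 0 ≤ τ)
    (hA : ∀ e, ‖α e‖ ≤ A) (hτ : ∀ e, ‖t e‖ ≤ τ) (hN0 : 0 ≤ N)
    (hN : ∀ i, ∀ w ∈ sphere (0 : ℂ) (ρ / 2), ‖g i w‖ ≤ N) (i : E × Bool) {w : ℂ}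
    (hw : w ∈ sphere (0 : ℂ) (ρ / 2)) :
    ‖endForm G X (fun v => modelSum X (ρ / 2) t α (S v) g) i w‖ ≤
      4 * c₂ * (k * (A / (ε / 2) + 2 * c₂ / (ε / 2) ^ 2 * τ * N)) := by
  have hc₂ := h.c₂_pos
  have h1 := norm_modelSum_le (z := (X.z i.1 i.2).symm w) (T := S (vtx G i)) h hε hs hg hA hτ
    hN0 hN fun j hj => h.half_le_norm_sub hε hε' ((hS _ _).1 hj).symm hw
  rw [mem_sphere_zero_iff_norm] at hw
  have h2 := (h.chart i).norm_deriv_symm_le hw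
  have h3 : ((S (vtx G i)).card : ℝ) ≤ k := by exact_mod_cast hk _
  have h4 : ‖modelSum X (ρ / 2) t α (S (vtx G i)) g ((X.z i.1 i.2).symm w)‖ ≤
      k * (A / (ε / 2) + 2 * c₂ / (ε / 2) ^ 2 * τ * N) := h1.trans (by gcongr)
  calc ‖endForm G X (fun v => modelSum X (ρ / 2) t α (S v) g) i w‖
      = ‖modelSum X (ρ / 2) t α (S (vtx G i)) g ((X.z i.1 i.2).symm w)‖ *
        ‖deriv (X.z i.1 i.2).symm w‖ := norm_mul _ _
    _ ≤ (k * (A / (ε / 2) + 2 * c₂ / (ε / 2) ^ 2 * τ * N)) * (4 * c₂) := by gcongr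
    _ = _ := by ring

/-- Existence of a fixed point, with a bound. -/
theorem exists_fixedPoint (h : X.Admissible G ρ c₁ c₂) (hε : 0 < ε) (hε' : ε ≤ ρ * c₁)
    (hs : SmallParameters ρ c₂ ε t) (hS : ∀ v i, i ∈ S v ↔ vtx G i = v) {k : ℕ}
    (hk : ∀ v, (S v).card ≤ k) {A τ : ℝ} (hA0 : 0 ≤ A) (hτ0 : 0 ≤ τ)
    (hA : ∀ e, ‖α e‖ ≤ A) (hτ : ∀ e, ‖t e‖ ≤ τ)
    (hsmall : 4 * c₂ * (k * (2 * c₂ / (ε / 2) ^ 2 * τ)) ≤ 1 / 2) :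
    ∃ g : E × Bool → ℂ → ℂ, (∀ i, ContinuousOn (g i) (sphere 0 (ρ / 2))) ∧
      (∀ i, ∀ w ∈ sphere (0 : ℂ) (ρ / 2),
        g i w = endForm G X (fun v => modelSum X (ρ / 2) t α (S v) g) i w) ∧
      ∀ i, ∀ w ∈ sphere (0 : ℂ) (ρ / 2), ‖g i w‖ ≤ 2 * (4 * c₂ * (k * (A / (ε / 2)))) := by
  have hρ := h.rho_pos
  have hc₂ := h.c₂_pos
  have bound : ∀ (g : lp (fun _ : E × Bool => C(sphere (0 : ℂ) (ρ / 2), ℂ)) ∞) (i : E × Bool),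
      ‖restrictModel h hs.lt_sq hS α g i‖ ≤
        4 * c₂ * (k * (A / (ε / 2) + 2 * c₂ / (ε / 2) ^ 2 * τ * ‖g‖)) := by
    intro g i
    refine (ContinuousMap.norm_le _ (by positivity)).2 fun w => ?_
    exact norm_endForm_modelSum_le h hε hε' hs hS hk (fun i => continuousOn_sphereExtend (g i))
      hA0 hτ0 hA hτ (norm_nonneg g)
      (fun i w hw => (norm_sphereExtend_le (g i) hw).trans (lp.norm_apply_le_norm (by simp) g i))
      i w.2
  -- The uniform `bound` over the ends makes T a self-map of a Banach space even for infinitely many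
  -- edges.
  let T : lp (fun _ : E × Bool => C(sphere (0 : ℂ) (ρ / 2), ℂ)) ∞ →
      lp (fun _ : E × Bool => C(sphere (0 : ℂ) (ρ / 2), ℂ)) ∞ := fun g =>
    ⟨fun i => restrictModel h hs.lt_sq hS α g i, memℓp_infty ⟨_, by
      rintro _ ⟨i, rfl⟩
      exact bound g i⟩⟩
  have hT : ∀ g i w, (T g i) w = endForm G X
    (fun v => modelSum X (ρ / 2) t α (S v) fun i => sphereExtend (g i)) i w := fun _ _ _ => rfl
  have hcontr : ContractingWith (1 / 2) T := by
    refine ⟨by norm_num, LipschitzWith.of_dist_le_mul fun g g' => ?_⟩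
    rw [dist_eq_norm, dist_eq_norm]
    refine lp.norm_le_of_forall_le (by positivity) fun i => ?_
    refine (ContinuousMap.norm_le _ (by positivity)).2 fun w => ?_
    have h1 : (T g - T g') i w = endForm G X (fun v => modelSum X (ρ / 2) t 0 (S v)
        fun i w => sphereExtend (g i) w - sphereExtend (g' i) w) i w := by
      rw [lp.coeFn_sub, Pi.sub_apply, ContinuousMap.sub_apply, hT, hT]
      simp only [endForm, chartForm]
      rw [← sub_mul]
      congr 1
      rw [modelSum, modelSum, modelSum, ← Finset.sum_sub_distrib]
      refine Finset.sum_congr rfl fun j hj => ?_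
      rw [modelPart_sub (h.chart j) (by positivity)
        ((period_radius hρ (hs.lt_sq j.1)).trans (by linarith)) _ _
        (continuousOn_sphereExtend _) (continuousOn_sphereExtend _)
        (h.symm_mem_region hs.lt_sq i w.2 j ((hS _ _).1 hj))]
      simp
    rw [h1]
    refine (norm_endForm_modelSum_le (A := 0) (N := ‖g - g'‖) h hε hε' hs hS hk
      (fun i => (continuousOn_sphereExtend (g i)).sub (continuousOn_sphereExtend (g' i)))
      le_rfl hτ0 (by simp) hτ (norm_nonneg _) (fun i w hw => ?_) i w.2).trans ?_
    · change ‖sphereExtend (g i) w - sphereExtend (g' i) w‖ ≤ _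
      rw [sphereExtend_apply _ hw, sphereExtend_apply _ hw, ← ContinuousMap.sub_apply]
      exact (ContinuousMap.norm_coe_le_norm (g i - g' i) _).trans
        (lp.norm_apply_le_norm (by simp) (g - g') i)
    · have := mul_le_mul_of_nonneg_right hsmall (norm_nonneg (g - g'))
      simp only [zero_div, zero_add, NNReal.coe_div, NNReal.coe_one, NNReal.coe_ofNat]
      linarith
  obtain ⟨g, hg⟩ : ∃ g, T g = g := ⟨_, hcontr.fixedPoint_isFixedPt⟩
  have hfix : ∀ i, ∀ w (hw : w ∈ sphere (0 : ℂ) (ρ / 2)), sphereExtend (g i) w = endForm G X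
      (fun v => modelSum X (ρ / 2) t α (S v) fun i => sphereExtend (g i)) i w := by
    intro i w hw
    rw [sphereExtend_apply _ hw]
    conv_lhs => rw [← hg]
    exact hT g i ⟨w, hw⟩
  -- From g = T g, ‖g‖ ≤ 4c₂kA/(ε/2) + ‖g‖/2.
  have hnorm : ‖g‖ ≤ 2 * (4 * c₂ * (k * (A / (ε / 2)))) := by
    have h1 : ‖T g‖ ≤ 4 * c₂ * (k * (A / (ε / 2) + 2 * c₂ / (ε / 2) ^ 2 * τ * ‖g‖)) :=
      lp.norm_le_of_forall_le (by positivity) fun i => bound g i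
    rw [hg] at h1
    have h2 := mul_le_mul_of_nonneg_right hsmall (norm_nonneg g)
    linarith
  exact ⟨fun i => sphereExtend (g i), fun i => continuousOn_sphereExtend (g i), hfix,
    fun i w hw => (norm_sphereExtend_le (g i) hw).trans
      ((lp.norm_apply_le_norm (by simp) g i).trans hnorm)⟩

end FixedPoint

/-! ### The period map and its inverse -/

section PeriodMap

open Complex Metric Set Filter
open scoped Real

variable {V E : Type*} {G : OrientedMultigraph V E} {X : NodeCoordinates E} {ρ c₁ c₂ ε : ℝ}
  {t : E → ℂ}

theorem exists_ends (hG : G.BoundedDegree) : ∃ (k : ℕ) (S : V → Finset (E × Bool)),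
    (∀ v i, i ∈ S v ↔ vtx G i = v) ∧ ∀ v, (S v).card ≤ k := by
  classical
  obtain ⟨k, hk⟩ := hG
  have hfin : ∀ v, (G.edgesAt v).Finite := fun v => Set.finite_of_encard_le_coe (hk v)
  have hmem : ∀ i : E × Bool, i.1 ∈ G.edgesAt (vtx G i) := by
    rintro ⟨e, b⟩
    cases b
    exacts [Or.inl rfl, Or.inr rfl]
  -- `k` bounds the number of edges at a vertex, but a loop has both of its ends there.
  refine ⟨k * 2, fun v => ((hfin v).toFinset ×ˢ Finset.univ).filter fun i => vtx G i = v,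
    fun v i => ?_, fun v => ?_⟩
  · simp only [Finset.mem_filter, Finset.mem_product, Finite.mem_toFinset, Finset.mem_univ,
      and_true, and_iff_right_iff_imp]
    rintro rfl
    exact hmem i
  · refine (Finset.card_filter_le _ _).trans ?_
    rw [Finset.card_product, Finset.card_univ, Fintype.card_bool]
    have h1 := hk v
    rw [(hfin v).encard_eq_coe_toFinset_card] at h1
    exact Nat.mul_le_mul_right 2 (by exact_mod_cast h1)

theorem mem_compatible_iff (hG : G.BoundedDegree) {S : V → Finset (E × Bool)}
    (hS : ∀ v i, i ∈ S v ↔ vtx G i = v) (α : lp (fun _ : E => ℂ) ∞) :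
    α ∈ compatible G hG ↔ ∀ v, ∑ i ∈ S v, sgn i.2 * α i.1 = 0 := by
  refine forall_congr' fun v => ?_
  have hset : {i : E × Bool | i ∈ S v} =
      (fun e => (e, false)) '' {e | G.src e = v} ∪ (fun e => (e, true)) '' {e | G.tgt e = v} := by
    ext ⟨e, b⟩
    simp only [mem_ofPred_eq, hS]
    cases b <;> simp [vtx, OrientedMultigraph.vert]
  have hfin : {i : E × Bool | i ∈ S v}.Finite := (S v).finite_toSet
  have hdisj : Disjoint ((fun e : E => (e, false)) '' {e | G.src e = v})
      ((fun e => (e, true)) '' {e | G.tgt e = v}) := by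
    rw [disjoint_left]
    rintro _ ⟨e, -, rfl⟩ ⟨e', -, h⟩
    simp at h
  have hsum : ∑ i ∈ S v, sgn i.2 * α i.1 =
      ∑ᶠ e ∈ {e | G.tgt e = v}, α e - ∑ᶠ e ∈ {e | G.src e = v}, α e := by
    have h1 : ∑ i ∈ S v, sgn i.2 * α i.1 = ∑ᶠ i ∈ {i : E × Bool | i ∈ S v}, sgn i.2 * α i.1 :=
      (finsum_mem_coe_finset (fun i : E × Bool => sgn i.2 * α i.1) (S v)).symm
    rw [hset] at h1 hfin
    have hf1 := hfin.subset subset_union_left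
    have hf2 := hfin.subset subset_union_right
    have hi1 : InjOn (fun e : E => (e, false)) {e | G.src e = v} := fun a _ b _ h => by simpa using h
    have hi2 : InjOn (fun e : E => (e, true)) {e | G.tgt e = v} := fun a _ b _ h => by simpa using h
    rw [h1, finsum_mem_union hdisj hf1 hf2, finsum_mem_image hi1, finsum_mem_image hi2]
    have h2 : ∑ᶠ e ∈ {e | G.src e = v}, sgn (e, false).2 * α (e, false).1 =
        -∑ᶠ e ∈ {e | G.src e = v}, α e := by
      simp only [sgn, Bool.false_eq_true, if_false, neg_one_mul]
      exact finsum_mem_neg_distrib _ (Finite.of_finite_image hf1 hi1)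
    have h3 : ∑ᶠ e ∈ {e | G.tgt e = v}, sgn (e, true).2 * α (e, true).1 =
        ∑ᶠ e ∈ {e | G.tgt e = v}, α e := by
      simp only [sgn, if_true, one_mul]
    simp only at h2 h3 ⊢
    rw [h2, h3]
    ring
  rw [hsum, sub_eq_zero]
  exact eq_comm

theorem isClosed_compatible (hG : G.BoundedDegree) :
    IsClosed (compatible G hG : Set (lp (fun _ : E => ℂ) ∞)) := by
  obtain ⟨k, S, hS, -⟩ := exists_ends hG
  have : (compatible G hG : Set (lp (fun _ : E => ℂ) ∞)) =
      ⋂ v, {α | ∑ i ∈ S v, sgn i.2 * α i.1 = 0} := by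
    ext α
    simp only [SetLike.mem_coe, mem_compatible_iff hG hS, mem_iInter, mem_ofPred_eq]
  rw [this]
  refine isClosed_iInter fun v => isClosed_eq (continuous_finsetSum _ fun i _ => ?_)
    continuous_const
  exact continuous_const.mul ((continuous_apply i.1).comp lp.uniformContinuous_coe.continuous)

theorem H1.norm_coeff_le (ω : H1 G X ρ t ε) (v : V) {z : ℂ} (hz : z ∈ core G X ε v) :
    ‖ω.1 v z‖ ≤ ‖ω‖ := by
  rw [H1.norm_def]
  exact le_ciSup ω.bddAbove (⟨v, z, hz⟩ : Σ v : V, ↥(core G X ε v))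

theorem H1.norm_le (ω : H1 G X ρ t ε) {C : ℝ} (hC : 0 ≤ C)
    (h : ∀ v, ∀ z ∈ core G X ε v, ‖ω.1 v z‖ ≤ C) : ‖ω‖ ≤ C := by
  rw [H1.norm_def]
  exact Real.iSup_le (fun x => h x.1 x.2 x.2.2) hC

/-- Both radii exceed |t|/ρ and are below ρ, so the circles are homotopic in the annulus where the
differential is holomorphic. The radius ρ/2, independent of t, is the one used in all estimates. -/
theorem IsRegularDifferential.circleIntegral_eq {f : V → ℂ → ℂ}
    (hf : IsRegularDifferential G X ρ t f) (h : X.Admissible G ρ c₁ c₂) {e : E}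
    (ht : ‖t e‖ < ρ ^ 2 / 4) :
    (∮ w in C(0, (‖t e‖ / ρ + ρ) / 2), endForm G X f (e, true) w) =
      ∮ w in C(0, ρ / 2), endForm G X f (e, true) w := by
  have hρ := h.rho_pos
  have h0 : 0 ≤ ‖t e‖ / ρ := by positivity
  have h1 : ‖t e‖ / ρ < ρ / 2 := by
    rw [div_lt_iff₀ hρ]
    nlinarith
  exact circleIntegral_eq_of_annulus (by positivity) h1 (by linarith) (by linarith)
    (hf.differentiableOn_endForm h (e, true))

theorem H1.period_eq (h : X.Admissible G ρ c₁ c₂) (ω : H1 G X ρ t ε) {e : E}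
    (ht : ‖t e‖ < ρ ^ 2 / 4) :
    ω.period e = ∮ w in C(0, ρ / 2), endForm G X ω.1 (e, true) w :=
  ω.2.1.circleIntegral_eq h ht

theorem H1.period_add (h : X.Admissible G ρ c₁ c₂) (ω η : H1 G X ρ t ε) {e : E}
    (ht : ‖t e‖ < ρ ^ 2 / 4) : (ω + η).period e = ω.period e + η.period e := by
  have hr : (0 : ℝ) ≤ ρ / 2 := by linarith [h.rho_pos]
  rw [period_eq h _ ht, period_eq h _ ht, period_eq h _ ht, ← circleIntegral.integral_add
    ((ω.2.1.continuousOn_endForm h (e, true) ht).circleIntegrable hr)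
    ((η.2.1.continuousOn_endForm h (e, true) ht).circleIntegrable hr)]
  refine circleIntegral.integral_congr hr fun w _ => ?_
  exact add_mul (ω.1 (vtx G (e, true)) _) (η.1 (vtx G (e, true)) _) _

theorem H1.period_smul (h : X.Admissible G ρ c₁ c₂) (c : ℂ) (ω : H1 G X ρ t ε) {e : E}
    (ht : ‖t e‖ < ρ ^ 2 / 4) : (c • ω).period e = c * ω.period e := by
  have hr : (0 : ℝ) ≤ ρ / 2 := by linarith [h.rho_pos]
  rw [period_eq h _ ht, period_eq h _ ht, ← circleIntegral.integral_const_mul]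
  refine circleIntegral.integral_congr hr fun w _ => ?_
  exact mul_assoc c (ω.1 (vtx G (e, true)) _) _

/-- The factor which governs all smallness conditions. -/
def smallnessFactor (c₂ ε : ℝ) (k : ℕ) : ℝ :=
  8 * c₂ * (8 * π + 2) * (2 * c₂ / (ε / 2) ^ 2) * (k + 1)

section

variable {S : V → Finset (E × Bool)} {k : ℕ} {τ : ℝ}

theorem smallness_neck (hc₂ : 0 < c₂) (hτ0 : 0 ≤ τ)
    (hτ : smallnessFactor c₂ ε k * τ ≤ 1 / 2) :
    4 * c₂ * ((8 * π + 2) * (2 * c₂ / (ε / 2) ^ 2)) * τ ≤ 1 / 2 := by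
  refine le_trans ?_ hτ
  have hπ := Real.pi_pos
  set K := 2 * c₂ / (ε / 2) ^ 2
  have hK : 0 ≤ K := by positivity
  have hk : (0 : ℝ) ≤ k := Nat.cast_nonneg k
  have h0 : 0 ≤ c₂ * (8 * π + 2) * K * τ := by positivity
  have h1 : 0 ≤ c₂ * (8 * π + 2) * K * τ * k := by positivity
  rw [smallnessFactor]
  linarith

theorem smallness_contraction (hc₂ : 0 < c₂) (hτ0 : 0 ≤ τ)
    (hτ : smallnessFactor c₂ ε k * τ ≤ 1 / 2) :
    4 * c₂ * (k * (2 * c₂ / (ε / 2) ^ 2 * τ)) ≤ 1 / 2 := by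
  refine le_trans ?_ hτ
  have hπ := Real.pi_pos
  set K := 2 * c₂ / (ε / 2) ^ 2
  have hK : 0 ≤ K := by positivity
  have hk : (0 : ℝ) ≤ k := Nat.cast_nonneg k
  have h0 : 0 ≤ c₂ * K * τ := by positivity
  have h1 : 0 ≤ c₂ * K * τ * k := by positivity
  have h2 : 0 ≤ π * (c₂ * K * τ) := by positivity
  have h3 : 0 ≤ π * (c₂ * K * τ * k) := by positivity
  rw [smallnessFactor]
  linarith

theorem smallness_injective (hc₂ : 0 < c₂) (hτ0 : 0 ≤ τ)
    (hτ : smallnessFactor c₂ ε k * τ ≤ 1 / 2) :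
    k * (2 * c₂ / (ε / 2) ^ 2 * τ * (2 * (4 * c₂ * (1 + 8 * π)))) ≤ 1 / 2 := by
  refine le_trans ?_ hτ
  have hπ := Real.pi_pos
  set K := 2 * c₂ / (ε / 2) ^ 2
  have hK : 0 ≤ K := by positivity
  have hk : (0 : ℝ) ≤ k := Nat.cast_nonneg k
  have h0 : 0 ≤ c₂ * K * τ := by positivity
  have h1 : 0 ≤ c₂ * K * τ * k := by positivity
  have h2 : 0 ≤ π * (c₂ * K * τ) := by positivity
  have h3 : 0 ≤ π * (c₂ * K * τ * k) := by positivity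
  rw [smallnessFactor]
  linarith

/-- Continuity of the period map: the core norm bounds the neck circles by
`norm_endForm_le_of_small`, and this bound is fed into the contour estimate with M = ‖ω‖. -/
theorem H1.norm_period_le (h : X.Admissible G ρ c₁ c₂) (hε : 0 < ε) (hε' : ε ≤ ρ * c₁)
    (hs : SmallParameters ρ c₂ ε t) (hS : ∀ v i, i ∈ S v ↔ vtx G i = v)
    (hτ0 : 0 ≤ τ) (htτ : ∀ e, ‖t e‖ ≤ τ) (hτ : smallnessFactor c₂ ε k * τ ≤ 1 / 2)
    (ω : H1 G X ρ t ε) (e : E) :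
    ‖ω.period e‖ ≤
      2 * π * ε * (1 + 2 * c₂ / (ε / 2) ^ 2 * τ * (2 * (4 * c₂ * (1 + 8 * π)))) * ‖ω‖ := by
  have hc₂ := h.c₂_pos
  have hπ := Real.pi_pos
  have hα : ∀ e, ω.period e = ∮ w in C(0, ρ / 2), endForm G X ω.1 (e, true) w := fun e =>
    ω.period_eq h (hs.lt_sq e)
  have hsm := smallness_neck (ε := ε) hc₂ hτ0 hτ
  have hM : ∀ v, ∀ z ∈ core G X ε v, ‖ω.1 v z‖ ≤ ‖ω‖ := fun v z hz => ω.norm_coeff_le v hz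
  have hN : ∀ i, ∀ w ∈ sphere (0 : ℂ) (ρ / 2), ‖endForm G X ω.1 i w‖ ≤
      2 * (4 * c₂ * ((1 + 8 * π) * ‖ω‖)) := fun i w hw =>
    ω.2.1.norm_endForm_le_of_small h hε hε' hS hα hs hM (fun e =>
      (mul_le_mul_of_nonneg_left (htτ e) (by positivity)).trans hsm) i hw
  have h1 := ω.2.1.norm_period_le h hε hε' hS hα hs hM (e, true) (hN (opp (e, true)))
  have h2 : 2 * c₂ / (ε / 2) ^ 2 * ‖t e‖ * (2 * (4 * c₂ * ((1 + 8 * π) * ‖ω‖))) ≤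
      2 * c₂ / (ε / 2) ^ 2 * τ * (2 * (4 * c₂ * ((1 + 8 * π) * ‖ω‖))) := by
    have := htτ e
    gcongr
  have h3 : 0 ≤ 2 * π * ε := by positivity
  have h4 := mul_le_mul_of_nonneg_left h2 h3
  simp only at h1
  linarith

/-- The period map is injective. -/
theorem H1.eq_zero_of_period (h : X.Admissible G ρ c₁ c₂) (hε : 0 < ε) (hε' : ε ≤ ρ * c₁)
    (hs : SmallParameters ρ c₂ ε t) (hS : ∀ v i, i ∈ S v ↔ vtx G i = v)
    (hk : ∀ v, (S v).card ≤ k) (hτ0 : 0 ≤ τ) (htτ : ∀ e, ‖t e‖ ≤ τ)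
    (hτ : smallnessFactor c₂ ε k * τ ≤ 1 / 2) (ω : H1 G X ρ t ε) (hω : ∀ e, ω.period e = 0) :
    ω = 0 := by
  have hc₂ := h.c₂_pos
  have hπ := Real.pi_pos
  have hα : ∀ e, (0 : E → ℂ) e = ∮ w in C(0, ρ / 2), endForm G X ω.1 (e, true) w := fun e => by
    rw [← ω.period_eq h (hs.lt_sq e), hω e, Pi.zero_apply]
  have hsm := smallness_neck (ε := ε) hc₂ hτ0 hτ
  have hM : ∀ v, ∀ z ∈ core G X ε v, ‖ω.1 v z‖ ≤ ‖ω‖ := fun v z hz => ω.norm_coeff_le v hz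
  have hN : ∀ i, ∀ w ∈ sphere (0 : ℂ) (ρ / 2), ‖endForm G X ω.1 i w‖ ≤
      2 * (4 * c₂ * ((1 + 8 * π) * ‖ω‖)) := fun i w hw =>
    ω.2.1.norm_endForm_le_of_small h hε hε' hS hα hs hM (fun e =>
      (mul_le_mul_of_nonneg_left (htτ e) (by positivity)).trans hsm) i hw
  -- With zero periods each singular part reduces to its O(|t|) term, and the neck values in it are
  -- bounded by a multiple of ‖ω‖.
  have hhalf : ‖ω‖ ≤ 1 / 2 * ‖ω‖ := by
    refine ω.norm_le (by positivity) fun v z hz => ?_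
    rw [ω.2.1.eq_sum_endPart h hα hs.lt_sq (hS v) (h.core_subset_region hε hs.le_eps v hz)]
    have h1 := norm_modelSum_le (α := (0 : E → ℂ)) (A := 0) (z := z) (T := S v) h hε hs
      (fun i => ω.2.1.continuousOn_endForm h i (hs.lt_sq i.1)) (by simp) htτ (by positivity) hN
      fun i hi => by
        have := hz i.1 i.2 ((hS v i).1 hi)
        linarith
    refine h1.trans ?_
    rw [zero_div, zero_add]
    have h2 : ((S v).card : ℝ) ≤ k := by exact_mod_cast hk v
    have h3 := mul_le_mul_of_nonneg_right (smallness_injective (ε := ε) hc₂ hτ0 hτ) (norm_nonneg ω)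
    refine le_trans ?_ h3
    have h4 : 2 * c₂ / (ε / 2) ^ 2 * τ * (2 * (4 * c₂ * ((1 + 8 * π) * ‖ω‖))) =
      2 * c₂ / (ε / 2) ^ 2 * τ * (2 * (4 * c₂ * (1 + 8 * π))) * ‖ω‖ := by ring
    rw [h4, ← mul_assoc]
    gcongr
  have h0 : ‖ω‖ = 0 := le_antisymm (by linarith [norm_nonneg ω]) (norm_nonneg ω)
  -- Zero norm gives vanishing on the core only; the neck bound makes the coefficients vanish on all
  -- circles |z_i| = ρ/2, which determine ω.
  refine Subtype.ext (ω.2.1.eq_zero_of_endForm h hS hs.lt_sq fun i w hw => ?_)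
  have := hN i w hw
  rw [h0, mul_zero, mul_zero, mul_zero] at this
  exact norm_le_zero_iff.1 this

/-- The period map is surjective, with a bounded right inverse. -/
theorem H1.exists_period_eq (h : X.Admissible G ρ c₁ c₂) (hε : 0 < ε) (hε' : ε ≤ ρ * c₁)
    (hs : SmallParameters ρ c₂ ε t) (hS : ∀ v i, i ∈ S v ↔ vtx G i = v)
    (hk : ∀ v, (S v).card ≤ k) (hτ0 : 0 ≤ τ) (htτ : ∀ e, ‖t e‖ ≤ τ)
    (hτ : smallnessFactor c₂ ε k * τ ≤ 1 / 2) {α : E → ℂ} {A : ℝ} (hA0 : 0 ≤ A)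
    (hA : ∀ e, ‖α e‖ ≤ A) (hα : ∀ v, ∑ i ∈ S v, sgn i.2 * α i.1 = 0) :
    ∃ ω : H1 G X ρ t ε, (∀ e, ω.period e = α e) ∧
      ‖ω‖ ≤ k * (1 / (ε / 2) + 2 * c₂ / (ε / 2) ^ 2 * τ * (2 * (4 * c₂ * (k / (ε / 2))))) * A := by
  have hc₂ := h.c₂_pos
  obtain ⟨g, hgc, hfix, hgN⟩ := exists_fixedPoint h hε hε' hs hS hk hA0 hτ0 hA htτ
    (smallness_contraction hc₂ hτ0 hτ)
  obtain ⟨f, hf, hfg, hfα⟩ := exists_regularDifferential h hs.lt_sq hS hα hgc hfix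
  have hbound : ∀ v, ∀ z ∈ core G X ε v, ‖f v z‖ ≤
      k * (1 / (ε / 2) + 2 * c₂ / (ε / 2) ^ 2 * τ * (2 * (4 * c₂ * (k / (ε / 2))))) * A := by
    intro v z hz
    rw [hfg v z (h.core_subset_region hε hs.le_eps v hz)]
    have h1 := norm_modelSum_le (z := z) (T := S v) h hε hs hgc hA htτ (by positivity) hgN
      fun i hi => by
        have := hz i.1 i.2 ((hS v i).1 hi)
        linarith
    have h2 : ((S v).card : ℝ) ≤ k := by exact_mod_cast hk v
    refine h1.trans ((mul_le_mul_of_nonneg_right h2 (by positivity)).trans (le_of_eq ?_))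
    ring
  refine ⟨⟨f, hf, _, hbound⟩, fun e => ?_, H1.norm_le _ (by positivity) hbound⟩
  exact (hf.circleIntegral_eq h (hs.lt_sq e)).trans (hfα e)

/-- The period map is an isomorphism of Banach spaces for small parameters. -/
theorem exists_periodMap (hG : G.BoundedDegree) (h : X.Admissible G ρ c₁ c₂) (hε : 0 < ε)
    (hε' : ε ≤ ρ * c₁) (hs : SmallParameters ρ c₂ ε t) (hS : ∀ v i, i ∈ S v ↔ vtx G i = v)
    (hk : ∀ v, (S v).card ≤ k) (hτ0 : 0 ≤ τ) (htτ : ∀ e, ‖t e‖ ≤ τ)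
    (hτ : smallnessFactor c₂ ε k * τ ≤ 1 / 2) :
    ∃ L : H1 G X ρ t ε ≃L[ℂ] compatible G hG,
      ∀ (ω : H1 G X ρ t ε) (e : E), (L ω : lp (fun _ : E => ℂ) ∞) e = ω.period e := by
  have hc₂ := h.c₂_pos
  have hπ := Real.pi_pos
  have hb := H1.norm_period_le h hε hε' hs hS hτ0 htτ hτ
  have hper : ∀ ω : H1 G X ρ t ε, Memℓp ω.period ∞ := fun ω => memℓp_infty ⟨_, by
    rintro _ ⟨e, rfl⟩
    exact hb ω e⟩
  have hcompat : ∀ ω : H1 G X ρ t ε,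
      (⟨ω.period, hper ω⟩ : lp (fun _ : E => ℂ) ∞) ∈ compatible G hG := fun ω =>
    (mem_compatible_iff hG hS _).2 fun v =>
      ω.2.1.sum_sgn_mul_eq_zero h (fun e => ω.period_eq h (hs.lt_sq e)) hs.lt_sq (hS v)
  let P : H1 G X ρ t ε →ₗ[ℂ] compatible G hG :=
    { toFun := fun ω => ⟨⟨ω.period, hper ω⟩, hcompat ω⟩
      map_add' := fun ω η => Subtype.ext (lp.ext (funext fun e =>
        H1.period_add h ω η (hs.lt_sq e)))
      map_smul' := fun c ω => Subtype.ext (lp.ext (funext fun e =>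
        H1.period_smul h c ω (hs.lt_sq e))) }
  have hP : ∀ ω e, (P ω : lp (fun _ : E => ℂ) ∞) e = ω.period e := fun _ _ => rfl
  have hsurj : ∀ α : compatible G hG, ∃ ω, P ω = α ∧ ‖ω‖ ≤
      k * (1 / (ε / 2) + 2 * c₂ / (ε / 2) ^ 2 * τ * (2 * (4 * c₂ * (k / (ε / 2))))) * ‖α‖ := by
    intro α
    obtain ⟨ω, hω1, hω2⟩ := H1.exists_period_eq h hε hε' hs hS hk hτ0 htτ hτ (norm_nonneg α)
      (fun e => lp.norm_apply_le_norm (by simp) (α : lp (fun _ : E => ℂ) ∞) e)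
      ((mem_compatible_iff hG hS _).1 α.2)
    exact ⟨ω, Subtype.ext (lp.ext (funext hω1)), hω2⟩
  have hinj : Function.Injective P := by
    rw [injective_iff_map_eq_zero]
    intro ω hω
    refine H1.eq_zero_of_period h hε hε' hs hS hk hτ0 htτ hτ ω fun e => ?_
    rw [← hP, hω]
    rfl
  let L := LinearEquiv.ofBijective P ⟨hinj, fun α => (hsurj α).imp fun ω hω => hω.1⟩
  refine ⟨L.toContinuousLinearEquivOfBounds
    (2 * π * ε * (1 + 2 * c₂ / (ε / 2) ^ 2 * τ * (2 * (4 * c₂ * (1 + 8 * π)))))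
    (k * (1 / (ε / 2) + 2 * c₂ / (ε / 2) ^ 2 * τ * (2 * (4 * c₂ * (k / (ε / 2))))))
    (fun ω =>
    lp.norm_le_of_forall_le (by positivity) fun e => hb ω e) (fun α => ?_), fun ω e => hP ω e⟩
  obtain ⟨ω, hω1, hω2⟩ := hsurj α
  have : L.symm α = ω := by
    rw [LinearEquiv.symm_apply_eq]
    exact hω1.symm
  rw [this]
  exact hω2

end

theorem completeSpace_compatible (hG : G.BoundedDegree) : CompleteSpace (compatible G hG) :=
  (isClosed_compatible hG).completeSpace_coe

theorem exists_smallParameters_bound (h : X.Admissible G ρ c₁ c₂) (hε : 0 < ε) (k : ℕ) :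
    ∃ δ : ℝ, 0 < δ ∧ δ ≤ ρ ^ 2 ∧ ∀ t : E → ℂ, ∀ τ, 0 ≤ τ → τ < δ → (∀ e, ‖t e‖ ≤ τ) →
      SmallParameters ρ c₂ ε t ∧ smallnessFactor c₂ ε k * τ ≤ 1 / 2 := by
  have hρ := h.rho_pos
  have hc₂ := h.c₂_pos
  have hπ := Real.pi_pos
  have hQ : 0 < smallnessFactor c₂ ε k := by
    rw [smallnessFactor]
    positivity
  -- The second bound is c₂|t|/(ρ/2) ≤ ε/4 solved for |t|; the third makes `smallnessFactor` times τ
  -- at most 1/2.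
  refine ⟨min (min (ρ ^ 2 / 4) (ε * ρ / (8 * c₂))) (1 / 2 / smallnessFactor c₂ ε k),
    by positivity, ?_, fun t τ _ hτ ht => ⟨⟨fun e => ?_, fun e => ?_⟩, ?_⟩⟩
  · refine (min_le_left _ _).trans ((min_le_left _ _).trans ?_)
    linarith [sq_nonneg ρ]
  · exact (ht e).trans_lt (hτ.trans_le ((min_le_left _ _).trans (min_le_left _ _)))
  · have h1 := (ht e).trans (hτ.le.trans ((min_le_left _ _).trans (min_le_right _ _)))
    rw [le_div_iff₀ (by positivity)] at h1
    rw [← mul_div_assoc, div_le_iff₀ (by positivity)]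
    linarith
  · have h1 := hτ.le.trans (min_le_right _ _)
    rw [le_div_iff₀ hQ] at h1
    linarith

end PeriodMap

end OpeningNodes

end

theorem theorem2 {V E : Type*} (G : OpeningNodes.OrientedMultigraph V E)
    (hconn : G.Connected) (hdeg : G.BoundedDegree)
    (X : OpeningNodes.NodeCoordinates E) (ρ c₁ c₂ : ℝ) (hadm : X.Admissible G ρ c₁ c₂)
    (ε : ℝ) (hε : 0 < ε) (hε' : ε ≤ ρ * c₁) :
    ∃ δ : ℝ, 0 < δ ∧ δ ≤ ρ ^ 2 ∧ ∀ t : lp (fun _ : E => ℂ) ∞, ‖t‖ < δ →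
      (∀ ω : OpeningNodes.H1 G X ρ t ε, ‖ω‖ = 0 → ω = 0) ∧
      CompleteSpace (OpeningNodes.H1 G X ρ t ε) ∧
      ∃ L : OpeningNodes.H1 G X ρ t ε ≃L[ℂ] OpeningNodes.compatible G hdeg,
        ∀ (ω : OpeningNodes.H1 G X ρ t ε) (e : E),
          (L ω : lp (fun _ : E => ℂ) ∞) e = ω.period e := by
  obtain ⟨k, S, hS, hk⟩ := OpeningNodes.exists_ends hdeg
  obtain ⟨δ, hδ, hδρ, hsmall⟩ := OpeningNodes.exists_smallParameters_bound hadm hε k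
  refine ⟨δ, hδ, hδρ, fun t ht => ?_⟩
  have htn : ∀ e, ‖t e‖ ≤ ‖t‖ := fun e => lp.norm_apply_le_norm (by simp) t e
  obtain ⟨hs, hτ⟩ := hsmall t ‖t‖ (norm_nonneg t) ht htn
  obtain ⟨L, hL⟩ :=
    OpeningNodes.exists_periodMap hdeg hadm hε hε' hs hS hk (norm_nonneg t) htn hτ
  refine ⟨fun ω hω => ?_, ?_, L, hL⟩
  -- The sup over the core is a priori only a seminorm: if it vanishes, the periods vanish by
  -- continuity, and injectivity concludes.
  · refine OpeningNodes.H1.eq_zero_of_period hadm hε hε' hs hS hk (norm_nonneg t) htn hτ ω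
      fun e => norm_le_zero_iff.1 ?_
    have := OpeningNodes.H1.norm_period_le hadm hε hε' hs hS (norm_nonneg t) htn hτ ω e
    rwa [hω, mul_zero] at this
  · exact (completeSpace_congr (e := L.toEquiv) L.isUniformEmbedding).2
      (OpeningNodes.completeSpace_compatible hdeg)
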